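/- Write $\langle x\rangle=\sqrt{1+|x|^2}$ for $x\in\mathbb{R}^2$. For every $\lambda\in\mathbb{C}$ the following hold. (a) Let $N\ge 0$ be such that $\beta_0:=\frac{4-2N}{3}>1$. Then there exist a measurable potential $V:\mathbb{R}^2\to\mathbb{C}$, a function $u:\mathbb{R}^2\to\mathbb{C}$ of class $C^2$ that is not identically zero, and constants $C,c>0$ such that $$\Delta u+\lambda u=Vu \quad\text{at every point of } \mathbb{R}^2,\qquad |V(x)|\le C\langle x\rangle^{-N}\quad\text{for all }x\in\mathbb{R}^2,$$ $$|u(x)|\le C\exp\left(-c\,\frac{|x|^{\beta_0}}{\log|x|}\right)\quad\text{for all } |x|\ge 2.$$ (b) Let $P\ge 0$ be such that $\beta_0:=2-2P>1$. Then there exist a measurable vector potential $W=(W_1,W_2):\mathbb{R}^2\to\mathbb{C}^2$, a function $u:\mathbb{R}^2\to\mathbb{C}$ of class $C^2$ that is not identically zero, and constants $C,c>0$ such that $$\Delta u+\lambda u=W\cdot\nabla u \quad\text{at every point of } \mathbb{R}^2,\qquad |W(x)|\le C\langle x\rangle^{-P}\quad\text{for all }x\in\mathbb{R}^2,$$ $$|u(x)|\le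 C\exp\left(-c|x|^{\beta_0}\right)\quad\text{for all }x\in\mathbb{R}^2,$$ where $W\cdot\nabla u=W_1\,\partial_1u+W_2\,\partial_2u$. -/

import Mathlib

open scoped Laplacian

/-- The Euclidean plane. -/
abbrev Plane : Type := EuclideanSpace ℝ (Fin 2)

/-- The bracket `⟨x⟩ = √(1 + |x|²)`. -/
noncomputable def japaneseBracket (x : Plane) : ℝ := Real.sqrt (1 + ‖x‖ ^ 2)

/-- The partial derivative `∂ᵢ u` at `x` of a complex-valued function on the plane. -/
noncomputable def partialD (u : Plane → ℂ) (i : Fin 2) (x : Plane) : ℂ :=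
  fderiv ℝ u x (EuclideanSpace.single i (1 : ℝ))

/-- `(W · ∇u)(x) = W₁(x) ∂₁u(x) + W₂(x) ∂₂u(x)`, the bilinear (not conjugated) product. -/
noncomputable def dotGrad (W : Plane → EuclideanSpace ℂ (Fin 2)) (u : Plane → ℂ) (x : Plane) : ℂ :=
  ∑ i : Fin 2, W x i * partialD u i x

/-! For each `b ∈ (1/2, 1]` one function `u` serves both parts (`exists_decaying_function`): it
decays like `exp(-c|x|^(2b))`, while `|Δu + λu|` is at most a constant times `⟨x⟩^(3b-2) |u|` and
also times `⟨x⟩^(b-1) |∇u|`. Then `V = (Δu + λu)/u` has `N = 2 - 3b`, `W = (Δu + λu) conj(∇u)/|∇u|²`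
has `P = 1 - b`, and `β₀ = 2b` in both cases. The logarithm allowed in (a) is not needed.

The construction is of Meshkov type. With `t = log r`, `r²(Δ + λ) = ∂_t² + ∂_φ² + λr²`. Near the
radius `r_j` with `r_j^b = j`, `u` has angular frequency about `j²` and decays about like `r^(-j²)`.
The nodes `log r_j` are about `1/j` apart, so `log |u|` loses about `j` per step, hence about `j² =
r^(2b)` in total. As `b > 1/2`, `λ r_j²` is small against `j⁴`: it only corrects the decay rates,
which are square roots with `λr²` frozen at the node. The aim is `r²|Δu + λu| ≲ j³|u|` and `r|∇u| ≳
j²|u|`.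

To raise the frequency at node `j`, the incoming wave of frequency `j²` is joined by a wave of
frequency `(j+1)²` rotating the other way, with rate about `j² - 2j - 1`. It decays more slowly and
takes over past the node. Their sum has zeros, and there the error must vanish. So the phase of the
outgoing wave is modulated to give it the frequency `(j+1)² + (4j+2) cos(Mφ)`, `M = j² + (j+1)²`.
The zeros sit at `Mφ ≡ π` mod `2π`, where this frequency is exactly `j² - 2j - 1` and matches the
rate; `Admissible.norm_outErr_mul_le` is the quantitative form. Counter-rotation also saves the
gradient: the radial derivative sees the sum of the waves and the angular one their difference
(`two_wave_gradient`).

Between nodes a single wave without zeros is bent from the outgoing profile of one node to the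
incoming profile of the next (`bridge_helmholtz`). The innermost wave is a power of `z` near the
origin. -/

/-! ### Log-polar coordinates -/

/-- The unit vector at angle `φ`. -/
noncomputable def unitDir (φ : ℝ) : Plane :=
  Real.cos φ • EuclideanSpace.single 0 (1 : ℝ) + Real.sin φ • EuclideanSpace.single 1 (1 : ℝ)

/-- The point with log-polar coordinates `(t, φ)`. -/
noncomputable def polarPt (t φ : ℝ) : Plane := Real.exp t • unitDir φ

/-- The unit vector orthogonal to `unitDir φ`. -/
noncomputable def unitPerp (φ : ℝ) : Plane :=
  (-Real.sin φ) • EuclideanSpace.single 0 (1 : ℝ) + Real.cos φ • EuclideanSpace.single 1 (1 : ℝ)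

lemma hasDerivAt_unitDir (φ : ℝ) : HasDerivAt unitDir (unitPerp φ) φ :=
  ((Real.hasDerivAt_cos φ).smul_const _).add ((Real.hasDerivAt_sin φ).smul_const _)

lemma hasDerivAt_unitPerp (φ : ℝ) : HasDerivAt unitPerp (-unitDir φ) φ := by
  have h := ((Real.hasDerivAt_sin φ).neg.smul_const (EuclideanSpace.single 0 (1 : ℝ) : Plane)).add
    ((Real.hasDerivAt_cos φ).smul_const (EuclideanSpace.single 1 (1 : ℝ) : Plane))
  have e : -unitDir φ = -Real.cos φ • (EuclideanSpace.single 0 (1 : ℝ) : Plane)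
      + -Real.sin φ • (EuclideanSpace.single 1 (1 : ℝ) : Plane) := by
    simp only [unitDir]
    module
  rw [e]
  exact h

lemma hasDerivAt_polarPt_left (t φ : ℝ) :
    HasDerivAt (fun t => polarPt t φ) (polarPt t φ) t :=
  (Real.hasDerivAt_exp t).smul_const _

lemma hasDerivAt_polarPt_right (t φ : ℝ) :
    HasDerivAt (fun φ => polarPt t φ) (Real.exp t • unitPerp φ) φ :=
  (hasDerivAt_unitDir φ).const_smul (Real.exp t)

lemma polarPt_apply_zero (t φ : ℝ) : polarPt t φ 0 = Real.exp t * Real.cos φ := by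
  simp [polarPt, unitDir]

lemma polarPt_apply_one (t φ : ℝ) : polarPt t φ 1 = Real.exp t * Real.sin φ := by
  simp [polarPt, unitDir]

lemma norm_unitDir (φ : ℝ) : ‖unitDir φ‖ = 1 := by
  simp [unitDir, EuclideanSpace.norm_eq, Fin.sum_univ_two]

lemma norm_unitPerp (φ : ℝ) : ‖unitPerp φ‖ = 1 := by
  simp [unitPerp, EuclideanSpace.norm_eq, Fin.sum_univ_two]

lemma norm_polarPt (t φ : ℝ) : ‖polarPt t φ‖ = Real.exp t := by
  rw [polarPt, norm_smul, norm_unitDir, mul_one, Real.norm_eq_abs, abs_of_pos (Real.exp_pos t)]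

lemma log_norm_polarPt (t φ : ℝ) : Real.log ‖polarPt t φ‖ = t := by
  rw [norm_polarPt, Real.log_exp]

lemma polarPt_ne_zero (t φ : ℝ) : polarPt t φ ≠ 0 := by
  rw [← norm_pos_iff, norm_polarPt]; exact Real.exp_pos t

lemma exists_polarPt {x : Plane} (hx : x ≠ 0) : ∃ φ, x = polarPt (Real.log ‖x‖) φ := by
  have hpos : 0 < ‖x‖ := norm_pos_iff.2 hx
  have hn : ‖(⟨x 0, x 1⟩ : ℂ)‖ = ‖x‖ := by
    rw [EuclideanSpace.norm_eq, Fin.sum_univ_two, Complex.norm_eq_sqrt_sq_add_sq]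
    simp
  refine ⟨Complex.arg ⟨x 0, x 1⟩, ?_⟩
  ext i
  fin_cases i
  · have := Complex.norm_mul_cos_arg ⟨x 0, x 1⟩
    rw [hn] at this
    simpa [polarPt_apply_zero, Real.exp_log hpos] using this.symm
  · have := Complex.norm_mul_sin_arg ⟨x 0, x 1⟩
    rw [hn] at this
    simpa [polarPt_apply_one, Real.exp_log hpos] using this.symm

/-! ### The Laplacian in log-polar coordinates -/

section PolarCalculus

variable {u : Plane → ℂ} {t φ : ℝ}

lemma hasDerivAt_comp_polarPt_left (hu : DifferentiableAt ℝ u (polarPt t φ)) :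
    HasDerivAt (fun t => u (polarPt t φ)) (fderiv ℝ u (polarPt t φ) (polarPt t φ)) t :=
  hu.hasFDerivAt.comp_hasDerivAt t (hasDerivAt_polarPt_left t φ)

lemma hasDerivAt_comp_polarPt_right (hu : DifferentiableAt ℝ u (polarPt t φ)) :
    HasDerivAt (fun φ => u (polarPt t φ))
      (fderiv ℝ u (polarPt t φ) (Real.exp t • unitPerp φ)) φ :=
  hu.hasFDerivAt.comp_hasDerivAt φ (hasDerivAt_polarPt_right t φ)

lemma laplacian_eq_sum_fderiv (u : Plane → ℂ) (x : Plane) :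
    (Δ u) x = fderiv ℝ (fderiv ℝ u) x (EuclideanSpace.single 0 1) (EuclideanSpace.single 0 1)
      + fderiv ℝ (fderiv ℝ u) x (EuclideanSpace.single 1 1) (EuclideanSpace.single 1 1) := by
  rw [InnerProductSpace.laplacian_eq_iteratedFDeriv_orthonormalBasis u
    (EuclideanSpace.basisFun (Fin 2) ℝ)]
  simp [Fin.sum_univ_two, iteratedFDeriv_two_apply]

/-- The two vectors are `exp t` times an orthonormal basis, and the trace of a bilinear form does
not depend on the orthonormal basis. -/
lemma bilin_polarPt_add_bilin_perp (B : Plane →L[ℝ] Plane →L[ℝ] ℂ) (t φ : ℝ) :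
    B (polarPt t φ) (polarPt t φ) + B (Real.exp t • unitPerp φ) (Real.exp t • unitPerp φ)
      = Real.exp t ^ 2 * (B (EuclideanSpace.single 0 1) (EuclideanSpace.single 0 1)
        + B (EuclideanSpace.single 1 1) (EuclideanSpace.single 1 1)) := by
  have hcs : (Real.cos φ : ℂ) ^ 2 + (Real.sin φ : ℂ) ^ 2 = 1 := by
    exact_mod_cast Real.cos_sq_add_sin_sq φ
  simp only [polarPt, unitPerp, unitDir]
  generalize (EuclideanSpace.single 0 1 : Plane) = e₀
  generalize (EuclideanSpace.single 1 1 : Plane) = e₁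
  generalize Real.cos φ = c at *
  generalize Real.sin φ = s at *
  generalize Real.exp t = r
  simp only [map_add, map_smul, add_apply, smul_apply, Complex.real_smul, Complex.ofReal_neg]
  linear_combination (r : ℂ) ^ 2 * (B e₀ e₀ + B e₁ e₁) * hcs

lemma hasDerivAt_clm_comp_apply {B : Plane → Plane →L[ℝ] ℂ} {p v : ℝ → Plane} {p' v' : Plane}
    {s : ℝ} (hB : DifferentiableAt ℝ B (p s)) (hp : HasDerivAt p p' s) (hv : HasDerivAt v v' s) :
    HasDerivAt (fun s => B (p s) (v s)) (fderiv ℝ B (p s) p' (v s) + B (p s) v') s :=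
  HasDerivAt.clm_apply (c := fun s => B (p s)) (hB.hasFDerivAt.comp_hasDerivAt s hp) hv

/-- The Laplacian in log-polar coordinates. -/
lemma laplacian_polarPt (hu : ∀ t φ, ContDiffAt ℝ 2 u (polarPt t φ)) {f f₁ g₁ : ℝ → ℝ → ℂ}
    {f₂ g₂ : ℂ} (hf : ∀ t φ, u (polarPt t φ) = f t φ)
    (h₁ : ∀ t, HasDerivAt (fun t => f t φ) (f₁ t φ) t)
    (h₂ : HasDerivAt (fun t => f₁ t φ) f₂ t)
    (k₁ : ∀ φ, HasDerivAt (fun φ => f t φ) (g₁ t φ) φ)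
    (k₂ : HasDerivAt (fun φ => g₁ t φ) g₂ φ) :
    Real.exp t ^ 2 * (Δ u) (polarPt t φ) = f₂ + g₂ := by
  have hd : ∀ t φ, DifferentiableAt ℝ u (polarPt t φ) :=
    fun t φ => (hu t φ).differentiableAt (by norm_num)
  have hdd : DifferentiableAt ℝ (fderiv ℝ u) (polarPt t φ) :=
    ((hu t φ).fderiv_right (m := 1) (by norm_num)).differentiableAt (by norm_num)
  have e₁ : (fun t => f₁ t φ) = fun t => fderiv ℝ u (polarPt t φ) (polarPt t φ) := by
    funext t
    refine (h₁ t).unique ?_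
    simpa only [hf] using hasDerivAt_comp_polarPt_left (hd t φ)
  have e₂ : (fun φ => g₁ t φ) = fun φ => fderiv ℝ u (polarPt t φ) (Real.exp t • unitPerp φ) := by
    funext φ
    refine (k₁ φ).unique ?_
    simpa only [hf] using hasDerivAt_comp_polarPt_right (hd t φ)
  rw [e₁] at h₂
  rw [e₂] at k₂
  have E₁ := h₂.unique (hasDerivAt_clm_comp_apply hdd (hasDerivAt_polarPt_left t φ)
    (hasDerivAt_polarPt_left t φ))
  have E₂ := k₂.unique (hasDerivAt_clm_comp_apply hdd (hasDerivAt_polarPt_right t φ)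
    (v := fun φ => Real.exp t • unitPerp φ) ((hasDerivAt_unitPerp φ).const_smul (Real.exp t)))
  -- The first-order terms of the two second derivatives cancel: the radial velocity `x` is its own
  -- derivative, while the velocity along the circle has derivative `-x`.
  have hn : Real.exp t • -unitDir φ = -polarPt t φ := by rw [smul_neg, polarPt]
  rw [E₁, E₂, laplacian_eq_sum_fderiv, ← bilin_polarPt_add_bilin_perp, hn]
  simp only [map_neg]
  ring

end PolarCalculus

/-! ### Waves with modulated phase -/

/-- The direction `x / |x|` as a unit complex number, conjugated when `σ = -1`. -/
noncomputable def angDir (σ : ℝ) (x : Plane) : ℂ :=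
  ((x 0 : ℂ) + σ * Complex.I * (x 1 : ℂ)) / (‖x‖ : ℂ)

/-- The phase `g(t) + iσ(nφ + ε(t) sin(Mφ))`. -/
noncomputable def wavePhase (g : ℝ → ℂ) (ε : ℝ → ℝ) (σ : ℝ) (n M : ℕ) (t φ : ℝ) : ℂ :=
  g t + σ * Complex.I * (n * φ + ε t * Real.sin (M * φ) : ℝ)

/-- The function on the plane that equals `χ(t) exp(g(t) + iσ(nφ + ε(t) sin(Mφ)))` in log-polar
coordinates. -/
noncomputable def waveTerm (χ : ℝ → ℝ) (g : ℝ → ℂ) (ε : ℝ → ℝ) (σ : ℝ) (n M : ℕ) (x : Plane) : ℂ :=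
  χ (Real.log ‖x‖) * Complex.exp (g (Real.log ‖x‖)) * angDir σ x ^ n
    * Complex.exp (σ * Complex.I * (ε (Real.log ‖x‖) * (angDir 1 x ^ M).im : ℝ))

lemma angDir_polarPt {σ : ℝ} (hσ : σ = 1 ∨ σ = -1) (t φ : ℝ) :
    angDir σ (polarPt t φ) = Complex.exp (σ * Complex.I * φ) := by
  have hr : (Real.exp t : ℂ) ≠ 0 := by exact_mod_cast (Real.exp_pos t).ne'
  rw [angDir, norm_polarPt, polarPt_apply_zero, polarPt_apply_one]
  rcases hσ with rfl | rfl
  · rw [show ((1 : ℝ) : ℂ) * Complex.I * φ = (φ : ℂ) * Complex.I by push_cast; ring,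
      Complex.exp_mul_I]
    push_cast at hr ⊢
    field_simp
  · rw [show ((-1 : ℝ) : ℂ) * Complex.I * φ = ((-φ : ℝ) : ℂ) * Complex.I by push_cast; ring,
      Complex.exp_mul_I]
    push_cast at hr ⊢
    rw [Complex.cos_neg, Complex.sin_neg]
    field_simp

/-- Reads the modulation off the point itself, without a branch of the angle, so that `waveTerm` is
smooth away from the origin. -/
lemma angDir_one_pow_im (M : ℕ) (t φ : ℝ) :
    (angDir 1 (polarPt t φ) ^ M).im = Real.sin (M * φ) := by
  rw [angDir_polarPt (Or.inl rfl), ← Complex.exp_nat_mul,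
    show (M : ℂ) * (((1 : ℝ) : ℂ) * Complex.I * φ) = ((M * φ : ℝ) : ℂ) * Complex.I by
      push_cast; ring, Complex.exp_ofReal_mul_I_im]

lemma contDiffAt_angDir (σ : ℝ) {x : Plane} (hx : x ≠ 0) : ContDiffAt ℝ 2 (angDir σ) x := by
  have h : ∀ i : Fin 2, ContDiffAt ℝ 2 (fun x : Plane => ((x i : ℝ) : ℂ)) x := fun i =>
    Complex.ofRealCLM.contDiff.contDiffAt.comp x ((EuclideanSpace.proj i : Plane →L[ℝ] ℝ).contDiff.contDiffAt)
  have hn : ContDiffAt ℝ 2 (fun x : Plane => ((‖x‖ : ℝ) : ℂ)) x :=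
    Complex.ofRealCLM.contDiff.contDiffAt.comp x (contDiffAt_norm ℝ hx)
  have hne : ((‖x‖ : ℝ) : ℂ) ≠ 0 := by simpa using hx
  unfold angDir
  simp only [div_eq_mul_inv]
  exact ((h 0).add (contDiffAt_const.mul (h 1))).mul
    (ContDiffAt.inv (f := fun x : Plane => ((‖x‖ : ℝ) : ℂ)) hn hne)

section WaveTerm

variable {χ χ' χ'' : ℝ → ℝ} {g g' g'' : ℝ → ℂ} {ε ε' ε'' : ℝ → ℝ} {σ : ℝ} {n M : ℕ} {t φ : ℝ}

lemma waveTerm_polarPt (hσ : σ = 1 ∨ σ = -1) :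
    waveTerm χ g ε σ n M (polarPt t φ) = χ t * Complex.exp (wavePhase g ε σ n M t φ) := by
  rw [waveTerm, angDir_one_pow_im, angDir_polarPt hσ, log_norm_polarPt, ← Complex.exp_nat_mul,
    mul_assoc, mul_assoc, ← Complex.exp_add, ← Complex.exp_add, wavePhase]
  congr 2
  push_cast
  ring

lemma contDiffAt_waveTerm (hχ : ContDiff ℝ 2 χ) (hg : ContDiff ℝ 2 g) (hε : ContDiff ℝ 2 ε)
    {x : Plane} (hx : x ≠ 0) : ContDiffAt ℝ 2 (waveTerm χ g ε σ n M) x := by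
  have hl : ContDiffAt ℝ 2 (fun x : Plane => Real.log ‖x‖) x :=
    (contDiffAt_norm ℝ hx).log (by simpa using hx)
  have h1 : ContDiffAt ℝ 2 (fun x : Plane => ((χ (Real.log ‖x‖) : ℝ) : ℂ)) x :=
    Complex.ofRealCLM.contDiff.contDiffAt.comp x (hχ.contDiffAt.comp x hl)
  have h2 : ContDiffAt ℝ 2 (fun x : Plane => Complex.exp (g (Real.log ‖x‖))) x :=
    (hg.contDiffAt.comp x hl).cexp
  have h3 : ContDiffAt ℝ 2 (fun x : Plane => (angDir 1 x ^ M).im) x :=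
    Complex.imCLM.contDiff.contDiffAt.comp x ((contDiffAt_angDir 1 hx).pow M)
  have h4 : ContDiffAt ℝ 2
      (fun x : Plane => ((ε (Real.log ‖x‖) * (angDir 1 x ^ M).im : ℝ) : ℂ)) x :=
    Complex.ofRealCLM.contDiff.contDiffAt.comp x ((hε.contDiffAt.comp x hl).mul h3)
  exact ((h1.mul h2).mul ((contDiffAt_angDir σ hx).pow n)).mul (contDiffAt_const.mul h4).cexp

lemma hasDerivAt_wavePhase_left (hg : HasDerivAt g (g' t) t) (hε : HasDerivAt ε (ε' t) t) :
    HasDerivAt (fun t => wavePhase g ε σ n M t φ)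
      (g' t + σ * Complex.I * (ε' t * Real.sin (M * φ) : ℝ)) t := by
  exact hg.add ((((hε.mul_const _).const_add _).ofReal_comp).const_mul _)

lemma hasDerivAt_wavePhase_right :
    HasDerivAt (fun φ => wavePhase g ε σ n M t φ)
      (σ * Complex.I * (n + ε t * (M * Real.cos (M * φ)) : ℝ)) φ := by
  have h : HasDerivAt (fun φ : ℝ => Real.sin (M * φ)) (M * Real.cos (M * φ)) φ := by
    have := ((hasDerivAt_id φ).const_mul (M : ℝ)).sin
    simpa [mul_comm] using this
  have h2 : HasDerivAt (fun φ : ℝ => n * φ + ε t * Real.sin (M * φ))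
      (n + ε t * (M * Real.cos (M * φ))) φ := by
    exact (((hasDerivAt_id φ).const_mul (n : ℝ)).add (h.const_mul (ε t))).congr_deriv (by simp)
  exact (h2.ofReal_comp.const_mul _).const_add _

lemma hasDerivAt_wavePhase_right_right :
    HasDerivAt (fun φ : ℝ => σ * Complex.I * ((n + ε t * (M * Real.cos (M * φ)) : ℝ) : ℂ))
      (σ * Complex.I * (-(ε t * (M ^ 2 * Real.sin (M * φ))) : ℝ)) φ := by
  have h : HasDerivAt (fun φ : ℝ => Real.cos (M * φ)) (-(M * Real.sin (M * φ))) φ := by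
    have := ((hasDerivAt_id φ).const_mul (M : ℝ)).cos
    simpa [mul_comm] using this
  have h2 : HasDerivAt (fun φ : ℝ => n + ε t * (M * Real.cos (M * φ)))
      (-(ε t * (M ^ 2 * Real.sin (M * φ)))) φ := by
    exact (((h.const_mul (M : ℝ)).const_mul (ε t)).const_add (n : ℝ)).congr_deriv (by ring)
  exact h2.ofReal_comp.const_mul _

/-- The radial derivative of the phase. -/
noncomputable def phaseRadial (g' : ℝ → ℂ) (ε' : ℝ → ℝ) (σ : ℝ) (M : ℕ) (t φ : ℝ) : ℂ :=
  g' t + σ * Complex.I * (ε' t * Real.sin (M * φ) : ℝ)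

/-- The angular derivative of the phase is `iσ` times this. -/
noncomputable def phaseAngular (ε : ℝ → ℝ) (n M : ℕ) (t φ : ℝ) : ℝ :=
  n + ε t * (M * Real.cos (M * φ))

lemma hasDerivAt_wave_left (hχ : HasDerivAt χ (χ' t) t) (hg : HasDerivAt g (g' t) t)
    (hε : HasDerivAt ε (ε' t) t) :
    HasDerivAt (fun t => χ t * Complex.exp (wavePhase g ε σ n M t φ))
      ((χ' t + χ t * phaseRadial g' ε' σ M t φ) * Complex.exp (wavePhase g ε σ n M t φ)) t := by
  exact (hχ.ofReal_comp.mul (hasDerivAt_wavePhase_left hg hε).cexp).congr_deriv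
    (by rw [phaseRadial]; ring)

lemma hasDerivAt_wave_right :
    HasDerivAt (fun φ => χ t * Complex.exp (wavePhase g ε σ n M t φ))
      (χ t * (σ * Complex.I * phaseAngular ε n M t φ)
        * Complex.exp (wavePhase g ε σ n M t φ)) φ := by
  exact ((hasDerivAt_wavePhase_right (n := n) (M := M) (t := t) (φ := φ) (ε := ε) (σ := σ)
    (g := g)).cexp.const_mul (χ t : ℂ)).congr_deriv (by rw [phaseAngular]; ring)

/-- `r² (Δ + λ)` applied to a wave. -/
lemma laplacian_waveTerm (hσ : σ = 1 ∨ σ = -1) (hχ : ∀ t, HasDerivAt χ (χ' t) t)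
    (hχ' : ∀ t, HasDerivAt χ' (χ'' t) t) (hg : ∀ t, HasDerivAt g (g' t) t)
    (hg' : ∀ t, HasDerivAt g' (g'' t) t) (hε : ∀ t, HasDerivAt ε (ε' t) t)
    (hε' : ∀ t, HasDerivAt ε' (ε'' t) t) (cχ : ContDiff ℝ 2 χ) (cg : ContDiff ℝ 2 g)
    (cε : ContDiff ℝ 2 ε) (t φ : ℝ) :
    Real.exp t ^ 2 * (Δ (waveTerm χ g ε σ n M)) (polarPt t φ) =
      (χ'' t + 2 * χ' t * phaseRadial g' ε' σ M t φ
        + χ t * (phaseRadial g'' ε'' σ M t φ + phaseRadial g' ε' σ M t φ ^ 2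
          - σ * Complex.I * (ε t * (M ^ 2 * Real.sin (M * φ)) : ℝ) - phaseAngular ε n M t φ ^ 2))
        * Complex.exp (wavePhase g ε σ n M t φ) := by
  have hσ2 : (σ : ℂ) ^ 2 = 1 := by rcases hσ with rfl | rfl <;> norm_num
  have h₂ : HasDerivAt (fun t => (χ' t + χ t * phaseRadial g' ε' σ M t φ)
      * Complex.exp (wavePhase g ε σ n M t φ)) _ t :=
    (((hχ' t).ofReal_comp.add ((hχ t).ofReal_comp.mul ((hg' t).add
      ((((hε' t).mul_const (Real.sin (M * φ))).ofReal_comp).const_mul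
        (σ * Complex.I)))))).mul (hasDerivAt_wavePhase_left (hg t) (hε t)).cexp
  have k₂ : HasDerivAt (fun φ => χ t * (σ * Complex.I * phaseAngular ε n M t φ)
        * Complex.exp (wavePhase g ε σ n M t φ)) _ φ :=
    (hasDerivAt_wavePhase_right_right.const_mul (χ t : ℂ)).mul
      (hasDerivAt_wavePhase_right (n := n) (M := M) (t := t) (φ := φ) (ε := ε) (σ := σ)
        (g := g)).cexp
  rw [laplacian_polarPt (f := fun t φ => χ t * Complex.exp (wavePhase g ε σ n M t φ))
    (f₁ := fun t φ => (χ' t + χ t * phaseRadial g' ε' σ M t φ)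
      * Complex.exp (wavePhase g ε σ n M t φ))
    (g₁ := fun t φ => χ t * (σ * Complex.I * phaseAngular ε n M t φ)
        * Complex.exp (wavePhase g ε σ n M t φ)) (fun t φ => contDiffAt_waveTerm cχ cg cε (polarPt_ne_zero t φ))
    (fun t φ => waveTerm_polarPt hσ) (fun t => hasDerivAt_wave_left (hχ t) (hg t) (hε t)) h₂
    (fun φ => hasDerivAt_wave_right) k₂]
  simp only [phaseRadial, phaseAngular, Pi.add_apply, Pi.mul_apply]
  push_cast
  -- Either sign of `σ` gives `(iσ)² = -1`, so the angular frequency enters as `-phaseAngular²`.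
  linear_combination (χ t * (n + ε t * (M * Complex.cos (M * φ))) ^ 2
    * Complex.exp (wavePhase g ε σ n M t φ)) * (σ ^ 2 * Complex.I_sq - hσ2)

lemma fderiv_waveTerm_left (hσ : σ = 1 ∨ σ = -1) (hχ : HasDerivAt χ (χ' t) t)
    (hg : HasDerivAt g (g' t) t) (hε : HasDerivAt ε (ε' t) t) (cχ : ContDiff ℝ 2 χ)
    (cg : ContDiff ℝ 2 g) (cε : ContDiff ℝ 2 ε) :
    fderiv ℝ (waveTerm χ g ε σ n M) (polarPt t φ) (polarPt t φ) =
      (χ' t + χ t * phaseRadial g' ε' σ M t φ) * Complex.exp (wavePhase g ε σ n M t φ) := by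
  have h := hasDerivAt_comp_polarPt_left ((contDiffAt_waveTerm (σ := σ) (n := n) (M := M) cχ cg cε
    (polarPt_ne_zero t φ)).differentiableAt (by norm_num))
  simp only [waveTerm_polarPt hσ] at h
  exact h.unique (hasDerivAt_wave_left hχ hg hε)

lemma fderiv_waveTerm_right (hσ : σ = 1 ∨ σ = -1) (cχ : ContDiff ℝ 2 χ)
    (cg : ContDiff ℝ 2 g) (cε : ContDiff ℝ 2 ε) :
    fderiv ℝ (waveTerm χ g ε σ n M) (polarPt t φ) (Real.exp t • unitPerp φ) =
      χ t * (σ * Complex.I * phaseAngular ε n M t φ)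
        * Complex.exp (wavePhase g ε σ n M t φ) := by
  have h := hasDerivAt_comp_polarPt_right ((contDiffAt_waveTerm (σ := σ) (n := n) (M := M) cχ cg cε
    (polarPt_ne_zero t φ)).differentiableAt (by norm_num))
  simp only [waveTerm_polarPt hσ] at h
  exact h.unique hasDerivAt_wave_right

end WaveTerm

/-! ### Cutoffs in the variable `|x|^b` -/

section Cutoff

lemma contDiff_smoothTransition (n : ℕ) : ContDiff ℝ n Real.smoothTransition := by
  exact_mod_cast Real.smoothTransition.contDiff (n := (n : ℕ∞))

lemma contDiff_deriv_smoothTransition (n : ℕ) : ContDiff ℝ n (deriv Real.smoothTransition) := by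
  have h : ContDiff ℝ ((n : WithTop ℕ∞) + 1) Real.smoothTransition := by
    exact_mod_cast contDiff_smoothTransition (n + 1)
  exact (contDiff_succ_iff_deriv.1 h).2.2

/-- The profile is locally constant there. An equality of germs is needed so that the second
derivative vanishes as well. -/
lemma deriv_smoothTransition_eqOn : ∀ x ∉ Set.Icc (0 : ℝ) 1,
    deriv Real.smoothTransition =ᶠ[nhds x] 0 := by
  intro x hx
  rw [Set.mem_Icc, not_and_or, not_le, not_le] at hx
  rcases hx with hx | hx
  · filter_upwards [Iio_mem_nhds hx] with y hy
    have : Real.smoothTransition =ᶠ[nhds y] fun _ => 0 := by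
      filter_upwards [Iio_mem_nhds hy] with z hz
      exact Real.smoothTransition.zero_of_nonpos hz.le
    simp [this.deriv_eq]
  · filter_upwards [Ioi_mem_nhds hx] with y hy
    have : Real.smoothTransition =ᶠ[nhds y] fun _ => 1 := by
      filter_upwards [Ioi_mem_nhds hy] with z hz
      exact Real.smoothTransition.one_of_one_le hz.le
    simp [this.deriv_eq]

lemma deriv_smoothTransition_eq_zero {x : ℝ} (hx : x ∉ Set.Icc (0 : ℝ) 1) :
    deriv Real.smoothTransition x = 0 :=
  (deriv_smoothTransition_eqOn x hx).eq_of_nhds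

lemma deriv_deriv_smoothTransition_eq_zero {x : ℝ} (hx : x ∉ Set.Icc (0 : ℝ) 1) :
    deriv (deriv Real.smoothTransition) x = 0 := by
  rw [(deriv_smoothTransition_eqOn x hx).deriv_eq]
  simp

lemma exists_bound_deriv_smoothTransition : ∃ D : ℝ, 1 ≤ D ∧
    ∀ x, |deriv Real.smoothTransition x| ≤ D ∧ |deriv (deriv Real.smoothTransition) x| ≤ D := by
  have h2 : Continuous (deriv (deriv Real.smoothTransition)) := by
    have h : ContDiff ℝ ((0 : WithTop ℕ∞) + 1) (deriv Real.smoothTransition) := by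
      exact_mod_cast contDiff_deriv_smoothTransition 1
    exact (contDiff_succ_iff_deriv.1 h).2.2.continuous
  obtain ⟨C₁, h₁⟩ := isCompact_Icc.exists_bound_of_continuousOn (s := Set.Icc (0 : ℝ) 1)
    (contDiff_deriv_smoothTransition 1).continuous.continuousOn
  obtain ⟨C₂, h₂⟩ := isCompact_Icc.exists_bound_of_continuousOn (s := Set.Icc (0 : ℝ) 1)
    h2.continuousOn
  refine ⟨max 1 (max C₁ C₂), le_max_left _ _, fun x => ?_⟩
  by_cases hx : x ∈ Set.Icc (0 : ℝ) 1
  · exact ⟨(h₁ x hx).trans (by simp), (h₂ x hx).trans (by simp)⟩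
  · rw [deriv_smoothTransition_eq_zero hx, deriv_deriv_smoothTransition_eq_zero hx, abs_zero]
    simp

/-- A cutoff in the variable `exp (b t)`. -/
noncomputable def cutoff (a k b t : ℝ) : ℝ := Real.smoothTransition (a + k * Real.exp (b * t))

/-- The derivative of `cutoff`. -/
noncomputable def cutoffD (a k b t : ℝ) : ℝ :=
  deriv Real.smoothTransition (a + k * Real.exp (b * t)) * (k * (b * Real.exp (b * t)))

/-- The second derivative of `cutoff`. -/
noncomputable def cutoffDD (a k b t : ℝ) : ℝ :=
  deriv (deriv Real.smoothTransition) (a + k * Real.exp (b * t)) * (k * (b * Real.exp (b * t))) ^ 2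
    + deriv Real.smoothTransition (a + k * Real.exp (b * t)) * (k * (b * (b * Real.exp (b * t))))

variable {a k b t : ℝ}

lemma hasDerivAt_exp_mul (b t : ℝ) :
    HasDerivAt (fun t => Real.exp (b * t)) (b * Real.exp (b * t)) t := by
  have := ((hasDerivAt_id t).const_mul b).exp
  simpa [mul_comm] using this

lemma hasDerivAt_cutoff : HasDerivAt (cutoff a k b) (cutoffD a k b t) t := by
  have h1 : HasDerivAt Real.smoothTransition (deriv Real.smoothTransition
      (a + k * Real.exp (b * t))) (a + k * Real.exp (b * t)) :=
    ((contDiff_smoothTransition 1).differentiable (by norm_num) _).hasDerivAt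
  exact h1.comp t (((hasDerivAt_exp_mul b t).const_mul k).const_add a)

lemma hasDerivAt_cutoffD : HasDerivAt (cutoffD a k b) (cutoffDD a k b t) t := by
  have h1 : HasDerivAt (deriv Real.smoothTransition) (deriv (deriv Real.smoothTransition)
      (a + k * Real.exp (b * t))) (a + k * Real.exp (b * t)) :=
    ((contDiff_deriv_smoothTransition 1).differentiable (by norm_num) _).hasDerivAt
  have h2 := (h1.comp t (((hasDerivAt_exp_mul b t).const_mul k).const_add a)).mul
    (((hasDerivAt_exp_mul b t).const_mul b).const_mul k)
  have h3 : HasDerivAt (cutoffD a k b) _ t := h2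
  refine h3.congr_deriv ?_
  simp only [Function.comp_apply, cutoffDD]
  ring

lemma contDiff_cutoff : ContDiff ℝ 2 (cutoff a k b) := by
  have h : ContDiff ℝ 2 Real.smoothTransition := contDiff_smoothTransition 2
  exact h.comp (contDiff_const.add (contDiff_const.mul (contDiff_const.mul contDiff_id).exp))

lemma cutoff_nonneg : 0 ≤ cutoff a k b t := Real.smoothTransition.nonneg _

lemma cutoff_le_one : cutoff a k b t ≤ 1 := Real.smoothTransition.le_one _

lemma cutoff_eq_one (h : 1 ≤ a + k * Real.exp (b * t)) : cutoff a k b t = 1 :=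
  Real.smoothTransition.one_of_one_le h

lemma cutoff_eq_zero (h : a + k * Real.exp (b * t) ≤ 0) : cutoff a k b t = 0 :=
  Real.smoothTransition.zero_of_nonpos h

lemma cutoffD_eq_zero (h : 1 < a + k * Real.exp (b * t)) : cutoffD a k b t = 0 := by
  rw [cutoffD, deriv_smoothTransition_eq_zero (fun h' => h.not_ge h'.2), zero_mul]

lemma cutoffDD_eq_zero (h : 1 < a + k * Real.exp (b * t)) : cutoffDD a k b t = 0 := by
  rw [cutoffDD, deriv_smoothTransition_eq_zero (fun h' => h.not_ge h'.2),
    deriv_deriv_smoothTransition_eq_zero (fun h' => h.not_ge h'.2), zero_mul, zero_mul, add_zero]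

/-- Each derivative in `t` costs a factor `exp (b t) ≤ 2J`. The constants are `16 = 8 · 2` and `272
= 16² + 16`. -/
lemma abs_cutoff_deriv_le {D J : ℝ} (hD : ∀ x, |deriv Real.smoothTransition x| ≤ D ∧
    |deriv (deriv Real.smoothTransition) x| ≤ D) (hk : |k| ≤ 8) (hb0 : 0 ≤ b) (hb : b ≤ 1)
    (hJ : 1 ≤ J) (hy : Real.exp (b * t) ≤ 2 * J) :
    |cutoffD a k b t| ≤ 16 * D * J ∧ |cutoffDD a k b t| ≤ 272 * D * J ^ 2 := by
  have hy0 := (Real.exp_pos (b * t)).le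
  have hD0 : 0 ≤ D := (abs_nonneg _).trans (hD 0).1
  have e1 : |k * (b * Real.exp (b * t))| ≤ 16 * J := by
    rw [abs_mul, abs_mul, abs_of_nonneg hb0, abs_of_nonneg hy0]
    calc |k| * (b * Real.exp (b * t)) ≤ 8 * (1 * (2 * J)) := by gcongr
      _ = 16 * J := by ring
  have e2 : |k * (b * (b * Real.exp (b * t)))| ≤ 16 * J := by
    rw [abs_mul, abs_mul, abs_mul, abs_of_nonneg hb0, abs_of_nonneg hy0]
    calc |k| * (b * (b * Real.exp (b * t))) ≤ 8 * (1 * (1 * (2 * J))) := by gcongr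
      _ = 16 * J := by ring
  constructor
  · rw [cutoffD, abs_mul]
    calc _ ≤ D * (16 * J) := by gcongr; exact (hD _).1
      _ = _ := by ring
  · rw [cutoffDD]
    refine (abs_add_le _ _).trans ?_
    rw [abs_mul, abs_mul, abs_pow]
    calc _ ≤ D * (16 * J) ^ 2 + D * (16 * J) := by
          gcongr
          · exact (hD _).2
          · exact (hD _).1
      _ ≤ D * (16 * J) ^ 2 + D * (16 * (J * J)) := by gcongr; nlinarith
      _ = _ := by ring

end Cutoff

/-! ### Decay rates, nodes and amplitudes -/

section Parameters

/-- Since `(w - 1)(w + 1) = -z`, the root with nonnegative real part works: it has `‖w + 1‖ ≥ 1`. -/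
lemma exists_sq_eq_one_sub (z : ℂ) : ∃ w : ℂ, w ^ 2 = 1 - z ∧ ‖w - 1‖ ≤ ‖z‖ := by
  obtain ⟨w, hw⟩ := IsAlgClosed.exists_pow_nat_eq (1 - z) (n := 2) (by norm_num)
  have key : ∀ w : ℂ, w ^ 2 = 1 - z → 0 ≤ w.re → ‖w - 1‖ ≤ ‖z‖ := by
    intro w hw hre
    have h1 : 1 ≤ ‖w + 1‖ := by
      refine le_trans ?_ (Complex.re_le_norm _)
      simpa using hre
    have h2 : ‖w - 1‖ * ‖w + 1‖ = ‖z‖ := by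
      rw [← norm_mul, ← norm_neg z]
      congr 1
      linear_combination hw
    nlinarith [norm_nonneg (w - 1)]
  rcases le_total 0 w.re with h | h
  · exact ⟨w, hw, key w hw h⟩
  · have hw' : (-w) ^ 2 = 1 - z := by rw [neg_sq, hw]
    exact ⟨-w, hw', key _ hw' (by simpa using h)⟩

/-- A square root of `1 - z` that is close to `1` for small `z`. -/
noncomputable def sqrtNear (z : ℂ) : ℂ := (exists_sq_eq_one_sub z).choose

/-- The logarithm of the `j`-th transition radius. -/
noncomputable def node (b : ℝ) (j : ℕ) : ℝ := Real.log j / b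

/-- The square root of `a² - λ r²` near `a`, with `r` the `j`-th transition radius. -/
noncomputable def wkbRoot (lam : ℂ) (b : ℝ) (j : ℕ) (a : ℝ) : ℂ :=
  a * sqrtNear (lam * (Real.exp (node b j) ^ 2 : ℝ) / (a : ℂ) ^ 2)

/-- The decay rate of the wave arriving at the `j`-th transition. -/
noncomputable def rateIn (lam : ℂ) (b : ℝ) (j : ℕ) : ℂ := wkbRoot lam b j ((j : ℝ) ^ 2)

/-- The decay rate of the wave leaving the `j`-th transition. -/
noncomputable def rateOut (lam : ℂ) (b : ℝ) (j : ℕ) : ℂ :=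
  wkbRoot lam b j ((j : ℝ) ^ 2 - 2 * j - 1)

/-- The common log-amplitude of the two waves at the `j`-th transition. -/
noncomputable def logAmp (lam : ℂ) (b : ℝ) : ℕ → ℂ
  | 0 => 0
  | j + 1 => logAmp lam b j
      - ((node b (j + 1) - node b j) / 2 : ℝ) * (rateOut lam b j + rateIn lam b (j + 1))

lemma wkbRoot_sq (lam : ℂ) (b : ℝ) (j : ℕ) {a : ℝ} (ha : a ≠ 0) :
    wkbRoot lam b j a ^ 2 = (a : ℂ) ^ 2 - lam * (Real.exp (node b j) : ℂ) ^ 2 := by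
  have ha' : (a : ℂ) ≠ 0 := by exact_mod_cast ha
  rw [wkbRoot, mul_pow, sqrtNear, (exists_sq_eq_one_sub _).choose_spec.1]
  push_cast
  field_simp

lemma norm_wkbRoot_sub_le (lam : ℂ) (b : ℝ) (j : ℕ) {a K : ℝ} (ha : 0 < a)
    (h : ‖lam‖ * Real.exp (node b j) ^ 2 ≤ K * a ^ 2) :
    ‖wkbRoot lam b j a - a‖ ≤ K * a := by
  set z := lam * (Real.exp (node b j) ^ 2 : ℝ) / (a : ℂ) ^ 2 with hz
  have e : wkbRoot lam b j a - a = a * (sqrtNear z - 1) := by rw [wkbRoot]; ring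
  have hs : ‖sqrtNear z - 1‖ ≤ ‖z‖ := (exists_sq_eq_one_sub z).choose_spec.2
  have hzn : ‖z‖ ≤ K := by
    rw [hz, norm_div, norm_mul, norm_pow, Complex.norm_real, Complex.norm_real, Real.norm_eq_abs,
      Real.norm_eq_abs, abs_of_pos (by positivity), abs_of_pos ha, div_le_iff₀ (by positivity)]
    exact h
  rw [e, norm_mul, Complex.norm_real, Real.norm_eq_abs, abs_of_pos ha, mul_comm]
  gcongr
  exact hs.trans hzn

/-- The index `j` is so large that the potential `λ` is a perturbation at the `j`-th transition. -/
structure Admissible (lam : ℂ) (b D : ℝ) (j : ℕ) : Prop where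
  b_ge : 1 / 2 ≤ b
  b_le : b ≤ 1
  D_ge : 1 ≤ D
  le_index : 80 * D + 60 ≤ j
  lam_le : ‖lam‖ * Real.exp (node b j) ^ 2 ≤ (j : ℝ) ^ 4 / 40

variable {lam : ℂ} {b D t : ℝ} {j : ℕ}

lemma Admissible.five_le (h : Admissible lam b D j) : (5 : ℝ) ≤ j := by
  linarith [h.D_ge, h.le_index]

lemma Admissible.rateIn_sq (h : Admissible lam b D j) :
    rateIn lam b j ^ 2 = (j : ℂ) ^ 4 - lam * (Real.exp (node b j) : ℂ) ^ 2 := by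
  have := h.five_le
  rw [rateIn, wkbRoot_sq _ _ _ (by positivity)]
  push_cast
  ring

lemma Admissible.half_le (h : Admissible lam b D j) : (j : ℝ) ^ 2 / 2 ≤ (j : ℝ) ^ 2 - 2 * j - 1 := by
  nlinarith [h.five_le]

lemma Admissible.rateOut_sq (h : Admissible lam b D j) :
    rateOut lam b j ^ 2 = ((j : ℂ) ^ 2 - 2 * j - 1) ^ 2 - lam * (Real.exp (node b j) : ℂ) ^ 2 := by
  have h1 := h.five_le
  have h2 := h.half_le
  have h3 : (0 : ℝ) < (j : ℝ) ^ 2 / 2 := by positivity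
  rw [rateOut, wkbRoot_sq _ _ _ (by linarith)]
  push_cast
  ring

lemma Admissible.norm_rateIn_sub (h : Admissible lam b D j) :
    ‖rateIn lam b j - (j : ℂ) ^ 2‖ ≤ (j : ℝ) ^ 2 / 10 := by
  have h1 := h.five_le
  have := norm_wkbRoot_sub_le lam b j (a := (j : ℝ) ^ 2) (K := 1 / 10) (by positivity)
    (h.lam_le.trans (by nlinarith [sq_nonneg ((j : ℝ) ^ 2)]))
  rw [rateIn]
  push_cast at this
  linarith

lemma Admissible.norm_rateOut_sub (h : Admissible lam b D j) :
    ‖rateOut lam b j - ((j : ℂ) ^ 2 - 2 * j - 1)‖ ≤ ((j : ℝ) ^ 2 - 2 * j - 1) / 10 := by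
  have h1 := h.five_le
  have h2 := h.half_le
  have h3 : (0 : ℝ) < (j : ℝ) ^ 2 / 2 := by positivity
  -- Here the unperturbed rate is at least `j²/2`, so a tenth of its square is at least `j⁴/40`;
  -- this explains the constant in `lam_le`.
  have := norm_wkbRoot_sub_le lam b j (a := (j : ℝ) ^ 2 - 2 * j - 1) (K := 1 / 10) (by linarith)
    (h.lam_le.trans (by nlinarith [mul_self_le_mul_self h3.le h2]))
  rw [rateOut]
  push_cast at this
  linarith

lemma Admissible.norm_rateIn_le (h : Admissible lam b D j) :
    ‖rateIn lam b j‖ ≤ 2 * (j : ℝ) ^ 2 := by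
  have h1 := norm_le_norm_add_norm_sub' (rateIn lam b j) ((j : ℂ) ^ 2)
  rw [norm_pow, Complex.norm_natCast] at h1
  nlinarith [h.norm_rateIn_sub, h.five_le]

lemma Admissible.le_norm_rateIn (h : Admissible lam b D j) :
    9 / 10 * (j : ℝ) ^ 2 ≤ ‖rateIn lam b j‖ := by
  have h1 := norm_le_norm_add_norm_sub' ((j : ℂ) ^ 2) (rateIn lam b j)
  rw [norm_pow, Complex.norm_natCast, norm_sub_rev] at h1
  nlinarith [h.norm_rateIn_sub, h.five_le]

lemma Admissible.re_rateIn (h : Admissible lam b D j) :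
    9 / 10 * (j : ℝ) ^ 2 ≤ (rateIn lam b j).re := by
  have h1 := (Complex.abs_re_le_norm _).trans h.norm_rateIn_sub
  rw [Complex.sub_re, ← Nat.cast_pow, Complex.natCast_re, abs_le] at h1
  push_cast at h1
  linarith [h1.1]

lemma Admissible.re_rateOut (h : Admissible lam b D j) :
    9 / 10 * ((j : ℝ) ^ 2 - 2 * j - 1) ≤ (rateOut lam b j).re := by
  have h1 := (Complex.abs_re_le_norm _).trans h.norm_rateOut_sub
  have e : (rateOut lam b j - ((j : ℂ) ^ 2 - 2 * j - 1)).re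
      = (rateOut lam b j).re - ((j : ℝ) ^ 2 - 2 * j - 1) := by
    rw [Complex.sub_re, show ((j : ℂ) ^ 2 - 2 * j - 1) = (((j : ℝ) ^ 2 - 2 * j - 1 : ℝ) : ℂ) by
      push_cast; ring, Complex.ofReal_re]
  rw [e, abs_le] at h1
  linarith [h1.1]

lemma Admissible.norm_rateOut_le (h : Admissible lam b D j) :
    ‖rateOut lam b j‖ ≤ 2 * (j : ℝ) ^ 2 := by
  have h1 := norm_le_norm_add_norm_sub' (rateOut lam b j) (((j : ℝ) ^ 2 - 2 * j - 1 : ℝ) : ℂ)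
  have h2 := h.half_le
  have h3 := h.five_le
  have h4 : (0 : ℝ) < (j : ℝ) ^ 2 / 2 := by positivity
  rw [Complex.norm_real, Real.norm_eq_abs, abs_of_pos (by linarith)] at h1
  push_cast at h1
  nlinarith [h.norm_rateOut_sub]

/-- Subtracting the estimates of the two rates would leave an error of order `j²`. But `λ` is frozen
at the same node in both, so the squares differ by exactly `(2j+1)(2j²-2j-1)`; division by the sum
of the rates, known up to ten per cent, gives the gap. -/
lemma Admissible.norm_rateIn_sub_rateOut_sub (h : Admissible lam b D j) :
    ‖(rateIn lam b j - rateOut lam b j) - (2 * j + 1)‖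
      ≤ ‖rateIn lam b j - rateOut lam b j‖ / 10 := by
  set v := rateIn lam b j - rateOut lam b j with hv
  set s : ℝ := 2 * (j : ℝ) ^ 2 - 2 * j - 1 with hs
  have h2 := h.half_le
  have h3 := h.five_le
  have hs0 : 0 < s := by nlinarith
  have e1 : v * (rateIn lam b j + rateOut lam b j) = (2 * j + 1) * s := by
    rw [hv, hs]
    push_cast
    linear_combination h.rateIn_sq - h.rateOut_sq
  have e2 : ‖rateIn lam b j + rateOut lam b j - s‖ ≤ s / 10 := by
    have : rateIn lam b j + rateOut lam b j - s = (rateIn lam b j - (j : ℂ) ^ 2)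
        + (rateOut lam b j - ((j : ℂ) ^ 2 - 2 * j - 1)) := by
      rw [hs]; push_cast; ring
    rw [this]
    refine (norm_add_le _ _).trans ?_
    have := h.norm_rateIn_sub
    have := h.norm_rateOut_sub
    rw [hs]
    linarith
  have e3 : (v - (2 * j + 1)) * s = -(v * (rateIn lam b j + rateOut lam b j - s)) := by
    linear_combination e1
  have e4 := congrArg norm e3
  rw [norm_mul, norm_neg, norm_mul, Complex.norm_real, Real.norm_eq_abs, abs_of_pos hs0] at e4
  have e5 : ‖v - (2 * j + 1)‖ * s ≤ ‖v‖ / 10 * s := by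
    rw [e4]; nlinarith [norm_nonneg v]
  exact le_of_mul_le_mul_right e5 hs0

lemma Admissible.norm_rateIn_sub_rateOut_le (h : Admissible lam b D j) :
    ‖rateIn lam b j - rateOut lam b j‖ ≤ 3 * j := by
  have h1 := h.norm_rateIn_sub_rateOut_sub
  have h2 := norm_le_norm_add_norm_sub' (rateIn lam b j - rateOut lam b j) (2 * j + 1)
  have h3 : ‖(2 * j + 1 : ℂ)‖ = 2 * j + 1 := by
    rw [show (2 * j + 1 : ℂ) = ((2 * j + 1 : ℕ) : ℂ) by push_cast; ring, Complex.norm_natCast]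
    push_cast; ring
  linarith [h.five_le]

lemma Admissible.le_re_rateIn_sub_rateOut (h : Admissible lam b D j) :
    (j : ℝ) ≤ (rateIn lam b j - rateOut lam b j).re := by
  have h1 := (Complex.abs_re_le_norm _).trans h.norm_rateIn_sub_rateOut_sub
  have h2 := h.norm_rateIn_sub_rateOut_le
  have e : ((rateIn lam b j - rateOut lam b j) - (2 * j + 1)).re
      = (rateIn lam b j - rateOut lam b j).re - (2 * j + 1) := by
    rw [Complex.sub_re, show (2 * j + 1 : ℂ) = ((2 * j + 1 : ℝ) : ℂ) by push_cast; ring,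
      Complex.ofReal_re]
  rw [e, abs_le] at h1
  linarith [h1.1]

/-! ### Position relative to the nodes -/

/-- This is `1 - 1/y ≤ log y ≤ y - 1` at `y = exp (b t) / j`. -/
lemma node_sub_bounds (hb : 0 < b) (hj : 0 < j) (t : ℝ) :
    (Real.exp (b * t) - j) / Real.exp (b * t) ≤ b * (t - node b j) ∧
      b * (t - node b j) ≤ (Real.exp (b * t) - j) / j := by
  have hj' : (0 : ℝ) < j := by exact_mod_cast hj
  have e : b * (t - node b j) = Real.log (Real.exp (b * t) / j) := by
    rw [Real.log_div (Real.exp_pos _).ne' hj'.ne', Real.log_exp, node]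
    field_simp
  have hpos : 0 < Real.exp (b * t) / j := by positivity
  rw [e]
  constructor
  · have := Real.one_sub_inv_le_log_of_pos hpos
    rw [inv_div] at this
    rwa [sub_div, div_self (Real.exp_pos _).ne']
  · have := Real.log_le_sub_one_of_pos hpos
    rwa [sub_div, div_self hj'.ne']

lemma exp_mul_node (hb : 0 < b) (hj : 0 < j) : Real.exp (b * node b j) = j := by
  rw [node, mul_div_cancel₀ _ hb.ne', Real.exp_log (by exact_mod_cast hj)]

lemma Admissible.abs_sub_node_le (h : Admissible lam b D j)
    (hy : |Real.exp (b * t) - j| ≤ 1) : |t - node b j| ≤ 3 / j := by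
  have h5 := h.five_le
  have hj : 0 < j := by
    have : (0 : ℝ) < j := by linarith
    exact_mod_cast this
  have hb := h.b_ge
  obtain ⟨h1, h2⟩ := node_sub_bounds (by linarith : 0 < b) hj t
  rw [abs_le] at hy
  have h3 : (Real.exp (b * t) - j) / j ≤ 1 / j := by gcongr; linarith
  have h4 : -(3 / 2 / j) ≤ (Real.exp (b * t) - j) / Real.exp (b * t) := by
    rw [le_div_iff₀ (Real.exp_pos _), neg_mul, div_mul_eq_mul_div, neg_le, le_div_iff₀ (by linarith)]
    nlinarith
  have h6 : 3 / (j : ℝ) = 2 * (3 / 2 / j) := by ring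
  have h7 : 1 / (j : ℝ) ≤ 3 / 2 / j := by gcongr; norm_num
  have h8 : 0 < 3 / 2 / (j : ℝ) := by positivity
  rw [h6, abs_le]
  constructor <;> nlinarith

/-- The price of freezing `λr²` at the node: `r²` has relative variation `O(1/j)` over this range,
and `|λ| r_j²` is at most `j⁴/40`. -/
lemma Admissible.norm_lam_mul_le (h : Admissible lam b D j)
    (ht : |t - node b j| ≤ 3 / j) :
    ‖lam * (Real.exp t : ℂ) ^ 2 - lam * (Real.exp (node b j) : ℂ) ^ 2‖ ≤ (j : ℝ) ^ 3 := by
  have h5 : (60 : ℝ) ≤ j := by linarith [h.D_ge, h.le_index]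
  have e : lam * (Real.exp t : ℂ) ^ 2 - lam * (Real.exp (node b j) : ℂ) ^ 2
      = lam * ((Real.exp (node b j) ^ 2 * (Real.exp (2 * (t - node b j)) - 1) : ℝ) : ℂ) := by
    have : Real.exp t ^ 2 = Real.exp (node b j) ^ 2 * Real.exp (2 * (t - node b j)) := by
      rw [← Real.exp_nat_mul, ← Real.exp_nat_mul, ← Real.exp_add]
      congr 1; push_cast; ring
    rw [← Complex.ofReal_pow, this]
    push_cast
    ring
  have h6 : 3 / (j : ℝ) ≤ 1 / 2 := by
    rw [div_le_iff₀ (by linarith)]; linarith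
  have h7 : |Real.exp (2 * (t - node b j)) - 1| ≤ 2 * |2 * (t - node b j)| :=
    Real.abs_exp_sub_one_le (by rw [abs_mul, abs_two]; linarith)
  rw [abs_mul, abs_two] at h7
  rw [e, norm_mul, Complex.norm_real, Real.norm_eq_abs, abs_mul, abs_of_nonneg (by positivity),
    ← mul_assoc]
  calc _ ≤ (j : ℝ) ^ 4 / 40 * (2 * (2 * (3 / j))) := by
        gcongr
        · exact h.lam_le
        · linarith
    _ = 12 / 40 * (j : ℝ) ^ 3 := by field_simp; ring
    _ ≤ _ := by nlinarith [pow_pos (by linarith : (0 : ℝ) < j) 3]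

lemma Admissible.node_succ_sub (h : Admissible lam b D j) :
    1 / (j + 1 : ℝ) ≤ node b (j + 1) - node b j ∧ node b (j + 1) - node b j ≤ 3 / j := by
  have h5 := h.five_le
  have hj : 0 < j := by
    have : (0 : ℝ) < j := by linarith
    exact_mod_cast this
  have hb := h.b_ge
  have hb1 := h.b_le
  have hy := exp_mul_node (by linarith : 0 < b) (Nat.succ_pos j)
  push_cast at hy
  constructor
  · have := (node_sub_bounds (by linarith : 0 < b) hj (node b (j + 1))).1
    rw [hy] at this
    have h1 : 0 ≤ node b (j + 1) - node b j := by
      have h0 : 0 ≤ (j + 1 - j : ℝ) / (j + 1) := by apply div_nonneg <;> linarith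
      nlinarith
    have e : (j + 1 - j : ℝ) / (j + 1) = 1 / (j + 1) := by congr 1; ring
    rw [e] at this
    nlinarith
  · refine (le_abs_self _).trans (h.abs_sub_node_le ?_)
    rw [hy]
    simp

/-- Again a difference of squares divided by a sum. Now the nodes differ, so besides `(j+1)⁴ -
(j²-2j-1)² = 8j³ + 4j²` there is the variation of `λr²` from one node to the next, also `O(j³)`. -/
lemma norm_rateIn_succ_sub_rateOut_le (h : Admissible lam b D j)
    (h' : Admissible lam b D (j + 1)) :
    ‖rateIn lam b (j + 1) - rateOut lam b j‖ ≤ 10 * j := by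
  have h5 := h.five_le
  have hL := h.norm_lam_mul_le (t := node b (j + 1)) (by
    rw [abs_of_nonneg (le_trans (by positivity) h.node_succ_sub.1)]
    exact h.node_succ_sub.2)
  have e : (rateIn lam b (j + 1) - rateOut lam b j) * (rateIn lam b (j + 1) + rateOut lam b j)
      = ((8 * (j : ℝ) ^ 3 + 4 * (j : ℝ) ^ 2 : ℝ) : ℂ)
        - (lam * (Real.exp (node b (j + 1)) : ℂ) ^ 2 - lam * (Real.exp (node b j) : ℂ) ^ 2) := by
    have e1 := h'.rateIn_sq
    have e2 := h.rateOut_sq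
    push_cast at e1 e2 ⊢
    linear_combination e1 - e2
  have e2 : ‖(rateIn lam b (j + 1) - rateOut lam b j)‖ * ‖rateIn lam b (j + 1) + rateOut lam b j‖
      ≤ 10 * (j : ℝ) ^ 3 := by
    rw [← norm_mul, e]
    refine (norm_sub_le _ _).trans ?_
    rw [Complex.norm_real, Real.norm_eq_abs, abs_of_nonneg (by positivity)]
    nlinarith [sq_nonneg (j : ℝ)]
  have e3 : (j : ℝ) ^ 2 ≤ ‖rateIn lam b (j + 1) + rateOut lam b j‖ := by
    refine le_trans ?_ (Complex.re_le_norm _)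
    have h1 := h'.re_rateIn
    have h2 := h.re_rateOut
    push_cast at h1
    rw [Complex.add_re]
    nlinarith
  have e4 : ‖rateIn lam b (j + 1) - rateOut lam b j‖ * (j : ℝ) ^ 2 ≤ 10 * j * (j : ℝ) ^ 2 := by
    calc _ ≤ _ := mul_le_mul_of_nonneg_left e3 (norm_nonneg _)
      _ ≤ 10 * (j : ℝ) ^ 3 := e2
      _ = _ := by ring
  exact le_of_mul_le_mul_right e4 (by positivity)

/-- The amplitude decays at least quadratically. -/
lemma re_logAmp_succ_le (h : Admissible lam b D j) (h' : Admissible lam b D (j + 1)) :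
    (logAmp lam b (j + 1)).re ≤ (logAmp lam b j).re - j / 4 := by
  have h5 := h.five_le
  rw [logAmp, Complex.sub_re, Complex.re_ofReal_mul, Complex.add_re]
  have h1 := h'.re_rateIn
  have h2 := h.re_rateOut
  have h3 := h.half_le
  push_cast at h1
  have h4 : (j : ℝ) ^ 2 ≤ (rateOut lam b j).re + (rateIn lam b (j + 1)).re := by nlinarith
  have h6 := h.node_succ_sub.1
  have h7 : (j : ℝ) / 4 ≤ 1 / (j + 1 : ℝ) / 2 * (j : ℝ) ^ 2 := by
    rw [div_div, div_mul_eq_mul_div, le_div_iff₀ (by positivity)]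
    nlinarith
  have h8 : 1 / (j + 1 : ℝ) / 2 * (j : ℝ) ^ 2 ≤ (node b (j + 1) - node b j) / 2
      * ((rateOut lam b j).re + (rateIn lam b (j + 1)).re) := by
    have h9 : 0 ≤ 1 / (j + 1 : ℝ) := by positivity
    exact mul_le_mul (by linarith) h4 (by positivity) (by linarith)
  linarith

end Parameters

/-! ### The incoming, outgoing and bridging waves -/

section Waves

/-- The alternating direction of rotation. -/
noncomputable def rotSign (j : ℕ) : ℝ := (-1) ^ j

lemma rotSign_eq (j : ℕ) : rotSign j = 1 ∨ rotSign j = -1 := neg_one_pow_eq_or ℝ j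

lemma rotSign_succ (j : ℕ) : rotSign (j + 1) = -rotSign j := by
  rw [rotSign, rotSign, pow_succ]; ring

/-- The amplitude of the angular modulation of the outgoing wave. -/
noncomputable def modAmp (j : ℕ) : ℝ := (4 * j + 2) / (2 * (j : ℝ) ^ 2 + 2 * j + 1)

/-- The wave that dominates before the `j`-th transition. -/
noncomputable def inWave (lam : ℂ) (b : ℝ) (j : ℕ) : Plane → ℂ :=
  waveTerm (cutoff (2 + 8 * j) (-8) b)
    (fun t => logAmp lam b j - rateIn lam b j * ((t - node b j : ℝ) : ℂ))
    (fun _ => 0) (rotSign j) (j ^ 2) 0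

/-- The wave that dominates after the `j`-th transition. -/
noncomputable def outWave (lam : ℂ) (b : ℝ) (j : ℕ) : Plane → ℂ :=
  waveTerm (cutoff (2 - 8 * j) 8 b)
    (fun t => logAmp lam b j - rateOut lam b j * ((t - node b j : ℝ) : ℂ))
    (fun _ => modAmp j) (rotSign (j + 1)) ((j + 1) ^ 2) (2 * j ^ 2 + 2 * j + 1)

/-- The cutoff along which the outgoing wave of the `j`-th transition is turned into the incoming
wave of the next one. -/
noncomputable def bend (b : ℝ) (j : ℕ) : ℝ → ℝ := cutoff (-(3 / 2) - 4 * j) 4 b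

/-- The log-amplitude between the transitions `j` and `j + 1`. -/
noncomputable def bridgeExp (lam : ℂ) (b : ℝ) (j : ℕ) (t : ℝ) : ℂ :=
  (logAmp lam b j - rateOut lam b j * ((t - node b j : ℝ) : ℂ))
    + bend b j t * ((rateOut lam b j - rateIn lam b (j + 1))
      * ((t - (node b j + node b (j + 1)) / 2 : ℝ) : ℂ))

/-- The wave between the transitions `j` and `j + 1`. -/
noncomputable def bridgeWave (lam : ℂ) (b : ℝ) (j : ℕ) : Plane → ℂ :=
  waveTerm (fun _ => 1) (bridgeExp lam b j)
    (fun t => (1 - bend b j t) * modAmp j) (rotSign (j + 1)) ((j + 1) ^ 2) (2 * j ^ 2 + 2 * j + 1)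

variable {lam : ℂ} {b D t φ : ℝ} {j : ℕ}

lemma contDiff_linear_exponent (a s : ℂ) (T : ℝ) :
    ContDiff ℝ 2 (fun t : ℝ => a - s * ((t - T : ℝ) : ℂ)) :=
  contDiff_const.sub (contDiff_const.mul
    (Complex.ofRealCLM.contDiff.comp (contDiff_id.sub contDiff_const)))

lemma hasDerivAt_linear_exponent (a s : ℂ) (T t : ℝ) :
    HasDerivAt (fun t : ℝ => a - s * ((t - T : ℝ) : ℂ)) (-s) t := by
  have h : HasDerivAt (fun t : ℝ => ((t - T : ℝ) : ℂ)) ((1 : ℝ) : ℂ) t :=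
    ((hasDerivAt_id t).sub_const T).ofReal_comp
  exact ((h.const_mul s).const_sub a).congr_deriv (by simp)

lemma contDiffAt_inWave {x : Plane} (hx : x ≠ 0) : ContDiffAt ℝ 2 (inWave lam b j) x :=
  contDiffAt_waveTerm contDiff_cutoff (contDiff_linear_exponent _ _ _) contDiff_const hx

lemma contDiffAt_outWave {x : Plane} (hx : x ≠ 0) : ContDiffAt ℝ 2 (outWave lam b j) x :=
  contDiffAt_waveTerm contDiff_cutoff (contDiff_linear_exponent _ _ _) contDiff_const hx

lemma contDiff_bridgeExp : ContDiff ℝ 2 (bridgeExp lam b j) :=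
  (contDiff_linear_exponent _ _ _).add ((Complex.ofRealCLM.contDiff.comp contDiff_cutoff).mul
    (contDiff_const.mul (Complex.ofRealCLM.contDiff.comp (contDiff_id.sub contDiff_const))))

lemma contDiffAt_bridgeWave {x : Plane} (hx : x ≠ 0) : ContDiffAt ℝ 2 (bridgeWave lam b j) x :=
  contDiffAt_waveTerm contDiff_const contDiff_bridgeExp
    ((contDiff_const.sub contDiff_cutoff).mul contDiff_const) hx

/-- The uncut incoming wave in log-polar coordinates. -/
noncomputable def inVal (lam : ℂ) (b : ℝ) (j : ℕ) (t φ : ℝ) : ℂ :=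
  Complex.exp (wavePhase (fun t => logAmp lam b j - rateIn lam b j * ((t - node b j : ℝ) : ℂ))
    (fun _ => 0) (rotSign j) (j ^ 2) 0 t φ)

/-- The uncut outgoing wave in log-polar coordinates. -/
noncomputable def outVal (lam : ℂ) (b : ℝ) (j : ℕ) (t φ : ℝ) : ℂ :=
  Complex.exp (wavePhase (fun t => logAmp lam b j - rateOut lam b j * ((t - node b j : ℝ) : ℂ))
    (fun _ => modAmp j) (rotSign (j + 1)) ((j + 1) ^ 2) (2 * j ^ 2 + 2 * j + 1) t φ)

/-- The angle in which the outgoing wave is modulated. -/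
noncomputable def modAngle (j : ℕ) (φ : ℝ) : ℝ := (2 * (j : ℝ) ^ 2 + 2 * j + 1) * φ

/-- The angular frequency of the outgoing wave. -/
noncomputable def outFreq (j : ℕ) (φ : ℝ) : ℝ :=
  ((j : ℝ) + 1) ^ 2 + (4 * j + 2) * Real.cos (modAngle j φ)

lemma modAmp_mul (j : ℕ) : modAmp j * (2 * (j : ℝ) ^ 2 + 2 * j + 1) = 4 * j + 2 := by
  rw [modAmp, div_mul_cancel₀]
  positivity

/-- The error made by the outgoing wave. -/
noncomputable def outErr (j : ℕ) (φ : ℝ) : ℂ :=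
  ((j : ℂ) ^ 2 - 2 * j - 1) ^ 2 - (outFreq j φ : ℂ) ^ 2
    + rotSign j * Complex.I
      * ((4 * j + 2) * (2 * (j : ℝ) ^ 2 + 2 * j + 1) * Real.sin (modAngle j φ) : ℝ)

lemma inWave_polarPt :
    inWave lam b j (polarPt t φ) = cutoff (2 + 8 * j) (-8) b t * inVal lam b j t φ :=
  waveTerm_polarPt (rotSign_eq j)

lemma outWave_polarPt :
    outWave lam b j (polarPt t φ) = cutoff (2 - 8 * j) 8 b t * outVal lam b j t φ :=
  waveTerm_polarPt (rotSign_eq (j + 1))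

/-- The rate was chosen so that `rateIn² - j⁴ + λr²` vanishes at the node; what survives is the
cutoff and the variation of `λr²`. -/
lemma helmholtz_inWave (h : Admissible lam b D j) :
    (Real.exp t : ℂ) ^ 2 * ((Δ (inWave lam b j)) (polarPt t φ)
        + lam * inWave lam b j (polarPt t φ)) =
      (cutoffDD (2 + 8 * j) (-8) b t - 2 * cutoffD (2 + 8 * j) (-8) b t * rateIn lam b j
        + cutoff (2 + 8 * j) (-8) b t
          * (lam * (Real.exp t : ℂ) ^ 2 - lam * (Real.exp (node b j) : ℂ) ^ 2))
        * inVal lam b j t φ := by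
  have key := laplacian_waveTerm (χ := cutoff (2 + 8 * j) (-8) b)
    (g := fun t => logAmp lam b j - rateIn lam b j * ((t - node b j : ℝ) : ℂ))
    (g' := fun _ => -rateIn lam b j) (g'' := fun _ => 0) (ε := fun _ => 0) (ε' := fun _ => 0)
    (ε'' := fun _ => 0) (n := j ^ 2) (M := 0) (rotSign_eq j) (fun t => hasDerivAt_cutoff)
    (fun t => hasDerivAt_cutoffD) (fun t => hasDerivAt_linear_exponent _ _ _ t)
    (fun t => hasDerivAt_const t _) (fun t => hasDerivAt_const t _)
    (fun t => hasDerivAt_const t _) contDiff_cutoff (contDiff_linear_exponent _ _ _)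
    contDiff_const t φ
  rw [mul_add, inWave_polarPt]
  unfold inWave
  rw [key, ← inVal]
  simp only [phaseRadial, phaseAngular]
  have hs := h.rateIn_sq
  push_cast at hs ⊢
  linear_combination (cutoff (2 + 8 * j) (-8) b t * inVal lam b j t φ : ℂ) * hs

/-- The rate is tuned to the constant frequency `j² - 2j - 1`, which the modulated wave has only
where the cosine is `-1`; `outErr` is the mismatch elsewhere. -/
lemma helmholtz_outWave (h : Admissible lam b D j) :
    (Real.exp t : ℂ) ^ 2 * ((Δ (outWave lam b j)) (polarPt t φ)
        + lam * outWave lam b j (polarPt t φ)) =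
      (cutoffDD (2 - 8 * j) 8 b t - 2 * cutoffD (2 - 8 * j) 8 b t * rateOut lam b j
        + cutoff (2 - 8 * j) 8 b t
          * (lam * (Real.exp t : ℂ) ^ 2 - lam * (Real.exp (node b j) : ℂ) ^ 2 + outErr j φ))
        * outVal lam b j t φ := by
  have key := laplacian_waveTerm (χ := cutoff (2 - 8 * j) 8 b)
    (g := fun t => logAmp lam b j - rateOut lam b j * ((t - node b j : ℝ) : ℂ))
    (g' := fun _ => -rateOut lam b j) (g'' := fun _ => 0) (ε := fun _ => modAmp j)
    (ε' := fun _ => 0)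
    (ε'' := fun _ => 0) (n := (j + 1) ^ 2) (M := 2 * j ^ 2 + 2 * j + 1) (rotSign_eq (j + 1))
    (fun t => hasDerivAt_cutoff)
    (fun t => hasDerivAt_cutoffD) (fun t => hasDerivAt_linear_exponent _ _ _ t)
    (fun t => hasDerivAt_const t _) (fun t => hasDerivAt_const t _)
    (fun t => hasDerivAt_const t _) contDiff_cutoff (contDiff_linear_exponent _ _ _)
    contDiff_const t φ
  rw [mul_add, outWave_polarPt]
  unfold outWave
  rw [key, ← outVal]
  simp only [phaseRadial, phaseAngular, rotSign_succ, outErr, outFreq, modAngle]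
  have hs := h.rateOut_sq
  have hm : (modAmp j : ℂ) * (2 * (j : ℂ) ^ 2 + 2 * j + 1) = 4 * j + 2 := by
    exact_mod_cast modAmp_mul j
  push_cast at hs ⊢
  rw [← hm]
  linear_combination (cutoff (2 - 8 * j) 8 b t * outVal lam b j t φ : ℂ) * hs

lemma fderiv_inWave_left :
    fderiv ℝ (inWave lam b j) (polarPt t φ) (polarPt t φ) =
      (cutoffD (2 + 8 * j) (-8) b t - cutoff (2 + 8 * j) (-8) b t * rateIn lam b j)
        * inVal lam b j t φ := by
  have key := fderiv_waveTerm_left (χ := cutoff (2 + 8 * j) (-8) b) (t := t) (φ := φ)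
    (χ' := cutoffD (2 + 8 * j) (-8) b)
    (g := fun t => logAmp lam b j - rateIn lam b j * ((t - node b j : ℝ) : ℂ))
    (g' := fun _ => -rateIn lam b j) (ε := fun _ => 0) (ε' := fun _ => 0)
    (n := j ^ 2) (M := 0) (rotSign_eq j) hasDerivAt_cutoff
    (hasDerivAt_linear_exponent _ _ _ t)
    (hasDerivAt_const t _) contDiff_cutoff (contDiff_linear_exponent _ _ _)
    contDiff_const
  unfold inWave
  rw [key, ← inVal, phaseRadial]
  push_cast
  ring

lemma fderiv_outWave_left :
    fderiv ℝ (outWave lam b j) (polarPt t φ) (polarPt t φ) =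
      (cutoffD (2 - 8 * j) 8 b t - cutoff (2 - 8 * j) 8 b t * rateOut lam b j)
        * outVal lam b j t φ := by
  have key := fderiv_waveTerm_left (χ := cutoff (2 - 8 * j) 8 b) (t := t) (φ := φ)
    (χ' := cutoffD (2 - 8 * j) 8 b)
    (g := fun t => logAmp lam b j - rateOut lam b j * ((t - node b j : ℝ) : ℂ))
    (g' := fun _ => -rateOut lam b j) (ε := fun _ => modAmp j) (ε' := fun _ => 0)
    (n := (j + 1) ^ 2) (M := 2 * j ^ 2 + 2 * j + 1) (rotSign_eq (j + 1)) hasDerivAt_cutoff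
    (hasDerivAt_linear_exponent _ _ _ t)
    (hasDerivAt_const t _) contDiff_cutoff (contDiff_linear_exponent _ _ _)
    contDiff_const
  unfold outWave
  rw [key, ← outVal, phaseRadial]
  push_cast
  ring

lemma fderiv_inWave_right :
    fderiv ℝ (inWave lam b j) (polarPt t φ) (Real.exp t • unitPerp φ) =
      rotSign j * Complex.I * (cutoff (2 + 8 * j) (-8) b t * (j : ℂ) ^ 2 * inVal lam b j t φ) := by
  unfold inWave
  rw [fderiv_waveTerm_right (rotSign_eq j) contDiff_cutoff (contDiff_linear_exponent _ _ _)
    contDiff_const, ← inVal, phaseAngular]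
  push_cast
  ring

lemma fderiv_outWave_right :
    fderiv ℝ (outWave lam b j) (polarPt t φ) (Real.exp t • unitPerp φ) =
      -(rotSign j * Complex.I * (cutoff (2 - 8 * j) 8 b t * (outFreq j φ : ℂ)
        * outVal lam b j t φ)) := by
  have hm : (modAmp j : ℂ) * (2 * (j : ℂ) ^ 2 + 2 * j + 1) = 4 * j + 2 := by
    exact_mod_cast modAmp_mul j
  unfold outWave
  rw [fderiv_waveTerm_right (rotSign_eq (j + 1)) contDiff_cutoff (contDiff_linear_exponent _ _ _)
    contDiff_const, ← outVal, phaseAngular, outFreq, rotSign_succ, modAngle]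
  push_cast
  rw [← hm]
  ring

end Waves

/-! ### The error near the zeros of the two-wave sum -/

section NearZeros

lemma le_abs_exp_sub_one (x : ℝ) : |x| * Real.exp (-|x|) ≤ |Real.exp x - 1| := by
  rcases le_total 0 x with h | h
  · rw [abs_of_nonneg h, abs_of_nonneg (by linarith [Real.add_one_le_exp x])]
    have h1 : Real.exp (-x) ≤ 1 := Real.exp_le_one_iff.2 (by linarith)
    nlinarith [Real.add_one_le_exp x]
  · have h0 : Real.exp x ≤ 1 := Real.exp_le_one_iff.2 h
    rw [abs_of_nonpos h, abs_of_nonpos (by linarith), neg_neg]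
    have h1 := Real.add_one_le_exp (-x)
    have h2 : Real.exp (-x) * Real.exp x = 1 := by rw [← Real.exp_add]; simp
    nlinarith [Real.exp_pos x]

lemma abs_sin_le_norm_one_add {σ : ℝ} (hσ : σ = 1 ∨ σ = -1) (θ : ℝ) :
    |Real.sin θ| ≤ ‖1 + Complex.exp (σ * Complex.I * θ)‖ ∧
      |1 + Real.cos θ| ≤ ‖1 + Complex.exp (σ * Complex.I * θ)‖ := by
  rcases hσ with rfl | rfl
  · have e : 1 + Complex.exp (((1 : ℝ) : ℂ) * Complex.I * θ) = ⟨1 + Real.cos θ, Real.sin θ⟩ := by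
      rw [show ((1 : ℝ) : ℂ) * Complex.I * θ = (θ : ℂ) * Complex.I by push_cast; ring]
      apply Complex.ext <;> simp [Complex.exp_ofReal_mul_I_re, Complex.exp_ofReal_mul_I_im]
    rw [e]
    exact ⟨Complex.abs_im_le_norm ⟨1 + Real.cos θ, Real.sin θ⟩,
      Complex.abs_re_le_norm ⟨1 + Real.cos θ, Real.sin θ⟩⟩
  · have e : 1 + Complex.exp (((-1 : ℝ) : ℂ) * Complex.I * θ) = ⟨1 + Real.cos θ, -Real.sin θ⟩ := by
      rw [show ((-1 : ℝ) : ℂ) * Complex.I * θ = ((-θ : ℝ) : ℂ) * Complex.I by push_cast; ring]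
      apply Complex.ext
      · rw [Complex.add_re, Complex.exp_ofReal_mul_I_re]; simp
      · rw [Complex.add_im, Complex.exp_ofReal_mul_I_im]; simp
    rw [e]
    refine ⟨?_, Complex.abs_re_le_norm ⟨1 + Real.cos θ, -Real.sin θ⟩⟩
    rw [← abs_neg]
    exact Complex.abs_im_le_norm (⟨1 + Real.cos θ, -Real.sin θ⟩ : ℂ)

/-- Compares the unperturbed sum with the actual one, whose phase difference is modulated and whose
quotient carries a factor `exp X`. The modulation moves the phase by at most `|sin θ|/2`, half of
the left side. The modulus of the quotient controls `X.re`, hence all of `X` by the sector condition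
`hre`, so the imaginary part of `X` cannot create a zero elsewhere. -/
lemma norm_one_add_exp_le_of_perturb {σ θ ε B : ℝ} {X : ℂ} (hσ : σ = 1 ∨ σ = -1)
    (hε : |ε| ≤ 1 / 2) (hX : ‖X‖ ≤ B) (hre : ‖X‖ ≤ 3 * |X.re|) :
    ‖1 + Complex.exp (σ * Complex.I * θ)‖ ≤ 2 * (1 + 3 * Real.exp B * Real.exp B)
      * ‖1 + Complex.exp (X + σ * Complex.I * (θ + ε * Real.sin θ : ℝ))‖ := by
  set ψ : ℝ := θ + ε * Real.sin θ with hψ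
  have hσn : ‖(σ : ℂ)‖ = 1 := by rcases hσ with rfl | rfl <;> simp
  have unit : ∀ x : ℝ, ‖Complex.exp (σ * Complex.I * x)‖ = 1 := by
    intro x
    rw [show (σ * Complex.I * x : ℂ) = ((σ * x : ℝ) : ℂ) * Complex.I by push_cast; ring]
    exact Complex.norm_exp_ofReal_mul_I _
  have s1 : ‖Complex.exp (σ * Complex.I * θ) - Complex.exp (σ * Complex.I * ψ)‖
      ≤ |Real.sin θ| / 2 := by
    have e : Complex.exp (σ * Complex.I * θ) - Complex.exp (σ * Complex.I * ψ)
        = Complex.exp (σ * Complex.I * ψ)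
          * (Complex.exp (Complex.I * ((σ * (θ - ψ) : ℝ) : ℂ)) - 1) := by
      rw [mul_sub, ← Complex.exp_add, mul_one]
      congr 2
      push_cast
      ring
    rw [e, norm_mul, unit, one_mul]
    refine (Real.norm_exp_I_mul_ofReal_sub_one_le).trans ?_
    have : |σ| = 1 := by rcases hσ with rfl | rfl <;> simp
    rw [Real.norm_eq_abs, abs_mul, this, one_mul, hψ, show θ - (θ + ε * Real.sin θ)
      = -(ε * Real.sin θ) by ring, abs_neg, abs_mul]
    nlinarith [abs_nonneg (Real.sin θ)]
  have s2 : ‖1 + Complex.exp (σ * Complex.I * θ)‖ ≤ 2 * ‖1 + Complex.exp (σ * Complex.I * ψ)‖ := by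
    have h1 := norm_add_le (1 + Complex.exp (σ * Complex.I * ψ))
      (Complex.exp (σ * Complex.I * θ) - Complex.exp (σ * Complex.I * ψ))
    rw [show (1 + Complex.exp (σ * Complex.I * ψ))
      + (Complex.exp (σ * Complex.I * θ) - Complex.exp (σ * Complex.I * ψ))
      = 1 + Complex.exp (σ * Complex.I * θ) by ring] at h1
    linarith [(abs_sin_le_norm_one_add hσ θ).1]
  set Z := ‖1 + Complex.exp (X + σ * Complex.I * ψ)‖ with hZ
  have s3 : ‖X‖ ≤ 3 * Real.exp B * Z := by
    have h1 : |Real.exp X.re - 1| ≤ Z := by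
      have := abs_norm_sub_norm_le (Complex.exp (X + σ * Complex.I * ψ)) (-1)
      rw [norm_neg, norm_one, Complex.exp_add, norm_mul, unit, mul_one, Complex.norm_exp,
        sub_neg_eq_add, ← Complex.exp_add, add_comm] at this
      rwa [hZ, ← add_comm, add_comm]
    have h2 := (le_abs_exp_sub_one X.re).trans h1
    have h3 : Real.exp (-B) ≤ Real.exp (-|X.re|) :=
      Real.exp_le_exp.2 (by linarith [Complex.abs_re_le_norm X])
    have h4 : Real.exp B * Real.exp (-B) = 1 := by rw [← Real.exp_add]; simp
    have h5 : |X.re| * Real.exp (-B) ≤ Z :=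
      (mul_le_mul_of_nonneg_left h3 (abs_nonneg _)).trans h2
    have h6 : |X.re| ≤ Real.exp B * Z := by
      calc |X.re| = Real.exp B * (|X.re| * Real.exp (-B)) := by linear_combination -|X.re| * h4
        _ ≤ _ := by gcongr
    linarith
  have s4 : ‖Complex.exp X - 1‖ ≤ ‖X‖ * Real.exp B := by
    have := Complex.norm_exp_sub_sum_le_norm_mul_exp X 1
    simp only [Finset.range_one, Finset.sum_singleton, pow_zero, Nat.factorial_zero, Nat.cast_one,
      div_one, pow_one] at this
    exact this.trans (by gcongr)
  have s5 : ‖1 + Complex.exp (σ * Complex.I * ψ)‖ ≤ Z + ‖X‖ * Real.exp B := by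
    have e : 1 + Complex.exp (σ * Complex.I * ψ) = (1 + Complex.exp (X + σ * Complex.I * ψ))
        - Complex.exp (σ * Complex.I * ψ) * (Complex.exp X - 1) := by
      rw [Complex.exp_add]; ring
    rw [e]
    refine (norm_sub_le _ _).trans ?_
    rw [norm_mul, unit, one_mul]
    linarith
  have hB := Real.exp_pos B
  nlinarith

variable {lam : ℂ} {b D t φ : ℝ} {j : ℕ}

lemma abs_modAmp_le (hj : (5 : ℝ) ≤ j) : |modAmp j| ≤ 1 / 2 := by
  rw [abs_of_nonneg (by unfold modAmp; positivity), modAmp, div_le_iff₀ (by positivity)]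
  nlinarith

/-- Factoring the difference of squares extracts `1 + cos`, and the remaining term has a factor
`sin`; both vanish at angle `π` no slower than `1 + exp(±iθ)`. -/
lemma norm_outErr_le (hj : (5 : ℝ) ≤ j) :
    ‖outErr j φ‖ ≤ 30 * (j : ℝ) ^ 3
      * ‖1 + Complex.exp (rotSign j * Complex.I * modAngle j φ)‖ := by
  obtain ⟨h1, h2⟩ := abs_sin_le_norm_one_add (rotSign_eq j) (modAngle j φ)
  set q := ‖1 + Complex.exp (rotSign j * Complex.I * modAngle j φ)‖
  have hσn : ‖(rotSign j : ℂ)‖ = 1 := by rcases rotSign_eq j with h | h <;> simp [h]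
  have e : outErr j φ = ((-(4 * j + 2) * (1 + Real.cos (modAngle j φ))
      * (2 * (j : ℝ) ^ 2 + (4 * j + 2) * Real.cos (modAngle j φ)) : ℝ) : ℂ)
      + rotSign j * Complex.I
      * ((4 * j + 2) * (2 * (j : ℝ) ^ 2 + 2 * j + 1) * Real.sin (modAngle j φ) : ℝ) := by
    rw [outErr, outFreq]
    push_cast
    ring
  have hc : |2 * (j : ℝ) ^ 2 + (4 * j + 2) * Real.cos (modAngle j φ)| ≤ 3 * (j : ℝ) ^ 2 := by
    have := Real.abs_cos_le_one (modAngle j φ)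
    rw [abs_le] at this ⊢
    constructor <;> nlinarith
  rw [e]
  refine (norm_add_le _ _).trans ?_
  rw [norm_mul, norm_mul, hσn, Complex.norm_I, Complex.norm_real, Complex.norm_real,
    Real.norm_eq_abs, Real.norm_eq_abs, abs_mul, abs_mul, abs_mul, abs_neg,
    abs_of_nonneg (by positivity : (0 : ℝ) ≤ 4 * j + 2),
    abs_of_nonneg (by positivity : (0 : ℝ) ≤ (4 * j + 2) * (2 * (j : ℝ) ^ 2 + 2 * j + 1)),
    one_mul, one_mul]
  have hq : 0 ≤ q := norm_nonneg _
  have a1 : (4 * j + 2 : ℝ) ≤ 5 * j := by linarith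
  have a2 : (2 * (j : ℝ) ^ 2 + 2 * j + 1) ≤ 3 * (j : ℝ) ^ 2 := by nlinarith
  calc _ ≤ 5 * j * q * (3 * (j : ℝ) ^ 2) + 5 * j * (3 * (j : ℝ) ^ 2) * q := by gcongr
    _ = _ := by ring

lemma norm_one_add_unit_le {σ : ℝ} (x : ℝ) :
    ‖1 + Complex.exp (σ * Complex.I * x)‖ ≤ 2 := by
  refine (norm_add_le _ _).trans ?_
  rw [show (σ * Complex.I * x : ℂ) = ((σ * x : ℝ) : ℂ) * Complex.I by push_cast; ring,
    Complex.norm_exp_ofReal_mul_I, norm_one]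
  norm_num

/-- In the quotient of counter-rotating waves the frequencies add up, to `j² + (j+1)²`: this is why
the modulation uses that frequency. -/
lemma inVal_eq : inVal lam b j t φ = outVal lam b j t φ
    * Complex.exp (-((rateIn lam b j - rateOut lam b j) * ((t - node b j : ℝ) : ℂ))
      + rotSign j * Complex.I * (modAngle j φ + modAmp j * Real.sin (modAngle j φ) : ℝ)) := by
  rw [inVal, outVal, ← Complex.exp_add, wavePhase, wavePhase, rotSign_succ, modAngle]
  congr 1
  push_cast
  ring

/-- The error of the outgoing wave vanishes at the zeros of the sum. -/
lemma Admissible.norm_outErr_mul_le (h : Admissible lam b D j) (ht : |t - node b j| ≤ 3 / j) :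
    ‖outErr j φ‖ * ‖outVal lam b j t φ‖ ≤ 60 * (1 + 3 * Real.exp 9 * Real.exp 9) * (j : ℝ) ^ 3
      * ‖inVal lam b j t φ + outVal lam b j t φ‖ := by
  have h5 := h.five_le
  set X := -((rateIn lam b j - rateOut lam b j) * ((t - node b j : ℝ) : ℂ)) with hX
  have hXn : ‖X‖ = ‖rateIn lam b j - rateOut lam b j‖ * |t - node b j| := by
    rw [hX, norm_neg, norm_mul, Complex.norm_real, Real.norm_eq_abs]
  have hXr : |X.re| = |(rateIn lam b j - rateOut lam b j).re| * |t - node b j| := by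
    rw [hX, Complex.neg_re, Complex.re_mul_ofReal, abs_neg, abs_mul]
  have hd := h.norm_rateIn_sub_rateOut_le
  have hr := h.le_re_rateIn_sub_rateOut.trans (le_abs_self _)
  have hXB : ‖X‖ ≤ 9 := by
    rw [hXn]
    calc _ ≤ 3 * j * (3 / (j : ℝ)) := by gcongr
      _ = 9 := by field_simp; norm_num
  -- With `δ = rateIn - rateOut`, the bounds `‖δ‖ ≤ 3j` and `δ.re ≥ j` confine `X` to a sector
  -- around the real axis, although `λ` is complex.
  have hX3 : ‖X‖ ≤ 3 * |X.re| := by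
    rw [hXn, hXr, ← mul_assoc]
    gcongr
    linarith
  have key := norm_one_add_exp_le_of_perturb (θ := modAngle j φ) (rotSign_eq j)
    (abs_modAmp_le h5) hXB hX3
  have e : ‖inVal lam b j t φ + outVal lam b j t φ‖ = ‖outVal lam b j t φ‖
      * ‖1 + Complex.exp (X + rotSign j * Complex.I
        * (modAngle j φ + modAmp j * Real.sin (modAngle j φ) : ℝ))‖ := by
    rw [inVal_eq, ← norm_mul]
    congr 1
    ring
  rw [e]
  have := norm_outErr_le (φ := φ) h5
  calc _ ≤ (30 * (j : ℝ) ^ 3 * (2 * (1 + 3 * Real.exp 9 * Real.exp 9)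
      * ‖1 + Complex.exp (X + rotSign j * Complex.I
        * (modAngle j φ + modAmp j * Real.sin (modAngle j φ) : ℝ))‖))
        * ‖outVal lam b j t φ‖ := by
        gcongr
        exact this.trans (by gcongr)
    _ = _ := by ring

lemma norm_inVal_eq : ‖inVal lam b j t φ‖ = ‖outVal lam b j t φ‖
    * Real.exp (-((rateIn lam b j - rateOut lam b j).re * (t - node b j))) := by
  rw [inVal_eq, norm_mul, Complex.norm_exp]
  congr 2
  rw [Complex.add_re, Complex.neg_re, Complex.re_mul_ofReal, mul_assoc, Complex.re_ofReal_mul,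
    Complex.I_mul_re, Complex.ofReal_im]
  ring

/-- The real parts of the rates differ by at least `j`, so this far past the node the quotient of
the waves is at most `exp(-1/16) ≤ 16/17`. -/
lemma Admissible.norm_inVal_le (h : Admissible lam b D j) (ht : 1 / (16 * j) ≤ t - node b j) :
    ‖inVal lam b j t φ‖ ≤ 16 / 17 * ‖outVal lam b j t φ‖ := by
  have h5 := h.five_le
  have h0 : 1 / 16 ≤ (rateIn lam b j - rateOut lam b j).re * (t - node b j) := by
    calc (1 / 16 : ℝ) = j * (1 / (16 * j)) := by field_simp
      _ ≤ _ := by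
        have := h.le_re_rateIn_sub_rateOut
        have h6 : 0 ≤ (rateIn lam b j - rateOut lam b j).re := by linarith
        gcongr
  rw [norm_inVal_eq, mul_comm]
  gcongr
  rw [Real.exp_neg, inv_le_comm₀ (Real.exp_pos _) (by norm_num)]
  linarith [Real.add_one_le_exp ((rateIn lam b j - rateOut lam b j).re * (t - node b j))]

lemma Admissible.norm_outVal_le (h : Admissible lam b D j) (ht : 1 / (16 * j) ≤ node b j - t) :
    ‖outVal lam b j t φ‖ ≤ 16 / 17 * ‖inVal lam b j t φ‖ := by
  have h5 := h.five_le
  have h0 : 1 / 16 ≤ (rateIn lam b j - rateOut lam b j).re * (node b j - t) := by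
    calc (1 / 16 : ℝ) = j * (1 / (16 * j)) := by field_simp
      _ ≤ _ := by
        have := h.le_re_rateIn_sub_rateOut
        have h6 : 0 ≤ (rateIn lam b j - rateOut lam b j).re := by linarith
        gcongr
  rw [norm_inVal_eq]
  have : 17 / 16 ≤ Real.exp (-((rateIn lam b j - rateOut lam b j).re * (t - node b j))) := by
    have := Real.add_one_le_exp (-((rateIn lam b j - rateOut lam b j).re * (t - node b j)))
    linarith
  nlinarith [norm_nonneg (outVal lam b j t φ)]

end NearZeros

/-! ### Estimates around a transition -/

section Cell

/-- All coefficients are `O(D J³)`; only cancellation in the sum is dangerous. Where both waves are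
uncut, `Λ` multiplies the sum itself and `hRw` controls the rest even at zeros. Otherwise an uncut
wave dominates the other by a factor `17/16`, so the sum is at least `1/17` of it. -/
lemma two_wave_error {J D K : ℝ} (hJ : 1 ≤ J) (hD : 1 ≤ D) (hK : 0 ≤ K) {p w N S Λ R : ℂ}
    {c₁ c₁' c₁'' c₂ c₂' c₂'' : ℝ}
    (hN : ‖N‖ ≤ 2 * J ^ 2) (hS : ‖S‖ ≤ 2 * J ^ 2) (hΛ : ‖Λ‖ ≤ J ^ 3) (hR : ‖R‖ ≤ 60 * J ^ 3)
    (h₁ : |c₁| ≤ 1) (h₂ : |c₂| ≤ 1)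
    (h₁' : |c₁'| ≤ 16 * D * J ∧ |c₁''| ≤ 272 * D * J ^ 2)
    (h₂' : |c₂'| ≤ 16 * D * J ∧ |c₂''| ≤ 272 * D * J ^ 2)
    (hRw : ‖R‖ * ‖w‖ ≤ K * J ^ 3 * ‖p + w‖)
    (hc : ((c₁ = 1 ∧ c₁' = 0 ∧ c₁'' = 0) ∧ (c₂ = 1 ∧ c₂' = 0 ∧ c₂'' = 0)) ∨
      ((c₂ = 1 ∧ c₂' = 0 ∧ c₂'' = 0) ∧ ‖p‖ ≤ 16 / 17 * ‖w‖) ∨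
      ((c₁ = 1 ∧ c₁' = 0 ∧ c₁'' = 0) ∧ ‖w‖ ≤ 16 / 17 * ‖p‖)) :
    ‖(c₁'' - 2 * c₁' * N + c₁ * Λ) * p + (c₂'' - 2 * c₂' * S + c₂ * (Λ + R)) * w‖
      ≤ (K + 14000 * D) * J ^ 3 * ‖c₁ * p + c₂ * w‖ := by
  have hJ3 : 0 < J ^ 3 := by positivity
  have hJ23 : J ^ 2 ≤ J ^ 3 := pow_le_pow_right₀ hJ (by norm_num)
  -- Here `397 = 272 + 64 + 61`. In the dominated cases the two waves add up to at most `16 + 17 =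
  -- 33` times the sum, and `33 · 397 ≤ 14000`.
  have gen : ∀ {c c' c'' : ℝ} {T Q : ℂ}, |c| ≤ 1 →
      (|c'| ≤ 16 * D * J ∧ |c''| ≤ 272 * D * J ^ 2) → ‖T‖ ≤ 2 * J ^ 2 → ‖Q‖ ≤ 61 * J ^ 3 →
      ‖(c'' - 2 * c' * T + c * Q : ℂ)‖ ≤ 397 * D * J ^ 3 := by
    intro c c' c'' T Q h h' hT hQ
    refine (norm_add_le _ _).trans ?_
    have n1 := norm_sub_le (c'' : ℂ) (2 * c' * T)
    rw [norm_mul, norm_mul, Complex.norm_real, Complex.norm_real, Real.norm_eq_abs,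
      Real.norm_eq_abs, Complex.norm_ofNat] at n1
    rw [norm_mul, Complex.norm_real, Real.norm_eq_abs]
    have n2 : 2 * |c'| * ‖T‖ ≤ 2 * (16 * D * J) * (2 * J ^ 2) := by gcongr; exact h'.1
    have n3 : |c| * ‖Q‖ ≤ 1 * (61 * J ^ 3) := by gcongr
    have n4 : 272 * D * J ^ 2 ≤ 272 * D * J ^ 3 := by gcongr
    have n5 : J ^ 3 ≤ D * J ^ 3 := by nlinarith
    have n6 : 2 * (16 * D * J) * (2 * J ^ 2) = 64 * D * J ^ 3 := by ring
    linarith [h'.2]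
  have g₁ := gen h₁ h₁' hN (Q := Λ) (by linarith)
  have g₂ := gen h₂ h₂' hS (Q := Λ + R) ((norm_add_le _ _).trans (by linarith))
  have tri : ‖(c₁'' - 2 * c₁' * N + c₁ * Λ) * p + (c₂'' - 2 * c₂' * S + c₂ * (Λ + R)) * w‖
      ≤ 397 * D * J ^ 3 * ‖p‖ + 397 * D * J ^ 3 * ‖w‖ := by
    refine (norm_add_le _ _).trans ?_
    rw [norm_mul, norm_mul]
    gcongr
  have hnn : 0 ≤ ‖c₁ * p + c₂ * w‖ := norm_nonneg _
  have hDJ : 0 < D * J ^ 3 := by positivity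
  rcases hc with ⟨⟨a1, a2, a3⟩, b1, b2, b3⟩ | ⟨⟨b1, b2, b3⟩, hpw⟩ | ⟨⟨a1, a2, a3⟩, hpw⟩
  · subst a1 a2 a3 b1 b2 b3
    have e : ((0 : ℝ) - 2 * (0 : ℝ) * N + (1 : ℝ) * Λ) * p
        + ((0 : ℝ) - 2 * (0 : ℝ) * S + (1 : ℝ) * (Λ + R)) * w = Λ * (p + w) + R * w := by
      push_cast; ring
    rw [e]
    have e2 : ((1 : ℝ) : ℂ) * p + ((1 : ℝ) : ℂ) * w = p + w := by push_cast; ring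
    rw [e2] at hnn ⊢
    refine (norm_add_le _ _).trans ?_
    rw [norm_mul, norm_mul]
    have : ‖Λ‖ * ‖p + w‖ ≤ D * J ^ 3 * ‖p + w‖ := by gcongr; nlinarith
    nlinarith [mul_nonneg hDJ.le hnn]
  · subst b1
    have low : ‖w‖ ≤ 17 * ‖c₁ * p + (1 : ℝ) * w‖ := by
      have h3 := norm_sub_le (c₁ * p + (1 : ℝ) * w) (c₁ * p)
      rw [show (c₁ * p + (1 : ℝ) * w) - c₁ * p = w by push_cast; ring, norm_mul,
        Complex.norm_real, Real.norm_eq_abs] at h3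
      have : |c₁| * ‖p‖ ≤ 1 * ‖p‖ := by gcongr
      linarith
    have hKn : 0 ≤ K * J ^ 3 * ‖c₁ * p + (1 : ℝ) * w‖ := by positivity
    have hp : ‖p‖ ≤ 16 * ‖c₁ * p + (1 : ℝ) * w‖ := by linarith
    have m₁ := mul_le_mul_of_nonneg_left hp hDJ.le
    have m₂ := mul_le_mul_of_nonneg_left low hDJ.le
    nlinarith [mul_nonneg hDJ.le hnn]
  · subst a1
    have low : ‖p‖ ≤ 17 * ‖(1 : ℝ) * p + c₂ * w‖ := by
      have h3 := norm_sub_le ((1 : ℝ) * p + c₂ * w) (c₂ * w)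
      rw [show ((1 : ℝ) * p + c₂ * w) - c₂ * w = p by push_cast; ring, norm_mul,
        Complex.norm_real, Real.norm_eq_abs] at h3
      have : |c₂| * ‖w‖ ≤ 1 * ‖w‖ := by gcongr
      linarith
    have hKn : 0 ≤ K * J ^ 3 * ‖(1 : ℝ) * p + c₂ * w‖ := by positivity
    have hp : ‖w‖ ≤ 16 * ‖(1 : ℝ) * p + c₂ * w‖ := by linarith
    have m₁ := mul_le_mul_of_nonneg_left hp hDJ.le
    have m₂ := mul_le_mul_of_nonneg_left low hDJ.le
    nlinarith [mul_nonneg hDJ.le hnn]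

/-- Radially both waves are multiplied by nearly `-N`, angularly by nearly `J²` with opposite signs.
Up to lower order the two derivatives are thus the sum and the difference of the waves, which cannot
both be small. -/
lemma two_wave_gradient {J D : ℝ} (hJ : 80 * D + 60 ≤ J) (hD : 1 ≤ D) {p w N S σ : ℂ}
    {c₁ c₁' c₂ c₂' F : ℝ} (hσ : ‖σ‖ = 1)
    (hN : 9 / 10 * J ^ 2 ≤ ‖N‖) (hS : ‖N - S‖ ≤ 3 * J) (hF : |F - J ^ 2| ≤ 7 * J)
    (h₁ : |c₁| ≤ 1) (h₂ : |c₂| ≤ 1) (h₁' : |c₁'| ≤ 16 * D * J) (h₂' : |c₂'| ≤ 16 * D * J)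
    (hc : (c₁ = 1 ∧ c₂ = 1) ∨ (c₂ = 1 ∧ ‖p‖ ≤ ‖w‖) ∨ (c₁ = 1 ∧ ‖w‖ ≤ ‖p‖)) :
    J ^ 2 / 8 * (‖p‖ + ‖w‖) ≤ ‖(c₁' - c₁ * N) * p + (c₂' - c₂ * S) * w‖
      + ‖σ * (c₁ * J ^ 2 * p) + -(σ * (c₂ * F * w))‖ := by
  have hJ0 : 0 ≤ J := by linarith
  have hp := norm_nonneg p
  have hw := norm_nonneg w
  have half : (‖p‖ + ‖w‖) / 2 ≤ ‖c₁ * p‖ + ‖c₂ * w‖ := by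
    rcases hc with ⟨a, b⟩ | ⟨b, hpw⟩ | ⟨a, hpw⟩
    · subst a b; simp only [Complex.ofReal_one, one_mul]; linarith
    · subst b
      simp only [Complex.ofReal_one, one_mul]
      linarith [norm_nonneg (c₁ * p)]
    · subst a
      simp only [Complex.ofReal_one, one_mul]
      linarith [norm_nonneg (c₂ * w)]
  have t1 : ‖N‖ * ‖c₁ * p + c₂ * w‖ ≤ ‖(c₁' - c₁ * N) * p + (c₂' - c₂ * S) * w‖
      + (16 * D * J * ‖p‖ + (16 * D * J + 3 * J) * ‖w‖) := by
    have e : -(N * (c₁ * p + c₂ * w)) = ((c₁' - c₁ * N) * p + (c₂' - c₂ * S) * w)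
        - (c₁' * p + (c₂' + c₂ * (N - S)) * w) := by ring
    rw [← norm_mul, ← norm_neg, e]
    refine (norm_sub_le _ _).trans ?_
    gcongr
    refine (norm_add_le _ _).trans ?_
    rw [norm_mul, norm_mul, Complex.norm_real, Real.norm_eq_abs]
    gcongr
    refine (norm_add_le _ _).trans ?_
    rw [norm_mul, Complex.norm_real, Complex.norm_real, Real.norm_eq_abs, Real.norm_eq_abs]
    have : |c₂| * ‖N - S‖ ≤ 1 * (3 * J) := by gcongr
    linarith
  have t2 : J ^ 2 * ‖c₁ * p - c₂ * w‖ ≤ ‖σ * (c₁ * J ^ 2 * p) + -(σ * (c₂ * F * w))‖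
      + 7 * J * ‖w‖ := by
    have e : σ * ((J ^ 2 : ℝ) * (c₁ * p - c₂ * w)) = (σ * (c₁ * J ^ 2 * p) + -(σ * (c₂ * F * w)))
        + σ * (c₂ * ((F - J ^ 2 : ℝ) : ℂ) * w) := by push_cast; ring
    have e2 : J ^ 2 * ‖c₁ * p - c₂ * w‖ = ‖σ * ((J ^ 2 : ℝ) * (c₁ * p - c₂ * w))‖ := by
      rw [norm_mul, hσ, one_mul, norm_mul, Complex.norm_real, Real.norm_eq_abs,
        abs_of_nonneg (by positivity : 0 ≤ J ^ 2)]
    rw [e2, e]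
    refine (norm_add_le _ _).trans ?_
    gcongr
    rw [norm_mul, hσ, one_mul, norm_mul, norm_mul, Complex.norm_real, Complex.norm_real,
      Real.norm_eq_abs, Real.norm_eq_abs]
    calc _ ≤ 1 * (7 * J) * ‖w‖ := by gcongr
      _ = _ := by ring
  have t3 : ‖c₁ * p‖ + ‖c₂ * w‖ ≤ ‖c₁ * p + c₂ * w‖ + ‖c₁ * p - c₂ * w‖ := by
    have a1 := norm_add_le (c₁ * p + c₂ * w) (c₁ * p - c₂ * w)
    have a2 := norm_sub_le (c₁ * p + c₂ * w) (c₁ * p - c₂ * w)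
    rw [show (c₁ * p + c₂ * w) + (c₁ * p - c₂ * w) = 2 * (c₁ * p) by ring, norm_mul,
      Complex.norm_ofNat] at a1
    rw [show (c₁ * p + c₂ * w) - (c₁ * p - c₂ * w) = 2 * (c₂ * w) by ring, norm_mul,
      Complex.norm_ofNat] at a2
    linarith
  have t4 : 9 / 10 * J ^ 2 * ‖c₁ * p + c₂ * w‖ ≤ ‖N‖ * ‖c₁ * p + c₂ * w‖ := by gcongr
  have t5 : 9 / 10 * J ^ 2 * ((‖p‖ + ‖w‖) / 2)
      ≤ 9 / 10 * J ^ 2 * (‖c₁ * p + c₂ * w‖ + ‖c₁ * p - c₂ * w‖) := by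
    gcongr; linarith
  -- The lower-order terms add up to `(16D + 10) J`; the bound `80D + 60 ≤ J` is what absorbs them.
  have t6 : (16 * D + 10) * J * (‖p‖ + ‖w‖) ≤ J ^ 2 / 5 * (‖p‖ + ‖w‖) := by
    gcongr; nlinarith
  have t7 : 0 ≤ J ^ 2 * ‖c₁ * p - c₂ * w‖ := by positivity
  have t8 : 0 ≤ J * ‖p‖ := by positivity
  have t9 : 0 ≤ J ^ 2 * (‖p‖ + ‖w‖) := by positivity
  nlinarith

variable {lam : ℂ} {b D t φ : ℝ} {j : ℕ}

/-- Uniform bounds on the first two derivatives of the cutoff profile. -/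
def TransitionBound (D : ℝ) : Prop :=
  ∀ x, |deriv Real.smoothTransition x| ≤ D ∧ |deriv (deriv Real.smoothTransition) x| ≤ D

/-- A cutoff acts only where `|exp (b t) - j| ≥ 1/8`; there `t` is at least `1/(16j)` from the node,
and the wave being cut is the dominated one. -/
lemma Admissible.cell_cases (h : Admissible lam b D j) (hy : |Real.exp (b * t) - j| < 3 / 8) :
    ((cutoff (2 + 8 * j) (-8) b t = 1 ∧ cutoffD (2 + 8 * j) (-8) b t = 0
        ∧ cutoffDD (2 + 8 * j) (-8) b t = 0) ∧
      (cutoff (2 - 8 * j) 8 b t = 1 ∧ cutoffD (2 - 8 * j) 8 b t = 0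
        ∧ cutoffDD (2 - 8 * j) 8 b t = 0)) ∨
    ((cutoff (2 - 8 * j) 8 b t = 1 ∧ cutoffD (2 - 8 * j) 8 b t = 0
        ∧ cutoffDD (2 - 8 * j) 8 b t = 0) ∧
      ‖inVal lam b j t φ‖ ≤ 16 / 17 * ‖outVal lam b j t φ‖) ∨
    ((cutoff (2 + 8 * j) (-8) b t = 1 ∧ cutoffD (2 + 8 * j) (-8) b t = 0
        ∧ cutoffDD (2 + 8 * j) (-8) b t = 0) ∧
      ‖outVal lam b j t φ‖ ≤ 16 / 17 * ‖inVal lam b j t φ‖) := by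
  have h5 := h.five_le
  have hj : 0 < j := by
    have : (0 : ℝ) < j := by linarith
    exact_mod_cast this
  have hb := h.b_ge
  have hb1 := h.b_le
  obtain ⟨l1, l2⟩ := node_sub_bounds (by linarith : 0 < b) hj t
  have f1 : Real.exp (b * t) - j < 1 / 8 → (1 : ℝ) < 2 + 8 * j + -8 * Real.exp (b * t) := by
    intro h; linarith
  have f2 : -(1 / 8) < Real.exp (b * t) - j → (1 : ℝ) < 2 - 8 * j + 8 * Real.exp (b * t) := by
    intro h; linarith
  have g : ∀ {a k : ℝ}, 1 < a + k * Real.exp (b * t) →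
      cutoff a k b t = 1 ∧ cutoffD a k b t = 0 ∧ cutoffDD a k b t = 0 :=
    fun h => ⟨cutoff_eq_one h.le, cutoffD_eq_zero h, cutoffDD_eq_zero h⟩
  rw [abs_lt] at hy
  rcases lt_or_ge (Real.exp (b * t) - j) (1 / 8) with c1 | c1
  · rcases lt_or_ge (-(1 / 8)) (Real.exp (b * t) - j) with c2 | c2
    · exact Or.inl ⟨g (f1 c1), g (f2 c2)⟩
    · refine Or.inr (Or.inr ⟨g (f1 c1), h.norm_outVal_le ?_⟩)
      have e1 : (Real.exp (b * t) - j) / j ≤ -(1 / 8) / j := by gcongr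
      have e2 : b * (node b j - t) ≥ 1 / 8 / j := by
        have : -(1 / 8) / (j : ℝ) = -(1 / 8 / j) := by ring
        linarith
      have e3 : 1 / (16 * (j : ℝ)) ≤ 1 / 8 / j := by
        rw [div_div]; gcongr; norm_num
      have e4 : 0 < 1 / 8 / (j : ℝ) := by positivity
      have e5 : 0 ≤ node b j - t := by by_contra hc; nlinarith
      nlinarith
  · refine Or.inr (Or.inl ⟨g (f2 (by linarith)), h.norm_inVal_le ?_⟩)
    have e1 : 1 / (16 * (j : ℝ)) ≤ (Real.exp (b * t) - j) / Real.exp (b * t) := by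
      rw [div_le_div_iff₀ (by positivity) (Real.exp_pos _)]
      nlinarith
    have e4 : 0 < 1 / (16 * (j : ℝ)) := by positivity
    have e5 : 0 ≤ t - node b j := by by_contra hc; nlinarith
    nlinarith

/-- The two-wave function near the `j`-th transition. -/
noncomputable def cellFun (lam : ℂ) (b : ℝ) (j : ℕ) : Plane → ℂ := inWave lam b j + outWave lam b j

lemma contDiffAt_cellFun {x : Plane} (hx : x ≠ 0) : ContDiffAt ℝ 2 (cellFun lam b j) x :=
  (contDiffAt_inWave hx).add (contDiffAt_outWave hx)

lemma cellFun_polarPt : cellFun lam b j (polarPt t φ) =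
    cutoff (2 + 8 * j) (-8) b t * inVal lam b j t φ
      + cutoff (2 - 8 * j) 8 b t * outVal lam b j t φ := by
  rw [cellFun, Pi.add_apply, inWave_polarPt, outWave_polarPt]

lemma abs_cutoff_le_one {a k : ℝ} : |cutoff a k b t| ≤ 1 :=
  abs_le.2 ⟨by linarith [cutoff_nonneg (a := a) (k := k) (b := b) (t := t)], cutoff_le_one⟩

lemma Admissible.cell_helmholtz (h : Admissible lam b D j) (hD : TransitionBound D)
    (hy : |Real.exp (b * t) - j| < 3 / 8) :
    Real.exp t ^ 2 * ‖(Δ (cellFun lam b j)) (polarPt t φ) + lam * cellFun lam b j (polarPt t φ)‖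
      ≤ (60 * (1 + 3 * Real.exp 9 * Real.exp 9) + 14000 * D) * (j : ℝ) ^ 3
        * ‖cellFun lam b j (polarPt t φ)‖ := by
  have h5 := h.five_le
  have hx := polarPt_ne_zero t φ
  have hne : ‖(Real.exp t : ℂ) ^ 2‖ = Real.exp t ^ 2 := by
    rw [norm_pow, Complex.norm_real, Real.norm_eq_abs, abs_of_pos (Real.exp_pos t)]
  have ht := h.abs_sub_node_le (t := t) (by linarith)
  have hyu : Real.exp (b * t) ≤ 2 * j := by linarith [(abs_lt.1 hy).2]
  have hlap : (Δ (cellFun lam b j)) (polarPt t φ)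
      = (Δ (inWave lam b j)) (polarPt t φ) + (Δ (outWave lam b j)) (polarPt t φ) :=
    (contDiffAt_inWave hx).laplacian_add (contDiffAt_outWave hx)
  have e : (Real.exp t : ℂ) ^ 2
      * ((Δ (cellFun lam b j)) (polarPt t φ) + lam * cellFun lam b j (polarPt t φ))
      = (Real.exp t : ℂ) ^ 2 * ((Δ (inWave lam b j)) (polarPt t φ)
        + lam * inWave lam b j (polarPt t φ))
      + (Real.exp t : ℂ) ^ 2 * ((Δ (outWave lam b j)) (polarPt t φ)
        + lam * outWave lam b j (polarPt t φ)) := by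
    rw [hlap, cellFun, Pi.add_apply]
    ring
  rw [← hne, ← norm_mul, e, helmholtz_inWave h, helmholtz_outWave h, cellFun_polarPt]
  have hb0 : 0 ≤ b := by linarith [h.b_ge]
  refine two_wave_error (by linarith) h.D_ge (by positivity) h.norm_rateIn_le h.norm_rateOut_le
    (h.norm_lam_mul_le ht) ?_ abs_cutoff_le_one abs_cutoff_le_one
    (abs_cutoff_deriv_le hD (by norm_num) hb0 h.b_le (by linarith) hyu)
    (abs_cutoff_deriv_le hD (by norm_num) hb0 h.b_le (by linarith) hyu)
    (h.norm_outErr_mul_le ht) (h.cell_cases hy)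
  refine (norm_outErr_le h5).trans ?_
  have := norm_one_add_unit_le (σ := rotSign j) (modAngle j φ)
  calc _ ≤ 30 * (j : ℝ) ^ 3 * 2 := by gcongr
    _ = _ := by ring

lemma norm_fderiv_polarPt_le (L : Plane →L[ℝ] ℂ) :
    ‖L (polarPt t φ)‖ ≤ Real.exp t * ‖L‖ ∧ ‖L (Real.exp t • unitPerp φ)‖ ≤ Real.exp t * ‖L‖ := by
  constructor
  · refine (L.le_opNorm _).trans ?_
    rw [norm_polarPt, mul_comm]
  · refine (L.le_opNorm _).trans ?_
    rw [norm_smul, norm_unitPerp, mul_one, Real.norm_eq_abs, abs_of_pos (Real.exp_pos t), mul_comm]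

lemma Admissible.cell_gradient (h : Admissible lam b D j) (hD : TransitionBound D)
    (hy : |Real.exp (b * t) - j| < 3 / 8) :
    (j : ℝ) ^ 2 * ‖cellFun lam b j (polarPt t φ)‖
      ≤ 16 * (Real.exp t * ‖fderiv ℝ (cellFun lam b j) (polarPt t φ)‖) := by
  have h5 := h.five_le
  have hx := polarPt_ne_zero t φ
  have hb0 : 0 ≤ b := by linarith [h.b_ge]
  have hyu : Real.exp (b * t) ≤ 2 * j := by linarith [(abs_lt.1 hy).2]
  have hf : fderiv ℝ (cellFun lam b j) (polarPt t φ)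
      = fderiv ℝ (inWave lam b j) (polarPt t φ) + fderiv ℝ (outWave lam b j) (polarPt t φ) :=
    fderiv_add ((contDiffAt_inWave hx).differentiableAt (by norm_num))
      ((contDiffAt_outWave hx).differentiableAt (by norm_num))
  obtain ⟨n1, n2⟩ := norm_fderiv_polarPt_le (t := t) (φ := φ)
    (fderiv ℝ (cellFun lam b j) (polarPt t φ))
  have hσn : ‖(rotSign j : ℂ) * Complex.I‖ = 1 := by rcases rotSign_eq j with h | h <;> simp [h]
  have hF : |outFreq j φ - (j : ℝ) ^ 2| ≤ 7 * j := by
    have := abs_le.1 (Real.abs_cos_le_one (modAngle j φ))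
    rw [outFreq, abs_le]
    constructor <;> nlinarith
  have key := two_wave_gradient (p := inVal lam b j t φ) (w := outVal lam b j t φ)
    (F := outFreq j φ) (c₁ := cutoff (2 + 8 * j) (-8) b t) (c₂ := cutoff (2 - 8 * j) 8 b t)
    h.le_index h.D_ge hσn h.le_norm_rateIn
    h.norm_rateIn_sub_rateOut_le hF abs_cutoff_le_one abs_cutoff_le_one
    (abs_cutoff_deriv_le (a := 2 + 8 * j) (k := -8) hD (by norm_num) hb0 h.b_le
      (by linarith) hyu).1
    (abs_cutoff_deriv_le (a := 2 - 8 * j) (k := 8) hD (by norm_num) hb0 h.b_le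
      (by linarith) hyu).1 (by
    rcases h.cell_cases (φ := φ) hy with ⟨a, c⟩ | ⟨c, d⟩ | ⟨a, d⟩
    · exact Or.inl ⟨a.1, c.1⟩
    · exact Or.inr (Or.inl ⟨c.1, d.trans (by linarith [norm_nonneg (outVal lam b j t φ)])⟩)
    · exact Or.inr (Or.inr ⟨a.1, d.trans (by linarith [norm_nonneg (inVal lam b j t φ)])⟩))
  rw [hf, add_apply, fderiv_inWave_left, fderiv_outWave_left, ← hf] at n1
  rw [hf, add_apply, fderiv_inWave_right, fderiv_outWave_right, ← hf] at n2
  have hU : ‖cellFun lam b j (polarPt t φ)‖ ≤ ‖inVal lam b j t φ‖ + ‖outVal lam b j t φ‖ := by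
    rw [cellFun_polarPt]
    refine (norm_add_le _ _).trans ?_
    rw [norm_mul, norm_mul, Complex.norm_real, Complex.norm_real, Real.norm_eq_abs,
      Real.norm_eq_abs]
    have a1 := mul_le_mul_of_nonneg_right (abs_cutoff_le_one (a := 2 + 8 * j) (k := -8) (b := b)
      (t := t)) (norm_nonneg (inVal lam b j t φ))
    have a2 := mul_le_mul_of_nonneg_right (abs_cutoff_le_one (a := 2 - 8 * j) (k := 8) (b := b)
      (t := t)) (norm_nonneg (outVal lam b j t φ))
    linarith
  have hU2 := mul_le_mul_of_nonneg_left hU (by positivity : 0 ≤ (j : ℝ) ^ 2)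
  have e0 : ((j : ℝ) : ℂ) ^ 2 = (j : ℂ) ^ 2 := by push_cast; rfl
  rw [e0] at key
  linarith

lemma Admissible.norm_cellFun_le (h : Admissible lam b D j)
    (hy : |Real.exp (b * t) - j| < 3 / 8) :
    ‖cellFun lam b j (polarPt t φ)‖ ≤ 2 * Real.exp ((logAmp lam b j).re + 6 * j) := by
  have h5 := h.five_le
  have ht := h.abs_sub_node_le (t := t) (by linarith)
  have gen : ∀ {S : ℂ} {ε σ : ℝ} {n M : ℕ}, ‖S‖ ≤ 2 * (j : ℝ) ^ 2 →
      ‖Complex.exp (wavePhase (fun t => logAmp lam b j - S * ((t - node b j : ℝ) : ℂ))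
        (fun _ => ε) σ n M t φ)‖ ≤ Real.exp ((logAmp lam b j).re + 6 * j) := by
    intro S ε σ n M hS
    rw [Complex.norm_exp, Real.exp_le_exp, wavePhase, Complex.add_re, mul_assoc,
      Complex.re_ofReal_mul, Complex.I_mul_re, Complex.ofReal_im, neg_zero, mul_zero, add_zero,
      Complex.sub_re]
    have h1 : -(S * ((t - node b j : ℝ) : ℂ)).re ≤ ‖S‖ * |t - node b j| := by
      have := Complex.abs_re_le_norm (S * ((t - node b j : ℝ) : ℂ))
      rw [norm_mul, Complex.norm_real, Real.norm_eq_abs] at this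
      linarith [neg_abs_le (S * ((t - node b j : ℝ) : ℂ)).re]
    have h2 : ‖S‖ * |t - node b j| ≤ 2 * (j : ℝ) ^ 2 * (3 / j) := by gcongr
    have h3 : 2 * (j : ℝ) ^ 2 * (3 / j) = 6 * j := by field_simp; norm_num
    linarith
  rw [cellFun_polarPt]
  refine (norm_add_le _ _).trans ?_
  rw [norm_mul, norm_mul, Complex.norm_real, Complex.norm_real, Real.norm_eq_abs,
    Real.norm_eq_abs, two_mul]
  have g1 : ‖inVal lam b j t φ‖ ≤ _ := gen h.norm_rateIn_le
  have g2 : ‖outVal lam b j t φ‖ ≤ _ := gen h.norm_rateOut_le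
  refine add_le_add ?_ ?_
  · exact (mul_le_of_le_one_left (norm_nonneg _) abs_cutoff_le_one).trans g1
  · exact (mul_le_of_le_one_left (norm_nonneg _) abs_cutoff_le_one).trans g2

end Cell

/-! ### Estimates between two transitions -/

section Bridge

variable {lam : ℂ} {b D t φ : ℝ} {j : ℕ}

/-- The derivative of `bridgeExp`, up to the constant `-rateOut`. -/
noncomputable def bridgeExpD (lam : ℂ) (b : ℝ) (j : ℕ) (t : ℝ) : ℂ :=
  (rateOut lam b j - rateIn lam b (j + 1)) *
    ((cutoffD (-(3 / 2) - 4 * j) 4 b t * (t - (node b j + node b (j + 1)) / 2)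
      + bend b j t : ℝ) : ℂ)

/-- The second derivative of `bridgeExp`. -/
noncomputable def bridgeExpDD (lam : ℂ) (b : ℝ) (j : ℕ) (t : ℝ) : ℂ :=
  (rateOut lam b j - rateIn lam b (j + 1)) *
    ((cutoffDD (-(3 / 2) - 4 * j) 4 b t * (t - (node b j + node b (j + 1)) / 2)
      + 2 * cutoffD (-(3 / 2) - 4 * j) 4 b t : ℝ) : ℂ)

lemma hasDerivAt_bend : HasDerivAt (bend b j) (cutoffD (-(3 / 2) - 4 * j) 4 b t) t :=
  hasDerivAt_cutoff

lemma hasDerivAt_bridgeExp :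
    HasDerivAt (bridgeExp lam b j) (-rateOut lam b j + bridgeExpD lam b j t) t := by
  have h1 : HasDerivAt (fun t : ℝ => bend b j t * (t - (node b j + node b (j + 1)) / 2))
      (cutoffD (-(3 / 2) - 4 * j) 4 b t * (t - (node b j + node b (j + 1)) / 2)
      + bend b j t) t :=
    (hasDerivAt_bend.mul ((hasDerivAt_id t).sub_const _)).congr_deriv (by simp)
  have h2 := (hasDerivAt_linear_exponent (logAmp lam b j) (rateOut lam b j) (node b j) t).add
    (h1.ofReal_comp.const_mul (rateOut lam b j - rateIn lam b (j + 1)))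
  refine (h2.congr_of_eventuallyEq (Filter.Eventually.of_forall fun t => ?_)).congr_deriv rfl
  simp only [bridgeExp, Pi.add_apply]
  push_cast
  ring

lemma hasDerivAt_bridgeExpD :
    HasDerivAt (fun t => -rateOut lam b j + bridgeExpD lam b j t) (bridgeExpDD lam b j t) t := by
  have h1 : HasDerivAt (fun t : ℝ => cutoffD (-(3 / 2) - 4 * j) 4 b t
        * (t - (node b j + node b (j + 1)) / 2) + bend b j t)
      (cutoffDD (-(3 / 2) - 4 * j) 4 b t * (t - (node b j + node b (j + 1)) / 2)
      + 2 * cutoffD (-(3 / 2) - 4 * j) 4 b t) t :=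
    ((hasDerivAt_cutoffD.mul ((hasDerivAt_id t).sub_const _)).add
      hasDerivAt_bend).congr_deriv (by simp; ring)
  exact (h1.ofReal_comp.const_mul _).const_add _

/-- The phase of the bridging wave in log-polar coordinates. -/
noncomputable def bridgeVal (lam : ℂ) (b : ℝ) (j : ℕ) (t φ : ℝ) : ℂ :=
  Complex.exp (wavePhase (bridgeExp lam b j) (fun t => (1 - bend b j t) * modAmp j)
    (rotSign (j + 1)) ((j + 1) ^ 2) (2 * j ^ 2 + 2 * j + 1) t φ)

lemma bridgeWave_polarPt : bridgeWave lam b j (polarPt t φ) = bridgeVal lam b j t φ := by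
  rw [bridgeWave, waveTerm_polarPt (rotSign_eq (j + 1)), bridgeVal, Complex.ofReal_one, one_mul]

/-- The angular frequency of the bridging wave. -/
noncomputable def bridgeFreq (b : ℝ) (j : ℕ) (t φ : ℝ) : ℝ :=
  ((j : ℝ) + 1) ^ 2 + (1 - bend b j t) * ((4 * j + 2) * Real.cos (modAngle j φ))

/-- The non-constant part of the radial derivative of the phase of the bridging wave. -/
noncomputable def bridgeSlope (lam : ℂ) (b : ℝ) (j : ℕ) (t φ : ℝ) : ℂ :=
  bridgeExpD lam b j t + rotSign (j + 1) * Complex.I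
    * ((-cutoffD (-(3 / 2) - 4 * j) 4 b t * modAmp j) * Real.sin (modAngle j φ) : ℝ)

/-- The second radial derivative of the phase of the bridging wave. -/
noncomputable def bridgeCurv (lam : ℂ) (b : ℝ) (j : ℕ) (t φ : ℝ) : ℂ :=
  bridgeExpDD lam b j t + rotSign (j + 1) * Complex.I
    * ((-cutoffDD (-(3 / 2) - 4 * j) 4 b t * modAmp j) * Real.sin (modAngle j φ) : ℝ)

lemma helmholtz_bridgeWave (h : Admissible lam b D j) :
    (Real.exp t : ℂ) ^ 2 * ((Δ (bridgeWave lam b j)) (polarPt t φ)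
        + lam * bridgeWave lam b j (polarPt t φ)) =
      (bridgeCurv lam b j t φ - 2 * rateOut lam b j * bridgeSlope lam b j t φ
        + bridgeSlope lam b j t φ ^ 2
        + (lam * (Real.exp t : ℂ) ^ 2 - lam * (Real.exp (node b j) : ℂ) ^ 2)
        + ((((j : ℝ) ^ 2 - 2 * j - 1) ^ 2 - bridgeFreq b j t φ ^ 2 : ℝ) : ℂ)
        - rotSign (j + 1) * Complex.I * (((1 - bend b j t) * ((4 * j + 2)
          * ((2 * (j : ℝ) ^ 2 + 2 * j + 1) * Real.sin (modAngle j φ))) : ℝ) : ℂ))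
        * bridgeVal lam b j t φ := by
  have he : ∀ t, HasDerivAt (fun t => (1 - bend b j t) * modAmp j)
      (-cutoffD (-(3 / 2) - 4 * j) 4 b t * modAmp j) t :=
    fun t => (hasDerivAt_bend.const_sub 1).mul_const _
  have he' : ∀ t, HasDerivAt (fun t => -cutoffD (-(3 / 2) - 4 * j) 4 b t * modAmp j)
      (-cutoffDD (-(3 / 2) - 4 * j) 4 b t * modAmp j) t :=
    fun t => (hasDerivAt_cutoffD.neg).mul_const _
  have key := laplacian_waveTerm (χ := fun _ => 1) (χ' := fun _ => 0) (χ'' := fun _ => 0)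
    (n := (j + 1) ^ 2) (M := 2 * j ^ 2 + 2 * j + 1) (rotSign_eq (j + 1))
    (fun t => hasDerivAt_const t _) (fun t => hasDerivAt_const t _)
    (fun t => hasDerivAt_bridgeExp (lam := lam) (b := b) (j := j))
    (fun t => hasDerivAt_bridgeExpD) he he' contDiff_const contDiff_bridgeExp
    ((contDiff_const.sub contDiff_cutoff).mul contDiff_const) t φ
  rw [mul_add, bridgeWave_polarPt]
  unfold bridgeWave
  rw [key, ← bridgeVal]
  simp only [phaseRadial, phaseAngular, bridgeCurv, bridgeSlope, bridgeFreq, modAngle]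
  have hs := h.rateOut_sq
  have hm : (modAmp j : ℂ) * (2 * (j : ℂ) ^ 2 + 2 * j + 1) = 4 * j + 2 := by
    exact_mod_cast modAmp_mul j
  push_cast at hs ⊢
  rw [← hm]
  linear_combination (bridgeVal lam b j t φ : ℂ) * hs

lemma fderiv_bridgeWave_right :
    fderiv ℝ (bridgeWave lam b j) (polarPt t φ) (Real.exp t • unitPerp φ) =
      rotSign (j + 1) * Complex.I * bridgeFreq b j t φ * bridgeVal lam b j t φ := by
  have hm : (modAmp j : ℂ) * (2 * (j : ℂ) ^ 2 + 2 * j + 1) = 4 * j + 2 := by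
    exact_mod_cast modAmp_mul j
  have hε : ContDiff ℝ 2 (fun t => (1 - bend b j t) * modAmp j) :=
    (contDiff_const.sub contDiff_cutoff).mul contDiff_const
  unfold bridgeWave
  rw [fderiv_waveTerm_right (rotSign_eq (j + 1)) contDiff_const contDiff_bridgeExp hε, ← bridgeVal, phaseAngular,
    bridgeFreq, modAngle]
  push_cast
  rw [← hm]
  ring

lemma norm_rotSign_mul_I_mul (x : ℝ) : ‖(rotSign j : ℂ) * Complex.I * (x : ℂ)‖ = |x| := by
  have hσn : ‖(rotSign j : ℂ) * Complex.I‖ = 1 := by rcases rotSign_eq j with h | h <;> simp [h]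
  rw [norm_mul, hσn, one_mul, Complex.norm_real, Real.norm_eq_abs]

lemma Admissible.abs_sub_mid_le (h : Admissible lam b D j)
    (hy : |Real.exp (b * t) - j| ≤ 1) :
    |t - (node b j + node b (j + 1)) / 2| ≤ 5 / j := by
  have h5 := h.five_le
  have h1 := abs_le.1 (h.abs_sub_node_le (t := t) hy)
  obtain ⟨h2, h3⟩ := h.node_succ_sub
  have h4 : 0 ≤ 1 / (j + 1 : ℝ) := by positivity
  have h6 : 0 < 1 / (j : ℝ) := by positivity
  have e3 : 3 / (j : ℝ) = 3 * (1 / j) := by ring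
  have e5 : 5 / (j : ℝ) = 5 * (1 / j) := by ring
  rw [e3] at h1 h3
  rw [e5, abs_le]
  constructor <;> linarith

/-- The bend multiplies the difference of two linear exponents that meet at the midpoint of the
nodes. Their slopes differ by `O(j)` and the distance to the midpoint is `O(1/j)`, so the correction
is `O(1)`, and each derivative costs a factor `j`. -/
lemma norm_bridge_derivs_le (h : Admissible lam b D j) (h' : Admissible lam b D (j + 1))
    (hD : TransitionBound D) (hy : |Real.exp (b * t) - j| ≤ 1) :
    ‖bridgeSlope lam b j t φ‖ ≤ 820 * D * j ∧ ‖bridgeCurv lam b j t φ‖ ≤ 15000 * D * (j : ℝ) ^ 2 := by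
  have h5 := h.five_le
  have hD1 := h.D_ge
  have hb0 : 0 ≤ b := by linarith [h.b_ge]
  have hyu : Real.exp (b * t) ≤ 2 * j := by linarith [(abs_le.1 hy).2]
  obtain ⟨d1, d2⟩ := abs_cutoff_deriv_le (a := -(3 / 2) - 4 * j) (k := 4) hD (by norm_num) hb0
    h.b_le (by linarith : (1 : ℝ) ≤ j) hyu
  have hδ : ‖rateOut lam b j - rateIn lam b (j + 1)‖ ≤ 10 * j := by
    rw [norm_sub_rev]; exact norm_rateIn_succ_sub_rateOut_le h h'
  have hm := h.abs_sub_mid_le hy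
  have ha := abs_modAmp_le h5
  have hs := Real.abs_sin_le_one (modAngle j φ)
  have hbd : |bend b j t| ≤ 1 := abs_cutoff_le_one
  set η' := cutoffD (-(3 / 2) - 4 * j) 4 b t
  set η'' := cutoffDD (-(3 / 2) - 4 * j) 4 b t
  set mid := t - (node b j + node b (j + 1)) / 2
  constructor
  · rw [bridgeSlope, bridgeExpD]
    refine (norm_add_le _ _).trans ?_
    rw [norm_rotSign_mul_I_mul, norm_mul, Complex.norm_real, Real.norm_eq_abs, abs_mul, abs_mul,
      abs_neg]
    have e1 : |η' * mid + bend b j t| ≤ 81 * D := by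
      refine (abs_add_le _ _).trans ?_
      rw [abs_mul]
      have : |η'| * |mid| ≤ 16 * D * j * (5 / j) := by gcongr
      have e : 16 * D * j * (5 / (j : ℝ)) = 80 * D := by field_simp; norm_num
      linarith
    have e2 : ‖rateOut lam b j - rateIn lam b (j + 1)‖ * |η' * mid + bend b j t|
        ≤ 10 * j * (81 * D) := by gcongr
    have e3 : |η'| * |modAmp j| * |Real.sin (modAngle j φ)| ≤ 16 * D * j * (1 / 2) * 1 := by
      gcongr
    have : 0 < D * j := by positivity
    nlinarith
  · rw [bridgeCurv, bridgeExpDD]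
    refine (norm_add_le _ _).trans ?_
    rw [norm_rotSign_mul_I_mul, norm_mul, Complex.norm_real, Real.norm_eq_abs, abs_mul, abs_mul,
      abs_neg]
    have e1 : |η'' * mid + 2 * η'| ≤ 1392 * D * j := by
      refine (abs_add_le _ _).trans ?_
      rw [abs_mul, abs_mul, abs_two]
      have : |η''| * |mid| ≤ 272 * D * (j : ℝ) ^ 2 * (5 / j) := by gcongr
      have e : 272 * D * (j : ℝ) ^ 2 * (5 / (j : ℝ)) = 1360 * D * j := by field_simp; norm_num
      linarith
    have e2 : ‖rateOut lam b j - rateIn lam b (j + 1)‖ * |η'' * mid + 2 * η'|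
        ≤ 10 * j * (1392 * D * j) := by gcongr
    have e3 : |η''| * |modAmp j| * |Real.sin (modAngle j φ)|
        ≤ 272 * D * (j : ℝ) ^ 2 * (1 / 2) * 1 := by gcongr
    have : 0 < D * (j : ℝ) ^ 2 := by positivity
    nlinarith

lemma bend_nonneg : 0 ≤ bend b j t := cutoff_nonneg

lemma bend_le_one : bend b j t ≤ 1 := cutoff_le_one

lemma bridgeFreq_bounds : ((j : ℝ) ^ 2 - 2 * j - 1) ≤ bridgeFreq b j t φ ∧
    bridgeFreq b j t φ ≤ (j : ℝ) ^ 2 + 6 * j + 3 := by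
  have hc := abs_le.1 (Real.abs_cos_le_one (modAngle j φ))
  have h0 := bend_nonneg (b := b) (j := j) (t := t)
  have h1 := bend_le_one (b := b) (j := j) (t := t)
  have hx : |(1 - bend b j t) * ((4 * j + 2) * Real.cos (modAngle j φ))| ≤ 1 * ((4 * j + 2) * 1) := by
    rw [abs_mul, abs_mul, abs_of_nonneg (by linarith : 0 ≤ 1 - bend b j t),
      abs_of_nonneg (by positivity : (0 : ℝ) ≤ 4 * j + 2)]
    gcongr
    · linarith
    · exact Real.abs_cos_le_one _
  rw [abs_le] at hx
  rw [bridgeFreq]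
  constructor <;> nlinarith [hx.1, hx.2]

/-- A single exponential has no zeros, so no cancellation is needed: rate and frequency may disagree
by `O(j)`, which costs `O(j³)` in the difference of squares. -/
lemma bridge_helmholtz (h : Admissible lam b D j) (h' : Admissible lam b D (j + 1))
    (hD : TransitionBound D) (hy : |Real.exp (b * t) - j| ≤ 1) :
    Real.exp t ^ 2
      * ‖(Δ (bridgeWave lam b j)) (polarPt t φ) + lam * bridgeWave lam b j (polarPt t φ)‖
      ≤ 30000 * D * (j : ℝ) ^ 3 * ‖bridgeWave lam b j (polarPt t φ)‖ := by
  have h5 := h.five_le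
  have hD1 := h.D_ge
  have hne : ‖(Real.exp t : ℂ) ^ 2‖ = Real.exp t ^ 2 := by
    rw [norm_pow, Complex.norm_real, Real.norm_eq_abs, abs_of_pos (Real.exp_pos t)]
  rw [← hne, ← norm_mul, helmholtz_bridgeWave h, bridgeWave_polarPt, norm_mul]
  obtain ⟨n1, n2⟩ := norm_bridge_derivs_le (φ := φ) h h' hD hy
  have n3 := h.norm_rateOut_le
  have n4 := h.norm_lam_mul_le (h.abs_sub_node_le (t := t) hy)
  obtain ⟨f1, f2⟩ := bridgeFreq_bounds (b := b) (j := j) (t := t) (φ := φ)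
  have hj0 : (0 : ℝ) < j := by linarith
  gcongr
  set H := bridgeSlope lam b j t φ
  set Q := bridgeCurv lam b j t φ
  set F := bridgeFreq b j t φ
  have hJ : (0 : ℝ) < (j : ℝ) ^ 3 := by positivity
  have hDJ : (j : ℝ) ^ 3 ≤ D * (j : ℝ) ^ 3 := by nlinarith
  have p1 : ‖Q‖ ≤ 15000 * (D * (j : ℝ) ^ 3) := by
    have : (j : ℝ) ^ 2 ≤ (j : ℝ) ^ 3 := pow_le_pow_right₀ (by linarith) (by norm_num)
    nlinarith
  have p2 : ‖2 * rateOut lam b j * H‖ ≤ 3280 * (D * (j : ℝ) ^ 3) := by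
    rw [norm_mul, norm_mul, Complex.norm_ofNat]
    calc _ ≤ 2 * (2 * (j : ℝ) ^ 2) * (820 * D * j) := by gcongr
      _ = _ := by ring
  -- The square is `O(D² j²)`; one factor `D` is traded for `j` by `80 D ≤ j`.
  have p3 : ‖H ^ 2‖ ≤ 8500 * (D * (j : ℝ) ^ 3) := by
    rw [norm_pow]
    have hDj : 80 * D ≤ j := by linarith [h.le_index]
    calc _ ≤ (820 * D * j) ^ 2 := by gcongr
      _ = 8405 * D * (j : ℝ) ^ 2 * (80 * D) := by ring
      _ ≤ 8405 * D * (j : ℝ) ^ 2 * j := by gcongr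
      _ ≤ _ := by nlinarith
  have p4 : ‖((((j : ℝ) ^ 2 - 2 * j - 1) ^ 2 - F ^ 2 : ℝ) : ℂ)‖ ≤ 40 * (D * (j : ℝ) ^ 3) := by
    rw [Complex.norm_real, Real.norm_eq_abs, abs_of_nonpos (by nlinarith [h.half_le])]
    have a1 : F - ((j : ℝ) ^ 2 - 2 * j - 1) ≤ 9 * j := by linarith
    have a2 : F + ((j : ℝ) ^ 2 - 2 * j - 1) ≤ 3 * (j : ℝ) ^ 2 := by nlinarith
    calc _ = (F - ((j : ℝ) ^ 2 - 2 * j - 1)) * (F + ((j : ℝ) ^ 2 - 2 * j - 1)) := by ring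
      _ ≤ 9 * j * (3 * (j : ℝ) ^ 2) := by
        refine mul_le_mul a1 a2 ?_ (by positivity)
        nlinarith [h.half_le]
      _ = 27 * (j : ℝ) ^ 3 := by ring
      _ ≤ _ := by linarith
  have p5 : ‖rotSign (j + 1) * Complex.I * (((1 - bend b j t) * ((4 * j + 2)
          * ((2 * (j : ℝ) ^ 2 + 2 * j + 1) * Real.sin (modAngle j φ))) : ℝ) : ℂ)‖
      ≤ 15 * (D * (j : ℝ) ^ 3) := by
    rw [norm_rotSign_mul_I_mul, abs_mul, abs_mul, abs_mul,
      abs_of_nonneg (by linarith [bend_le_one (b := b) (j := j) (t := t)] : 0 ≤ 1 - bend b j t),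
      abs_of_nonneg (by positivity : (0 : ℝ) ≤ 4 * j + 2),
      abs_of_nonneg (by positivity : (0 : ℝ) ≤ 2 * (j : ℝ) ^ 2 + 2 * j + 1)]
    calc _ ≤ 1 * (5 * j * (3 * (j : ℝ) ^ 2 * 1)) := by
          gcongr
          · linarith [bend_nonneg (b := b) (j := j) (t := t)]
          · linarith
          · nlinarith
          · exact Real.abs_sin_le_one _
      _ = 15 * (j : ℝ) ^ 3 := by ring
      _ ≤ _ := by linarith
  have tri : ∀ a c d e f g : ℂ, ‖a - c + d + e + f - g‖ ≤ ‖a‖ + ‖c‖ + ‖d‖ + ‖e‖ + ‖f‖ + ‖g‖ := by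
    intro a c d e f g
    refine (norm_sub_le _ _).trans ?_
    gcongr
    refine (norm_add_le _ _).trans ?_
    gcongr
    refine (norm_add_le _ _).trans ?_
    gcongr
    refine (norm_add_le _ _).trans ?_
    gcongr
    exact norm_sub_le _ _
  refine (tri _ _ _ _ _ _).trans ?_
  linarith

lemma Admissible.bridge_gradient (h : Admissible lam b D j) :
    (j : ℝ) ^ 2 * ‖bridgeWave lam b j (polarPt t φ)‖
      ≤ 2 * (Real.exp t * ‖fderiv ℝ (bridgeWave lam b j) (polarPt t φ)‖) := by
  have n2 := (norm_fderiv_polarPt_le (t := t) (φ := φ)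
    (fderiv ℝ (bridgeWave lam b j) (polarPt t φ))).2
  have f1 := (bridgeFreq_bounds (b := b) (j := j) (t := t) (φ := φ)).1
  rw [fderiv_bridgeWave_right, norm_mul, norm_rotSign_mul_I_mul] at n2
  rw [bridgeWave_polarPt]
  have h1 : (j : ℝ) ^ 2 / 2 ≤ |bridgeFreq b j t φ| := (h.half_le.trans f1).trans (le_abs_self _)
  have h2 := mul_le_mul_of_nonneg_right h1 (norm_nonneg (bridgeVal lam b j t φ))
  linarith

lemma norm_bridgeWave_le (h : Admissible lam b D j) (h' : Admissible lam b D (j + 1))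
    (hy : |Real.exp (b * t) - j| ≤ 1) :
    ‖bridgeWave lam b j (polarPt t φ)‖ ≤ Real.exp ((logAmp lam b j).re + 6 * j + 50) := by
  have h5 := h.five_le
  have ht := h.abs_sub_node_le (t := t) hy
  have hm := h.abs_sub_mid_le hy
  have hδ : ‖rateOut lam b j - rateIn lam b (j + 1)‖ ≤ 10 * j := by
    rw [norm_sub_rev]; exact norm_rateIn_succ_sub_rateOut_le h h'
  rw [bridgeWave_polarPt, bridgeVal, Complex.norm_exp, Real.exp_le_exp, wavePhase, Complex.add_re,
    mul_assoc, Complex.re_ofReal_mul, Complex.I_mul_re, Complex.ofReal_im, neg_zero, mul_zero,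
    add_zero, bridgeExp, Complex.add_re, Complex.sub_re]
  have h1 : -(rateOut lam b j * ((t - node b j : ℝ) : ℂ)).re ≤ 6 * j := by
    have a1 := Complex.abs_re_le_norm (rateOut lam b j * ((t - node b j : ℝ) : ℂ))
    rw [norm_mul, Complex.norm_real, Real.norm_eq_abs] at a1
    have h2 : ‖rateOut lam b j‖ * |t - node b j| ≤ 2 * (j : ℝ) ^ 2 * (3 / j) := by
      gcongr
      exact h.norm_rateOut_le
    have h3 : 2 * (j : ℝ) ^ 2 * (3 / j) = 6 * j := by field_simp; norm_num
    linarith [neg_abs_le (rateOut lam b j * ((t - node b j : ℝ) : ℂ)).re]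
  have h2 : ((bend b j t : ℂ) * ((rateOut lam b j - rateIn lam b (j + 1))
      * ((t - (node b j + node b (j + 1)) / 2 : ℝ) : ℂ))).re ≤ 50 := by
    refine (Complex.re_le_norm _).trans ?_
    rw [norm_mul, norm_mul, Complex.norm_real, Complex.norm_real, Real.norm_eq_abs,
      Real.norm_eq_abs]
    calc _ ≤ 1 * (10 * j * (5 / (j : ℝ))) := by
          gcongr
          exact abs_cutoff_le_one
      _ = 50 := by field_simp; norm_num
  linarith

end Bridge

/-! ### Gluing the waves into one function -/

section Gluing

variable {lam : ℂ} {b D t φ : ℝ} {i j : ℕ} {x : Plane}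

/-- The cutoff of the innermost wave. -/
noncomputable def baseBend (b : ℝ) (i : ℕ) : ℝ → ℝ := cutoff (5 / 2 - 4 * i) 4 b

/-- The log-amplitude of the innermost wave. -/
noncomputable def baseExp (lam : ℂ) (b : ℝ) (i : ℕ) (t : ℝ) : ℂ :=
  (((i : ℝ) ^ 2 * t : ℝ) : ℂ)
    + baseBend b i t * (logAmp lam b i - rateIn lam b i * ((t - node b i : ℝ) : ℂ)
      - (((i : ℝ) ^ 2 * t : ℝ) : ℂ))

/-- The innermost wave, equal to `z ^ (i ^ 2)` near the origin. -/
noncomputable def baseWave (lam : ℂ) (b : ℝ) (i : ℕ) : Plane → ℂ :=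
  waveTerm (fun _ => 1) (baseExp lam b i) (fun _ => 0) 1 (i ^ 2) 0

/-- The scale `|x|^b`, whose integer values are the transitions. -/
noncomputable def scale (b : ℝ) (x : Plane) : ℝ := Real.exp (b * Real.log ‖x‖)

lemma scale_polarPt : scale b (polarPt t φ) = Real.exp (b * t) := by
  rw [scale, log_norm_polarPt]

lemma continuousAt_scale (hx : x ≠ 0) : ContinuousAt (scale b) x := by
  unfold scale
  exact ((continuous_norm.continuousAt.log (by simpa using hx)).const_mul b).rexp

/-- On this overlap the incoming wave is already gone, the outgoing one is uncut, and the bend has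
not begun. -/
lemma cellFun_eq_bridgeWave (h1 : 1 / 4 ≤ scale b x - j) (h2 : scale b x - j ≤ 3 / 8) :
    cellFun lam b j x = bridgeWave lam b j x := by
  rw [scale] at h1 h2
  have c1 : cutoff (2 + 8 * j) (-8) b (Real.log ‖x‖) = 0 := cutoff_eq_zero (by linarith)
  have c2 : cutoff (2 - 8 * j) 8 b (Real.log ‖x‖) = 1 := cutoff_eq_one (by linarith)
  have c3 : bend b j (Real.log ‖x‖) = 0 := cutoff_eq_zero (by linarith)
  simp only [cellFun, Pi.add_apply, inWave, outWave, bridgeWave, waveTerm, c1, c2, c3, bridgeExp,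
    Complex.ofReal_zero, zero_mul, zero_add, add_zero, sub_zero, one_mul]

/-- After the bend the exponent is linear with slope `-rateIn (j + 1)`. The recursion for `logAmp`
makes the old and new lines meet at the midpoint of the nodes, so the constants agree too. -/
lemma cellFun_succ_eq_bridgeWave (h1 : 5 / 8 ≤ scale b x - j) (h2 : scale b x - j ≤ 3 / 4) :
    cellFun lam b (j + 1) x = bridgeWave lam b j x := by
  rw [scale] at h1 h2
  have c1 : cutoff (2 + 8 * ((j + 1 : ℕ) : ℝ)) (-8) b (Real.log ‖x‖) = 1 :=
    cutoff_eq_one (by push_cast; linarith)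
  have c2 : cutoff (2 - 8 * ((j + 1 : ℕ) : ℝ)) 8 b (Real.log ‖x‖) = 0 :=
    cutoff_eq_zero (by push_cast; linarith)
  have c3 : bend b j (Real.log ‖x‖) = 1 := cutoff_eq_one (by linarith)
  have e : bridgeExp lam b j (Real.log ‖x‖) = logAmp lam b (j + 1)
      - rateIn lam b (j + 1) * ((Real.log ‖x‖ - node b (j + 1) : ℝ) : ℂ) := by
    rw [bridgeExp, c3, logAmp]
    push_cast
    ring
  simp only [cellFun, Pi.add_apply, inWave, outWave, bridgeWave, waveTerm, c1, c2, c3, e,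
    Complex.ofReal_zero, zero_mul, add_zero, sub_self, mul_zero, Complex.exp_zero]

lemma cellFun_eq_baseWave (hi : Even i) (h1 : -(3 / 8) ≤ scale b x - i)
    (h2 : scale b x - i ≤ -(1 / 4)) : cellFun lam b i x = baseWave lam b i x := by
  rw [scale] at h1 h2
  have c1 : cutoff (2 + 8 * i) (-8) b (Real.log ‖x‖) = 1 := cutoff_eq_one (by linarith)
  have c2 : cutoff (2 - 8 * i) 8 b (Real.log ‖x‖) = 0 := cutoff_eq_zero (by linarith)
  have c3 : baseBend b i (Real.log ‖x‖) = 1 := cutoff_eq_one (by linarith)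
  have e : baseExp lam b i (Real.log ‖x‖) = logAmp lam b i
      - rateIn lam b i * ((Real.log ‖x‖ - node b i : ℝ) : ℂ) := by
    rw [baseExp, c3]
    push_cast
    ring
  -- Evenness of the first index makes the first incoming wave rotate like `z`, as the innermost
  -- wave does.
  have hs : rotSign i = 1 := hi.neg_one_pow
  simp only [cellFun, Pi.add_apply, inWave, outWave, baseWave, waveTerm, c1, c2, e, hs,
    Complex.ofReal_zero, zero_mul, add_zero, mul_zero, Complex.exp_zero]

open Classical in
/-- The function glued from the waves, starting with the `i`-th transition. -/
noncomputable def glued (lam : ℂ) (b : ℝ) (i : ℕ) (x : Plane) : ℂ :=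
  if scale b x < i - 1 / 3 then baseWave lam b i x
  else if scale b x - ⌊scale b x⌋₊ < 1 / 3 then cellFun lam b ⌊scale b x⌋₊ x
  else if scale b x - ⌊scale b x⌋₊ < 2 / 3 then bridgeWave lam b ⌊scale b x⌋₊ x
  else cellFun lam b (⌊scale b x⌋₊ + 1) x

lemma scale_pos : 0 < scale b x := Real.exp_pos _

lemma floor_scale_eq {k : ℕ} (h1 : (k : ℝ) ≤ scale b x) (h2 : scale b x < k + 1) :
    ⌊scale b x⌋₊ = k :=
  (Nat.floor_eq_iff scale_pos.le).2 ⟨h1, h2⟩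

/-- The thresholds in `glued` lie strictly inside the overlaps of neighbouring waves. Hence each
wave represents `glued` on an open range of scales, and these ranges cover the punctured plane. -/
lemma glued_eq_baseWave (hi : Even i) (hi1 : 1 ≤ i) (h : scale b x < i - 1 / 4) :
    glued lam b i x = baseWave lam b i x := by
  rw [glued]
  by_cases h1 : scale b x < i - 1 / 3
  · rw [if_pos h1]
  · obtain ⟨k, rfl⟩ : ∃ k, i = k + 1 := ⟨i - 1, by omega⟩
    push_cast at h h1
    rw [if_neg (by push_cast; exact h1), floor_scale_eq (k := k) (by linarith) (by linarith),
      if_neg (by linarith), if_neg (by linarith)]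
    exact cellFun_eq_baseWave hi (by push_cast; linarith) (by push_cast; linarith)

lemma glued_eq_cellFun (hi : Even i) (hi1 : 1 ≤ i) (hij : i ≤ j) (h : |scale b x - j| < 3 / 8) :
    glued lam b i x = cellFun lam b j x := by
  have hij' : (i : ℝ) ≤ j := by exact_mod_cast hij
  obtain ⟨l, r⟩ := abs_lt.1 h
  rw [glued]
  by_cases h1 : scale b x < i - 1 / 3
  · rw [if_pos h1]
    have : j = i := by
      have hlt : (j : ℝ) < i + 1 := by linarith
      have : j < i + 1 := by exact_mod_cast hlt
      omega
    subst this
    exact (cellFun_eq_baseWave hi (by linarith) (by linarith)).symm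
  rw [if_neg h1]
  rcases le_or_gt (j : ℝ) (scale b x) with hc | hc
  · rw [floor_scale_eq hc (by linarith)]
    by_cases h2 : scale b x - j < 1 / 3
    · rw [if_pos h2]
    · rw [if_neg h2, if_pos (by linarith)]
      exact (cellFun_eq_bridgeWave (by linarith) (by linarith)).symm
  · obtain ⟨k, rfl⟩ : ∃ k, j = k + 1 := ⟨j - 1, by omega⟩
    push_cast at hc l r
    rw [floor_scale_eq (k := k) (by linarith) (by linarith), if_neg (by linarith)]
    by_cases h2 : scale b x - k < 2 / 3
    · rw [if_pos h2]
      exact (cellFun_succ_eq_bridgeWave (by linarith) (by linarith)).symm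
    · rw [if_neg h2]

lemma glued_eq_bridgeWave (hij : i ≤ j) (h1 : 1 / 4 < scale b x - j)
    (h2 : scale b x - j < 3 / 4) : glued lam b i x = bridgeWave lam b j x := by
  have hij' : (i : ℝ) ≤ j := by exact_mod_cast hij
  rw [glued, if_neg (by linarith), floor_scale_eq (k := j) (by linarith) (by linarith)]
  split_ifs with h3 h4
  · exact cellFun_eq_bridgeWave (by linarith) (by linarith)
  · rfl
  · exact cellFun_succ_eq_bridgeWave (by linarith) (by linarith)

lemma contDiff_baseExp : ContDiff ℝ 2 (baseExp lam b i) := by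
  have h : ContDiff ℝ 2 (fun t : ℝ => (((i : ℝ) ^ 2 * t : ℝ) : ℂ)) :=
    Complex.ofRealCLM.contDiff.comp (contDiff_const.mul contDiff_id)
  exact h.add ((Complex.ofRealCLM.contDiff.comp contDiff_cutoff).mul
    ((contDiff_linear_exponent _ _ _).sub h))

lemma contDiffAt_baseWave (hx : x ≠ 0) : ContDiffAt ℝ 2 (baseWave lam b i) x :=
  contDiffAt_waveTerm contDiff_const contDiff_baseExp contDiff_const hx

/-- Away from the origin the glued function is locally one of the explicit waves. -/
lemma glued_locally (hi : Even i) (hi1 : 1 ≤ i) (hx : x ≠ 0) :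
    (scale b x < i - 1 / 4 ∧ glued lam b i =ᶠ[nhds x] baseWave lam b i) ∨
    (∃ j, i ≤ j ∧ |scale b x - j| < 3 / 8 ∧ glued lam b i =ᶠ[nhds x] cellFun lam b j) ∨
    (∃ j, i ≤ j ∧ |scale b x - j| ≤ 1 ∧ glued lam b i =ᶠ[nhds x] bridgeWave lam b j) := by
  have hc := continuousAt_scale (b := b) hx
  have cell : ∀ j, i ≤ j → |scale b x - j| < 3 / 8 →
      glued lam b i =ᶠ[nhds x] cellFun lam b j := by
    intro j hj h
    have : ∀ᶠ y in nhds x, |scale b y - j| < 3 / 8 :=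
      ((hc.sub continuousAt_const).abs).eventually_lt continuousAt_const h
    filter_upwards [this] with y hy
    exact glued_eq_cellFun hi hi1 hj hy
  rcases lt_or_ge (scale b x) (i - 1 / 4) with h0 | h0
  · refine Or.inl ⟨h0, ?_⟩
    filter_upwards [hc.eventually_lt continuousAt_const h0] with y hy
    exact glued_eq_baseWave hi hi1 hy
  · refine Or.inr ?_
    rcases lt_or_ge (scale b x) i with h1 | h1
    · have : |scale b x - i| < 3 / 8 := by rw [abs_lt]; constructor <;> linarith
      exact Or.inl ⟨i, le_rfl, this, cell i le_rfl this⟩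
    · have f1 := Nat.floor_le (scale_pos (b := b) (x := x)).le
      have f2 := Nat.lt_floor_add_one (scale b x)
      have hik : i ≤ ⌊scale b x⌋₊ := Nat.le_floor h1
      set k := ⌊scale b x⌋₊
      rcases lt_or_ge (scale b x - k) (3 / 8) with h2 | h2
      · have : |scale b x - k| < 3 / 8 := by rw [abs_lt]; constructor <;> linarith
        exact Or.inl ⟨k, hik, this, cell k hik this⟩
      · rcases lt_or_ge (scale b x - k) (3 / 4) with h3 | h3
        · refine Or.inr ⟨k, hik, by rw [abs_le]; constructor <;> linarith, ?_⟩
          have c1 := continuousAt_const.eventually_lt (hc.sub continuousAt_const)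
            (by linarith : 1 / 4 < scale b x - k)
          have c2 := (hc.sub continuousAt_const).eventually_lt continuousAt_const h3
          filter_upwards [c1, c2] with y hy1 hy2
          exact glued_eq_bridgeWave hik hy1 hy2
        · have : |scale b x - ((k + 1 : ℕ) : ℝ)| < 3 / 8 := by
            push_cast
            rw [abs_lt]; constructor <;> linarith
          exact Or.inl ⟨k + 1, by omega, this, cell (k + 1) (by omega) this⟩

lemma baseExp_of_neg (hi : 2 ≤ i) (hb : 0 < b) (ht : t ≤ 0) :
    baseExp lam b i t = (((i : ℝ) ^ 2 * t : ℝ) : ℂ) := by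
  have hy : Real.exp (b * t) ≤ 1 := Real.exp_le_one_iff.2 (by nlinarith)
  have hi' : (2 : ℝ) ≤ i := by exact_mod_cast hi
  have c3 : baseBend b i t = 0 := cutoff_eq_zero (by linarith)
  rw [baseExp, c3]
  simp

lemma baseWave_eq_pow (hi : 2 ≤ i) (hb : 0 < b) (hx : ‖x‖ < 1) :
    baseWave lam b i x = ((x 0 : ℂ) + Complex.I * (x 1 : ℂ)) ^ (i ^ 2) := by
  have hi2 : i ^ 2 ≠ 0 := by positivity
  rcases eq_or_ne x 0 with rfl | hne
  -- At the origin division by zero makes `angDir` zero, and the exponent is positive, so both sides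
  -- vanish.
  · simp only [baseWave, waveTerm, angDir, PiLp.zero_apply, Complex.ofReal_zero, mul_zero, add_zero,
      zero_div, zero_pow hi2, zero_mul]
  · have hpos : 0 < ‖x‖ := norm_pos_iff.2 hne
    have hl : Real.log ‖x‖ ≤ 0 := Real.log_nonpos hpos.le hx.le
    have e : Complex.exp (((i : ℝ) ^ 2 * Real.log ‖x‖ : ℝ) : ℂ) = (‖x‖ : ℂ) ^ (i ^ 2) := by
      rw [← Complex.ofReal_exp, ← Complex.ofReal_pow]
      congr 1
      rw [← Nat.cast_pow, Real.exp_nat_mul, Real.exp_log hpos]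
    have hxc : (‖x‖ : ℂ) ≠ 0 := by exact_mod_cast hpos.ne'
    simp only [baseWave, waveTerm, baseExp_of_neg hi hb hl, e, angDir, Complex.ofReal_one,
      Complex.ofReal_zero, zero_mul, mul_zero, Complex.exp_zero, mul_one, one_mul]
    rw [← mul_pow, mul_div_cancel₀ _ hxc]

lemma glued_eventuallyEq_pow (hi : Even i) (hi2 : 2 ≤ i) (hb : 0 < b) :
    glued lam b i =ᶠ[nhds 0] fun x => ((x 0 : ℂ) + Complex.I * (x 1 : ℂ)) ^ (i ^ 2) := by
  filter_upwards [Metric.ball_mem_nhds (0 : Plane) one_pos] with x hx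
  rw [mem_ball_zero_iff] at hx
  have hi' : (2 : ℝ) ≤ i := by exact_mod_cast hi2
  have hl : Real.log ‖x‖ ≤ 0 := Real.log_nonpos (norm_nonneg _) hx.le
  -- At the origin `Real.log 0 = 0` makes the scale `1` instead of `0`; it is still below `i - 1/4`.
  have hy : scale b x ≤ 1 := Real.exp_le_one_iff.2 (by nlinarith)
  rw [glued_eq_baseWave hi (by omega) (by linarith), baseWave_eq_pow hi2 hb hx]

lemma contDiff_glued (hi : Even i) (hi2 : 2 ≤ i) (hb : 0 < b) :
    ContDiff ℝ 2 (glued lam b i) := by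
  rw [contDiff_iff_contDiffAt]
  intro x
  rcases eq_or_ne x 0 with rfl | hx
  · refine ContDiffAt.congr_of_eventuallyEq ?_ (glued_eventuallyEq_pow hi hi2 hb)
    have h : ∀ k : Fin 2, ContDiffAt ℝ 2 (fun x : Plane => ((x k : ℝ) : ℂ)) 0 := fun k =>
      Complex.ofRealCLM.contDiff.contDiffAt.comp 0
        ((EuclideanSpace.proj k : Plane →L[ℝ] ℝ).contDiff.contDiffAt)
    exact ((h 0).add (contDiffAt_const.mul (h 1))).pow _
  · rcases glued_locally (lam := lam) (b := b) hi (by omega) hx with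
      ⟨-, h⟩ | ⟨j, -, -, h⟩ | ⟨j, -, -, h⟩
    · exact (contDiffAt_baseWave hx).congr_of_eventuallyEq h
    · exact (contDiffAt_cellFun hx).congr_of_eventuallyEq h
    · exact (contDiffAt_bridgeWave hx).congr_of_eventuallyEq h

lemma glued_ne_zero (hi : Even i) (hi2 : 2 ≤ i) : glued lam b i ≠ 0 := by
  have hi' : (2 : ℝ) ≤ i := by exact_mod_cast hi2
  intro h
  have h1 := congrFun h (polarPt 0 0)
  rw [glued_eq_baseWave hi (by omega) (by rw [scale_polarPt, mul_zero, Real.exp_zero]; linarith),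
    baseWave, waveTerm_polarPt (Or.inl rfl)] at h1
  simp at h1

/-! ### The innermost wave -/

lemma baseWave_polarPt : baseWave lam b i (polarPt t φ)
    = Complex.exp (wavePhase (baseExp lam b i) (fun _ => 0) 1 (i ^ 2) 0 t φ) := by
  rw [baseWave, waveTerm_polarPt (Or.inl rfl), Complex.ofReal_one, one_mul]

/-- For `t < 0` the exponent is `n t` and the expression reduces to `λ exp(2t)`, which supplies the
factor needed to divide by `r²` near the origin. On `[0, T]` compactness suffices. -/
lemma exists_bound_of_contDiff {g : ℝ → ℂ} (hg : ContDiff ℝ 2 g) (lam : ℂ) (n T : ℝ)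
    (h0 : ∀ t ≤ 0, g t = ((n * t : ℝ) : ℂ)) (hn : 0 ≤ n) :
    ∃ C : ℝ, 0 < C ∧ ∀ t ≤ T, (g t).re ≤ C ∧
      ‖deriv (deriv g) t + deriv g t ^ 2 - (n : ℂ) ^ 2 + lam * (Real.exp t : ℂ) ^ 2‖
        ≤ C * Real.exp t ^ 2 := by
  have c1 : Continuous g := hg.continuous
  have hg' : ContDiff ℝ 1 (deriv g) := by
    have h : ContDiff ℝ ((1 : WithTop ℕ∞) + 1) g := by simpa [one_add_one_eq_two] using hg
    exact (contDiff_succ_iff_deriv.1 h).2.2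
  have c2 : Continuous (deriv g) := hg'.continuous
  have c3 : Continuous (deriv (deriv g)) := hg'.continuous_deriv (by norm_num)
  have cE : Continuous fun t : ℝ => (Real.exp t : ℂ) :=
    Complex.continuous_ofReal.comp Real.continuous_exp
  obtain ⟨C₁, h₁⟩ := isCompact_Icc.exists_bound_of_continuousOn (s := Set.Icc (0 : ℝ) T)
    c1.continuousOn
  obtain ⟨C₂, h₂⟩ := isCompact_Icc.exists_bound_of_continuousOn (s := Set.Icc (0 : ℝ) T)
    (f := fun t => deriv (deriv g) t + deriv g t ^ 2 - (n : ℂ) ^ 2 + lam * (Real.exp t : ℂ) ^ 2)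
    (by fun_prop)
  refine ⟨1 + |C₁| + |C₂| + ‖lam‖, by positivity, fun t ht => ?_⟩
  rcases lt_or_ge t 0 with hneg | hpos
  · have e1 : g =ᶠ[nhds t] fun t => ((n * t : ℝ) : ℂ) := by
      filter_upwards [Iio_mem_nhds hneg] with s hs using h0 s (le_of_lt hs)
    have hd : ∀ s, HasDerivAt (fun t : ℝ => ((n * t : ℝ) : ℂ)) (n : ℂ) s := fun s =>
      (((hasDerivAt_id s).const_mul n).ofReal_comp).congr_deriv (by simp)
    have e2 : deriv g =ᶠ[nhds t] fun _ => (n : ℂ) := by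
      filter_upwards [e1.deriv] with s hs
      rw [hs, (hd s).deriv]
    have e3 : deriv (deriv g) t = 0 := by rw [e2.deriv_eq]; simp
    constructor
    · rw [h0 t hneg.le, Complex.ofReal_re]
      nlinarith [abs_nonneg C₁, abs_nonneg C₂, norm_nonneg lam]
    · rw [e3, e2.eq_of_nhds, zero_add, sub_self, zero_add, norm_mul, norm_pow, Complex.norm_real,
        Real.norm_eq_abs, abs_of_pos (Real.exp_pos t)]
      gcongr
      linarith [abs_nonneg C₁, abs_nonneg C₂]
  · have hmem : t ∈ Set.Icc 0 T := ⟨hpos, ht⟩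
    constructor
    · have := (Complex.re_le_norm (g t)).trans (h₁ t hmem)
      linarith [le_abs_self C₁, abs_nonneg C₂, norm_nonneg lam]
    · have h2 := h₂ t hmem
      have h3 : 1 ≤ Real.exp t ^ 2 := one_le_pow₀ (Real.one_le_exp hpos)
      have h4 : 0 ≤ 1 + |C₁| + |C₂| + ‖lam‖ := by positivity
      have h5 : C₂ ≤ 1 + |C₁| + |C₂| + ‖lam‖ := by
        linarith [le_abs_self C₂, abs_nonneg C₁, norm_nonneg lam]
      refine (h2.trans h5).trans ?_
      nlinarith

lemma base_estimates (lam : ℂ) (hi : 2 ≤ i) (hb : 0 < b) (T : ℝ) :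
    ∃ C : ℝ, 0 < C ∧ ∀ t ≤ T, ∀ φ,
      ‖(Δ (baseWave lam b i)) (polarPt t φ) + lam * baseWave lam b i (polarPt t φ)‖
        ≤ C * ‖baseWave lam b i (polarPt t φ)‖ ∧
      ‖baseWave lam b i (polarPt t φ)‖
        ≤ Real.exp t * ‖fderiv ℝ (baseWave lam b i) (polarPt t φ)‖ ∧
      ‖baseWave lam b i (polarPt t φ)‖ ≤ Real.exp C := by
  have hg : ContDiff ℝ 2 (baseExp lam b i) := contDiff_baseExp
  obtain ⟨C, hC, hbd⟩ := exists_bound_of_contDiff hg lam ((i : ℝ) ^ 2) T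
    (fun t ht => baseExp_of_neg hi hb ht) (by positivity)
  have hg' : ContDiff ℝ 1 (deriv (baseExp lam b i)) := by
    have h : ContDiff ℝ ((1 : WithTop ℕ∞) + 1) (baseExp lam b i) := by
      simpa [one_add_one_eq_two] using hg
    exact (contDiff_succ_iff_deriv.1 h).2.2
  have hi' : (2 : ℝ) ≤ i := by exact_mod_cast hi
  refine ⟨C, hC, fun t ht φ => ⟨?_, ?_, ?_⟩⟩
  · have key := laplacian_waveTerm (χ := fun _ => 1) (χ' := fun _ => 0) (χ'' := fun _ => 0)
      (g := baseExp lam b i) (ε := fun _ => 0) (ε' := fun _ => 0) (ε'' := fun _ => 0)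
      (n := i ^ 2) (M := 0) (Or.inl rfl)
      (fun t => hasDerivAt_const t _) (fun t => hasDerivAt_const t _)
      (fun t => (hg.differentiable (by norm_num) t).hasDerivAt)
      (fun t => (hg'.differentiable (by norm_num) t).hasDerivAt)
      (fun t => hasDerivAt_const t _) (fun t => hasDerivAt_const t _) contDiff_const hg
      contDiff_const t φ
    have hE : 0 < Real.exp t ^ 2 := by positivity
    have hne : ‖(Real.exp t : ℂ) ^ 2‖ = Real.exp t ^ 2 := by
      rw [norm_pow, Complex.norm_real, Real.norm_eq_abs, abs_of_pos (Real.exp_pos t)]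
    have e : (Real.exp t : ℂ) ^ 2 * ((Δ (baseWave lam b i)) (polarPt t φ)
        + lam * baseWave lam b i (polarPt t φ))
        = (deriv (deriv (baseExp lam b i)) t + deriv (baseExp lam b i) t ^ 2
          - (((i : ℝ) ^ 2 : ℝ) : ℂ) ^ 2 + lam * (Real.exp t : ℂ) ^ 2)
          * baseWave lam b i (polarPt t φ) := by
      rw [mul_add]
      conv_lhs => arg 1; unfold baseWave
      rw [key, ← baseWave_polarPt]
      simp only [phaseRadial, phaseAngular]
      push_cast
      ring
    have e2 := congrArg norm e
    rw [norm_mul, norm_mul, hne] at e2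
    have := mul_le_mul_of_nonneg_right (hbd t ht).2
      (norm_nonneg (baseWave lam b i (polarPt t φ)))
    rw [← e2] at this
    refine le_of_mul_le_mul_left ?_ hE
    linarith
  · have n2 := (norm_fderiv_polarPt_le (t := t) (φ := φ)
      (fderiv ℝ (baseWave lam b i) (polarPt t φ))).2
    have e : fderiv ℝ (baseWave lam b i) (polarPt t φ) (Real.exp t • unitPerp φ)
        = Complex.I * (i : ℂ) ^ 2 * baseWave lam b i (polarPt t φ) := by
      conv_lhs => unfold baseWave
      rw [fderiv_waveTerm_right (Or.inl rfl) contDiff_const hg contDiff_const, ← baseWave_polarPt,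
        phaseAngular]
      push_cast
      ring
    rw [e, norm_mul, norm_mul, Complex.norm_I, one_mul, norm_pow, Complex.norm_natCast] at n2
    have : ‖baseWave lam b i (polarPt t φ)‖ ≤ (i : ℝ) ^ 2 * ‖baseWave lam b i (polarPt t φ)‖ :=
      le_mul_of_one_le_left (norm_nonneg _) (by nlinarith)
    linarith
  · rw [baseWave_polarPt, Complex.norm_exp, Real.exp_le_exp, wavePhase, Complex.add_re,
      mul_assoc, Complex.re_ofReal_mul, Complex.I_mul_re, Complex.ofReal_im, neg_zero, mul_zero,
      add_zero]
    exact (hbd t ht).1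

end Gluing

/-! ### Choice of the first transition and global estimates -/

section Construction

variable {lam : ℂ} {b D : ℝ} {i j : ℕ}

/-- Here `r_j² = j^(2/b)` with `2/b < 4`, so `λ r_j²` is eventually small against `j⁴`. -/
lemma exists_admissible (lam : ℂ) (hb : 1 / 2 < b) (hb1 : b ≤ 1) (hD : 1 ≤ D) :
    ∃ i : ℕ, Even i ∧ 2 ≤ i ∧ ∀ j ≥ i, Admissible lam b D j := by
  have hb0 : 0 < b := by linarith
  have hexp : 0 < 4 - 2 / b := by
    rw [sub_pos, div_lt_iff₀ hb0]; linarith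
  have hpos : 0 < 1 / (40 * (‖lam‖ + 1)) := by positivity
  have ht := ((tendsto_rpow_neg_atTop hexp).comp tendsto_natCast_atTop_atTop).eventually_lt_const
    hpos
  obtain ⟨k, hk⟩ := Filter.eventually_atTop.1 ht
  obtain ⟨l, hl⟩ := exists_nat_ge (80 * D + 60)
  refine ⟨2 * (k + l + 1), ⟨k + l + 1, by ring⟩, by omega, fun j hj => ?_⟩
  have hj1 : (1 : ℝ) ≤ j := by exact_mod_cast (by omega : 1 ≤ j)
  have hjl : (l : ℝ) ≤ j := by exact_mod_cast (by omega : l ≤ j)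
  have hj0 : (0 : ℝ) < j := by linarith
  refine ⟨hb.le, hb1, hD, hl.trans hjl, ?_⟩
  have h1 := hk j (by omega)
  simp only [Function.comp_apply] at h1
  have e : Real.exp (node b j) ^ 2 = (j : ℝ) ^ (4 : ℝ) * (j : ℝ) ^ (-(4 - 2 / b)) := by
    rw [← Real.rpow_add hj0, ← Real.exp_nat_mul, Real.rpow_def_of_pos hj0, node]
    congr 1
    push_cast
    field_simp
    ring
  have e4 : (j : ℝ) ^ (4 : ℝ) = (j : ℝ) ^ 4 := by exact_mod_cast Real.rpow_natCast (j : ℝ) 4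
  rw [e, e4]
  have hl0 := norm_nonneg lam
  calc ‖lam‖ * ((j : ℝ) ^ 4 * (j : ℝ) ^ (-(4 - 2 / b)))
      ≤ (‖lam‖ + 1) * ((j : ℝ) ^ 4 * (1 / (40 * (‖lam‖ + 1)))) := by
        gcongr
        linarith
    _ = (j : ℝ) ^ 4 / 40 := by field_simp

/-- Sums the single steps, using `j/4 ≥ ((j+1)² - j²)/12`. -/
lemma re_logAmp_le (hA : ∀ j ≥ i, Admissible lam b D j) (hij : i ≤ j) :
    (logAmp lam b j).re ≤ (logAmp lam b i).re - ((j : ℝ) ^ 2 - (i : ℝ) ^ 2) / 12 := by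
  induction j, hij using Nat.le_induction with
  | base => simp
  | succ k hk ih =>
    have h1 := re_logAmp_succ_le (hA k hk) (hA (k + 1) (by omega))
    have h2 := (hA k hk).five_le
    push_cast
    nlinarith

lemma glued_estimates (hi : Even i) (hi2 : 2 ≤ i) (hD : TransitionBound D)
    (hA : ∀ j ≥ i, Admissible lam b D j) :
    ∃ C R : ℝ, 0 < C ∧ 0 < R ∧ ∀ x : Plane, x ≠ 0 →
      (‖x‖ ≤ R ∧ ‖(Δ (glued lam b i)) x + lam * glued lam b i x‖ ≤ C * ‖glued lam b i x‖ ∧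
        ‖glued lam b i x‖ ≤ ‖x‖ * ‖fderiv ℝ (glued lam b i) x‖ ∧ ‖glued lam b i x‖ ≤ C) ∨
      ∃ j ≥ i, |scale b x - j| ≤ 1 ∧
        ‖x‖ ^ 2 * ‖(Δ (glued lam b i)) x + lam * glued lam b i x‖
          ≤ C * (j : ℝ) ^ 3 * ‖glued lam b i x‖ ∧
        (j : ℝ) ^ 2 * ‖glued lam b i x‖ ≤ 16 * (‖x‖ * ‖fderiv ℝ (glued lam b i) x‖) ∧
        ‖glued lam b i x‖ ≤ C * Real.exp ((logAmp lam b j).re + 6 * j) := by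
  have hAi := hA i le_rfl
  have hb0 : 0 < b := by linarith [hAi.b_ge]
  have hD1 := hAi.D_ge
  obtain ⟨C₀, hC₀, hbase⟩ := base_estimates lam hi2 hb0 (node b i)
  set C := Real.exp C₀ + C₀ + (60 * (1 + 3 * Real.exp 9 * Real.exp 9) + 14000 * D) + 30000 * D
    + 2 + Real.exp 50 with hC
  have p1 : 0 < 60 * (1 + 3 * Real.exp 9 * Real.exp 9) + 14000 * D := by positivity
  have p2 := Real.exp_pos C₀
  have p3 := Real.exp_pos 50
  refine ⟨C, Real.exp (node b i), by positivity, Real.exp_pos _, fun x hx => ?_⟩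
  obtain ⟨φ, hφ⟩ := exists_polarPt hx
  set t := Real.log ‖x‖ with ht
  have hn : ‖x‖ = Real.exp t := (Real.exp_log (norm_pos_iff.2 hx)).symm
  rcases glued_locally (lam := lam) (b := b) hi (by omega) hx with
    ⟨hs, h⟩ | ⟨j, hij, hs, h⟩ | ⟨j, hij, hs, h⟩
  all_goals
    rw [(InnerProductSpace.laplacian_congr_nhds h).eq_of_nhds, h.eq_of_nhds, h.fderiv_eq, hn]
  · left
    have htT : t ≤ node b i := by
      have h1 := (node_sub_bounds hb0 (by omega : 0 < i) t).2
      have h2 : Real.exp (b * t) < i - 1 / 4 := hs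
      have h3 : (Real.exp (b * t) - i) / i ≤ 0 :=
        div_nonpos_of_nonpos_of_nonneg (by linarith) (by positivity)
      by_contra hc
      nlinarith
    have hB := hbase t htT φ
    rw [← hφ] at hB
    obtain ⟨b1, b2, b3⟩ := hB
    refine ⟨Real.exp_le_exp.2 htT, b1.trans ?_, b2, b3.trans (by linarith)⟩
    gcongr
    linarith
  · right
    have h1 := (hA j hij).cell_helmholtz (t := t) (φ := φ) hD hs
    have h2 := (hA j hij).cell_gradient (t := t) (φ := φ) hD hs
    have h3 := (hA j hij).norm_cellFun_le (t := t) (φ := φ) hs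
    rw [← hφ] at h1 h2 h3
    refine ⟨j, hij, by linarith, h1.trans ?_, h2, h3.trans ?_⟩
    · gcongr
      linarith
    · gcongr
      linarith
  · right
    have h1 := bridge_helmholtz (t := t) (φ := φ) (hA j hij) (hA (j + 1) (by omega)) hD hs
    have h2 := (hA j hij).bridge_gradient (t := t) (φ := φ)
    have h3 := norm_bridgeWave_le (t := t) (φ := φ) (hA j hij) (hA (j + 1) (by omega)) hs
    rw [← hφ] at h1 h2 h3
    refine ⟨j, hij, hs, h1.trans ?_, h2.trans ?_, h3.trans ?_⟩
    · gcongr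
      linarith
    · have : 0 ≤ Real.exp t * ‖fderiv ℝ (bridgeWave lam b j) x‖ := by positivity
      linarith
    · rw [Real.exp_add _ 50, mul_comm]
      gcongr
      linarith

end Construction

/-! ### Comparing powers of `|x|` and of the bracket -/

section Bracket

variable {x : Plane} {R a : ℝ}

lemma one_le_japaneseBracket (x : Plane) : 1 ≤ japaneseBracket x :=
  Real.one_le_sqrt.2 (by nlinarith [sq_nonneg ‖x‖])

lemma norm_le_japaneseBracket (x : Plane) : ‖x‖ ≤ japaneseBracket x :=
  Real.le_sqrt_of_sq_le (by linarith)

lemma japaneseBracket_le (x : Plane) : japaneseBracket x ≤ 1 + ‖x‖ :=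
  (Real.sqrt_le_left (by positivity)).2 (by nlinarith [norm_nonneg x])

lemma continuous_japaneseBracket_rpow (a : ℝ) : Continuous fun x => japaneseBracket x ^ a := by
  have h : Continuous japaneseBracket := by
    unfold japaneseBracket
    fun_prop
  exact h.rpow_const fun x => Or.inl (by linarith [one_le_japaneseBracket x])

lemma rpow_norm_le_japaneseBracket (hx : 1 ≤ ‖x‖) :
    ‖x‖ ^ a ≤ 2 ^ |a| * japaneseBracket x ^ a := by
  have h0 : 0 < ‖x‖ := by linarith
  have hJ := one_le_japaneseBracket x
  rcases le_total 0 a with ha | ha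
  · have h1 : ‖x‖ ^ a ≤ japaneseBracket x ^ a :=
      Real.rpow_le_rpow h0.le (norm_le_japaneseBracket x) ha
    have h2 : (1 : ℝ) ≤ 2 ^ |a| := Real.one_le_rpow (by norm_num) (abs_nonneg a)
    exact h1.trans (le_mul_of_one_le_left (by positivity) h2)
  · have h1 : (2 * ‖x‖) ^ a ≤ japaneseBracket x ^ a :=
      Real.rpow_le_rpow_of_nonpos (by linarith) (by linarith [japaneseBracket_le x]) ha
    rw [Real.mul_rpow (by norm_num) h0.le] at h1
    rw [abs_of_nonpos ha]
    calc ‖x‖ ^ a = 2 ^ (-a) * (2 ^ a * ‖x‖ ^ a) := by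
          rw [← mul_assoc, ← Real.rpow_add (by norm_num)]; simp
      _ ≤ _ := by gcongr

lemma one_le_mul_japaneseBracket (hR : 0 < R) (hx : ‖x‖ ≤ R) :
    1 ≤ (1 + R) ^ |a| * japaneseBracket x ^ a := by
  have hJ := one_le_japaneseBracket x
  rcases le_total 0 a with ha | ha
  · exact one_le_mul_of_one_le_of_one_le (Real.one_le_rpow (by linarith) (abs_nonneg a))
      (Real.one_le_rpow hJ ha)
  · have h1 : (1 + R) ^ a ≤ japaneseBracket x ^ a :=
      Real.rpow_le_rpow_of_nonpos (by linarith) (by linarith [japaneseBracket_le x]) ha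
    rw [abs_of_nonpos ha]
    calc (1 : ℝ) = (1 + R) ^ (-a) * (1 + R) ^ a := by
          rw [← Real.rpow_add (by linarith)]; simp
      _ ≤ _ := by gcongr

end Bracket

/-! ### The decaying function -/

section Core

/-- The polar estimates say nothing at the origin; density of its complement extends them. -/
lemma le_of_le_off_zero {f g : Plane → ℝ} (hf : Continuous f) (hg : Continuous g)
    (h : ∀ x ≠ 0, f x ≤ g x) (x : Plane) : f x ≤ g x := by
  have h1 : closure ({0}ᶜ : Set Plane) ⊆ {x | f x ≤ g x} :=
    (isClosed_le hf hg).closure_subset_iff.2 fun x hx => h x hx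
  exact h1 ((dense_compl_singleton (0 : Plane)) x)

lemma continuous_laplacian {u : Plane → ℂ} (hu : ContDiff ℝ 2 u) : Continuous (Δ u) := by
  have h1 : ContDiff ℝ 1 (fderiv ℝ u) := hu.fderiv_right (by norm_num)
  have h2 : Continuous (fderiv ℝ (fderiv ℝ u)) := h1.continuous_fderiv (by norm_num)
  have e : Δ u = fun x =>
      fderiv ℝ (fderiv ℝ u) x (EuclideanSpace.single 0 1) (EuclideanSpace.single 0 1)
      + fderiv ℝ (fderiv ℝ u) x (EuclideanSpace.single 1 1) (EuclideanSpace.single 1 1) :=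
    funext (laplacian_eq_sum_fderiv u)
  rw [e]
  exact ((h2.clm_apply continuous_const).clm_apply continuous_const).add
    ((h2.clm_apply continuous_const).clm_apply continuous_const)

lemma scale_eq_rpow {b : ℝ} {x : Plane} (hx : x ≠ 0) : scale b x = ‖x‖ ^ b := by
  rw [scale, Real.rpow_def_of_pos (norm_pos_iff.2 hx), mul_comm]

/-- A function with `Δu + λu` controlled by both `u` and `∇u` that decays like
`exp (-c |x| ^ (2b))`. -/
theorem exists_decaying_function (lam : ℂ) {b : ℝ} (hb : 1 / 2 < b) (hb1 : b ≤ 1) :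
    ∃ (u : Plane → ℂ) (C c : ℝ), 0 < C ∧ 0 < c ∧ ContDiff ℝ 2 u ∧ u ≠ 0 ∧
      (∀ x, ‖(Δ u) x + lam * u x‖ ≤ C * japaneseBracket x ^ (3 * b - 2) * ‖u x‖) ∧
      (∀ x, ‖(Δ u) x + lam * u x‖ ≤ C * japaneseBracket x ^ (b - 1) * ‖fderiv ℝ u x‖) ∧
      (∀ x, ‖u x‖ ≤ C * Real.exp (-c * ‖x‖ ^ (2 * b))) := by
  have hb0 : 0 < b := by linarith
  obtain ⟨D, hD1, hD⟩ := exists_bound_deriv_smoothTransition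
  obtain ⟨i, hi, hi2, hA⟩ := exists_admissible lam hb hb1 hD1
  obtain ⟨C, R, hC, hR, hest⟩ := glued_estimates hi hi2 hD hA
  have hsm : ContDiff ℝ 2 (glued lam b i) := contDiff_glued hi hi2 hb0
  set u := glued lam b i with hu
  have cu : Continuous u := hsm.continuous
  have cL : Continuous fun x => ‖(Δ u) x + lam * u x‖ :=
    ((continuous_laplacian hsm).add (continuous_const.mul cu)).norm
  have cG : Continuous fun x => ‖fderiv ℝ u x‖ := (hsm.continuous_fderiv (by norm_num)).norm
  -- The `300` absorbs the loss `6j` and the passage from `j` to `j + 1`, at half the rate `1/12`: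
  -- what is needed is `j² - 146j + 7199 ≥ 0`, whose square completes at `j = 73`.
  set A₀ := (logAmp lam b i).re + (i : ℝ) ^ 2 / 12 + 300 with hA₀
  set K₁ := C * (1 + R) ^ |3 * b - 2| + 8 * C * 2 ^ |3 * b - 2|
  set K₂ := C * R * (1 + R) ^ |b - 1| + 32 * C * 2 ^ |b - 1|
  set K₃ := C * Real.exp (1 / 24 * R ^ (2 * b)) + C * Real.exp A₀
  have hK₁ : 0 < K₁ := by positivity
  have hK₂ : 0 < K₂ := by positivity
  have hK₃ : 0 < K₃ := by positivity
  -- the zone of large `|x|`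
  have zone : ∀ x : Plane, x ≠ 0 → ∀ j ≥ i, |scale b x - j| ≤ 1 →
      1 ≤ ‖x‖ ∧ (j : ℝ) ≤ 2 * ‖x‖ ^ b := by
    intro x hx j hj hs
    have h5 : (5 : ℝ) ≤ j := (hA j hj).five_le
    rw [scale_eq_rpow hx, abs_le] at hs
    refine ⟨?_, by linarith⟩
    by_contra hlt
    have := Real.rpow_le_one (norm_nonneg x) (not_le.1 hlt).le hb0.le
    linarith
  refine ⟨u, K₁ + K₂ + K₃, 1 / 24, by positivity, by norm_num, hsm, glued_ne_zero hi hi2,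
    le_of_le_off_zero cL ((continuous_const.mul (continuous_japaneseBracket_rpow _)).mul cu.norm) ?_,
    le_of_le_off_zero cL ((continuous_const.mul (continuous_japaneseBracket_rpow _)).mul cG) ?_,
    le_of_le_off_zero cu.norm (continuous_const.mul (Real.continuous_exp.comp
      (continuous_const.mul (continuous_norm.rpow_const fun x => Or.inr (by linarith))))) ?_⟩
  · intro x hx
    have hJ : 0 < japaneseBracket x ^ (3 * b - 2) :=
      Real.rpow_pos_of_pos (by linarith [one_le_japaneseBracket x]) _
    suffices h : ‖(Δ u) x + lam * u x‖ ≤ K₁ * japaneseBracket x ^ (3 * b - 2) * ‖u x‖ by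
      refine h.trans ?_
      gcongr
      linarith
    have hK : C * ((1 + R) ^ |3 * b - 2| * japaneseBracket x ^ (3 * b - 2))
        + 8 * C * (2 ^ |3 * b - 2| * japaneseBracket x ^ (3 * b - 2))
        = K₁ * japaneseBracket x ^ (3 * b - 2) := by ring
    rw [← hK]
    rcases hest x hx with ⟨hxR, h1, -, -⟩ | ⟨j, hj, hs, h1, -, -⟩
    · refine h1.trans ?_
      gcongr
      have h2 := one_le_mul_japaneseBracket (a := 3 * b - 2) hR hxR
      have h3 := mul_le_mul_of_nonneg_left h2 hC.le
      have : 0 ≤ 8 * C * (2 ^ |3 * b - 2| * japaneseBracket x ^ (3 * b - 2)) := by positivity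
      linarith
    · obtain ⟨hx1, hjx⟩ := zone x hx j hj hs
      have hx0 : 0 < ‖x‖ := by linarith
      have e : (‖x‖ ^ b) ^ 3 = ‖x‖ ^ 2 * ‖x‖ ^ (3 * b - 2) := by
        rw [← Real.rpow_natCast, ← Real.rpow_natCast, ← Real.rpow_mul hx0.le,
          ← Real.rpow_add hx0]
        congr 1; push_cast; ring
      have h2 : (j : ℝ) ^ 3 ≤ 8 * (‖x‖ ^ 2 * ‖x‖ ^ (3 * b - 2)) := by
        calc (j : ℝ) ^ 3 ≤ (2 * ‖x‖ ^ b) ^ 3 := by gcongr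
          _ = _ := by rw [mul_pow, e]; norm_num
      have h3 := rpow_norm_le_japaneseBracket (a := 3 * b - 2) hx1
      have h4 : ‖x‖ ^ 2 * ‖(Δ u) x + lam * u x‖ ≤ ‖x‖ ^ 2
          * (8 * C * (2 ^ |3 * b - 2| * japaneseBracket x ^ (3 * b - 2)) * ‖u x‖) := by
        calc _ ≤ C * (j : ℝ) ^ 3 * ‖u x‖ := h1
          _ ≤ C * (8 * (‖x‖ ^ 2 * (2 ^ |3 * b - 2| * japaneseBracket x ^ (3 * b - 2)))) * ‖u x‖ := by
            gcongr
            exact h2.trans (by gcongr)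
          _ = _ := by ring
      refine (le_of_mul_le_mul_left h4 (by positivity)).trans ?_
      gcongr
      have : 0 ≤ C * ((1 + R) ^ |3 * b - 2| * japaneseBracket x ^ (3 * b - 2)) := by positivity
      linarith
  · intro x hx
    have hJ : 0 < japaneseBracket x ^ (b - 1) :=
      Real.rpow_pos_of_pos (by linarith [one_le_japaneseBracket x]) _
    suffices h : ‖(Δ u) x + lam * u x‖ ≤ K₂ * japaneseBracket x ^ (b - 1) * ‖fderiv ℝ u x‖ by
      refine h.trans ?_
      gcongr
      linarith
    have hK : C * R * ((1 + R) ^ |b - 1| * japaneseBracket x ^ (b - 1))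
        + 32 * C * (2 ^ |b - 1| * japaneseBracket x ^ (b - 1))
        = K₂ * japaneseBracket x ^ (b - 1) := by ring
    rw [← hK]
    rcases hest x hx with ⟨hxR, h1, h1', -⟩ | ⟨j, hj, hs, h1, h1', -⟩
    · have h2 := one_le_mul_japaneseBracket (a := b - 1) hR hxR
      have h3 := mul_le_mul_of_nonneg_left h2 (by positivity : 0 ≤ C * R)
      calc _ ≤ C * ‖u x‖ := h1
        _ ≤ C * (R * ‖fderiv ℝ u x‖) := by
          gcongr
          exact h1'.trans (by gcongr)
        _ = C * R * ‖fderiv ℝ u x‖ := by ring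
        _ ≤ _ := by
          gcongr
          have : 0 ≤ 32 * C * (2 ^ |b - 1| * japaneseBracket x ^ (b - 1)) := by positivity
          linarith
    · obtain ⟨hx1, hjx⟩ := zone x hx j hj hs
      have hx0 : 0 < ‖x‖ := by linarith
      have e : ‖x‖ ^ b = ‖x‖ * ‖x‖ ^ (b - 1) := by
        nth_rewrite 2 [← Real.rpow_one ‖x‖]
        rw [← Real.rpow_add hx0]
        congr 1; ring
      have h3 := rpow_norm_le_japaneseBracket (a := b - 1) hx1
      -- Two of the three factors `j` are spent on the gradient bound; the third is at most `2|x|^b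
      -- = 2|x| · |x|^(b-1)`.
      have h4 : ‖x‖ ^ 2 * ‖(Δ u) x + lam * u x‖ ≤ ‖x‖ ^ 2
          * (32 * C * (2 ^ |b - 1| * japaneseBracket x ^ (b - 1)) * ‖fderiv ℝ u x‖) := by
        calc _ ≤ C * (j : ℝ) ^ 3 * ‖u x‖ := h1
          _ = C * j * ((j : ℝ) ^ 2 * ‖u x‖) := by ring
          _ ≤ C * (2 * (‖x‖ * (2 ^ |b - 1| * japaneseBracket x ^ (b - 1))))
              * (16 * (‖x‖ * ‖fderiv ℝ u x‖)) := by
            gcongr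
            rw [e] at hjx
            exact hjx.trans (by gcongr)
          _ = _ := by ring
      refine (le_of_mul_le_mul_left h4 (by positivity)).trans ?_
      gcongr
      have : 0 ≤ C * R * ((1 + R) ^ |b - 1| * japaneseBracket x ^ (b - 1)) := by positivity
      linarith
  · intro x hx
    suffices h : ‖u x‖ ≤ K₃ * Real.exp (-(1 / 24) * ‖x‖ ^ (2 * b)) by
      refine h.trans ?_
      gcongr
      linarith
    have hK : C * (Real.exp (1 / 24 * R ^ (2 * b)) * Real.exp (-(1 / 24) * ‖x‖ ^ (2 * b)))
        + C * (Real.exp A₀ * Real.exp (-(1 / 24) * ‖x‖ ^ (2 * b)))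
        = K₃ * Real.exp (-(1 / 24) * ‖x‖ ^ (2 * b)) := by ring
    rw [← hK, ← Real.exp_add, ← Real.exp_add]
    rcases hest x hx with ⟨hxR, -, -, h1⟩ | ⟨j, hj, hs, -, -, h1⟩
    · have h2 : ‖x‖ ^ (2 * b) ≤ R ^ (2 * b) :=
        Real.rpow_le_rpow (norm_nonneg x) hxR (by linarith)
      have h3 : 1 ≤ Real.exp (1 / 24 * R ^ (2 * b) + -(1 / 24) * ‖x‖ ^ (2 * b)) :=
        Real.one_le_exp (by linarith)
      have h4 := mul_le_mul_of_nonneg_left h3 hC.le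
      have : 0 ≤ C * Real.exp (A₀ + -(1 / 24) * ‖x‖ ^ (2 * b)) := by positivity
      linarith
    · have h2 := re_logAmp_le hA hj
      have e : ‖x‖ ^ (2 * b) = (‖x‖ ^ b) ^ 2 := by
        rw [← Real.rpow_natCast, ← Real.rpow_mul (norm_nonneg x)]
        congr 1; push_cast; ring
      rw [scale_eq_rpow hx, abs_le] at hs
      have h5 := (hA j hj).five_le
      have h3 : (logAmp lam b j).re + 6 * j ≤ A₀ + -(1 / 24) * ‖x‖ ^ (2 * b) := by
        rw [e]
        have a1 : (‖x‖ ^ b) ≤ j + 1 := by linarith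
        have a2 : (‖x‖ ^ b) ^ 2 ≤ ((j : ℝ) + 1) ^ 2 :=
          pow_le_pow_left₀ (by positivity) a1 2
        nlinarith [sq_nonneg ((j : ℝ) - 73)]
      have h4 := mul_le_mul_of_nonneg_left (Real.exp_le_exp.2 h3) hC.le
      have : 0 ≤ C * Real.exp (1 / 24 * R ^ (2 * b) + -(1 / 24) * ‖x‖ ^ (2 * b)) := by positivity
      linarith

end Core

/-! ### From pointwise bounds to potentials -/

section Potentials

variable {u F : Plane → ℂ}

/-- The potential `F / u`, zero where `u` vanishes, has the size by which `F` is bounded. -/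
lemma exists_scalar_potential (hF : Continuous F) (hu : Continuous u) {K : Plane → ℝ}
    (hK : ∀ x, 0 ≤ K x) (h : ∀ x, ‖F x‖ ≤ K x * ‖u x‖) :
    ∃ V : Plane → ℂ, Measurable V ∧ (∀ x, F x = V x * u x) ∧ ∀ x, ‖V x‖ ≤ K x := by
  refine ⟨fun x => F x / u x, hF.measurable.div hu.measurable, fun x => ?_, fun x => ?_⟩
  -- Where `u` vanishes, `h` forces `F` to vanish.
  · rcases eq_or_ne (u x) 0 with h0 | h0
    · have := h x
      rw [h0, norm_zero, mul_zero, norm_le_zero_iff] at this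
      rw [this, h0, mul_zero]
    · rw [div_mul_cancel₀ _ h0]
  · rw [norm_div]
    exact div_le_of_le_mul₀ (norm_nonneg _) (hK x) (h x)

lemma norm_le_add_apply_single (L : Plane →L[ℝ] ℂ) :
    ‖L‖ ≤ ‖L (EuclideanSpace.single 0 1)‖ + ‖L (EuclideanSpace.single 1 1)‖ := by
  refine L.opNorm_le_bound (by positivity) fun v => ?_
  have e : v = v 0 • EuclideanSpace.single 0 (1 : ℝ) + v 1 • EuclideanSpace.single 1 (1 : ℝ) := by
    ext k
    fin_cases k <;> simp
  have hv : ∀ k, |v k| ≤ ‖v‖ := fun k => PiLp.norm_apply_le v k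
  calc ‖L v‖ = ‖v 0 • L (EuclideanSpace.single 0 1) + v 1 • L (EuclideanSpace.single 1 1)‖ := by
        conv_lhs => rw [e]
        rw [map_add, map_smul, map_smul]
    _ ≤ |v 0| * ‖L (EuclideanSpace.single 0 1)‖ + |v 1| * ‖L (EuclideanSpace.single 1 1)‖ := by
        refine (norm_add_le _ _).trans ?_
        rw [norm_smul, norm_smul, Real.norm_eq_abs, Real.norm_eq_abs]
    _ ≤ ‖v‖ * ‖L (EuclideanSpace.single 0 1)‖ + ‖v‖ * ‖L (EuclideanSpace.single 1 1)‖ := by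
        gcongr
        · exact hv 0
        · exact hv 1
    _ = _ := by ring

/-- The vector potential `F` times the conjugate gradient over `|∇u|²`, zero where `∇u` vanishes. -/
lemma exists_vector_potential (hF : Continuous F) (hu : ContDiff ℝ 2 u) {K : Plane → ℝ}
    (hK : ∀ x, 0 ≤ K x) (h : ∀ x, ‖F x‖ ≤ K x * ‖fderiv ℝ u x‖) :
    ∃ W : Plane → EuclideanSpace ℂ (Fin 2), Measurable W ∧ (∀ x, F x = dotGrad W u x) ∧
      ∀ x, ‖W x‖ ≤ 2 * K x := by
  have hc : ∀ k, Continuous (partialD u k) := fun k =>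
    (hu.continuous_fderiv (by norm_num)).clm_apply continuous_const
  set G : Plane → ℝ := fun x => ‖partialD u 0 x‖ ^ 2 + ‖partialD u 1 x‖ ^ 2 with hG
  have cG : Continuous G := ((hc 0).norm.pow 2).add ((hc 1).norm.pow 2)
  -- Each partial derivative is at most `√G`; this crude comparison is the source of the factor `2`
  -- in the conclusion.
  have hGd : ∀ x, ‖fderiv ℝ u x‖ ≤ 2 * Real.sqrt (G x) := by
    intro x
    have h0 : ‖partialD u 0 x‖ ≤ Real.sqrt (G x) :=
      Real.le_sqrt_of_sq_le (by rw [hG]; simp only; nlinarith [sq_nonneg ‖partialD u 1 x‖])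
    have h1 : ‖partialD u 1 x‖ ≤ Real.sqrt (G x) :=
      Real.le_sqrt_of_sq_le (by rw [hG]; simp only; nlinarith [sq_nonneg ‖partialD u 0 x‖])
    have h2 := norm_le_add_apply_single (fderiv ℝ u x)
    have h3 : ‖fderiv ℝ u x‖ ≤ ‖partialD u 0 x‖ + ‖partialD u 1 x‖ := h2
    linarith
  have hG0 : ∀ x, 0 ≤ G x := fun x => by rw [hG]; positivity
  refine ⟨fun x => WithLp.toLp 2 fun k => F x / (G x : ℂ) * (starRingEnd ℂ) (partialD u k x),
    ?_, fun x => ?_, fun x => ?_⟩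
  · refine (WithLp.measurable_toLp 2 _).comp (measurable_pi_iff.2 fun k => ?_)
    exact (hF.measurable.div (Complex.continuous_ofReal.comp cG).measurable).mul
      (Complex.continuous_conj.comp (hc k)).measurable
  · have e : dotGrad (fun x => WithLp.toLp 2 fun k => F x / (G x : ℂ)
        * (starRingEnd ℂ) (partialD u k x)) u x = F x / (G x : ℂ) * (G x : ℂ) := by
      rw [dotGrad, Fin.sum_univ_two, hG]
      push_cast
      rw [← Complex.conj_mul', ← Complex.conj_mul']
      ring
    rw [e]
    rcases eq_or_ne (G x) 0 with h0 | h0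
    · have h1 := hGd x
      rw [h0, Real.sqrt_zero, mul_zero] at h1
      have h2 := (h x).trans (mul_le_mul_of_nonneg_left h1 (hK x))
      rw [mul_zero, norm_le_zero_iff] at h2
      rw [h2, zero_div, zero_mul]
    · rw [div_mul_cancel₀]
      exact_mod_cast h0
  · have e : ‖(WithLp.toLp 2 fun k => F x / (G x : ℂ) * (starRingEnd ℂ) (partialD u k x) :
        EuclideanSpace ℂ (Fin 2))‖ = ‖F x‖ / G x * Real.sqrt (G x) := by
      have e1 : ∀ k, ‖F x / (G x : ℂ) * (starRingEnd ℂ) (partialD u k x)‖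
          = ‖F x‖ / G x * ‖partialD u k x‖ := by
        intro k
        rw [norm_mul, norm_div, Complex.norm_conj, Complex.norm_real, Real.norm_eq_abs,
          abs_of_nonneg (hG0 x)]
      rw [EuclideanSpace.norm_eq, Fin.sum_univ_two]
      simp only [e1]
      rw [mul_pow, mul_pow, ← mul_add, Real.sqrt_mul (by positivity), Real.sqrt_sq]
      exact div_nonneg (norm_nonneg _) (hG0 x)
    rw [e]
    rcases (hG0 x).eq_or_lt with h0 | h0
    · rw [← h0, Real.sqrt_zero, mul_zero]
      linarith [hK x]
    · have hs := Real.sqrt_pos.2 h0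
      rw [div_mul_eq_mul_div, div_le_iff₀ h0]
      nth_rewrite 2 [← Real.mul_self_sqrt h0.le]
      have := (h x).trans (mul_le_mul_of_nonneg_left (hGd x) (hK x))
      nlinarith

end Potentials

/-! ### The two parts of the theorem -/

theorem proposition6p1 (lam : ℂ) :
    (∀ N β₀ : ℝ, 0 ≤ N → β₀ = (4 - 2 * N) / 3 → 1 < β₀ →
      ∃ (V : Plane → ℂ) (u : Plane → ℂ) (C c : ℝ),
        0 < C ∧ 0 < c ∧ Measurable V ∧ ContDiff ℝ 2 u ∧ u ≠ 0 ∧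
        (∀ x, (Δ u) x + lam * u x = V x * u x) ∧
        (∀ x, ‖V x‖ ≤ C * japaneseBracket x ^ (-N)) ∧
        (∀ x, 2 ≤ ‖x‖ → ‖u x‖ ≤ C * Real.exp (-c * (‖x‖ ^ β₀ / Real.log ‖x‖)))) ∧
    (∀ P β₀ : ℝ, 0 ≤ P → β₀ = 2 - 2 * P → 1 < β₀ →
      ∃ (W : Plane → EuclideanSpace ℂ (Fin 2)) (u : Plane → ℂ) (C c : ℝ),
        0 < C ∧ 0 < c ∧ Measurable W ∧ ContDiff ℝ 2 u ∧ u ≠ 0 ∧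
        (∀ x, (Δ u) x + lam * u x = dotGrad W u x) ∧
        (∀ x, ‖W x‖ ≤ C * japaneseBracket x ^ (-P)) ∧
        (∀ x, ‖u x‖ ≤ C * Real.exp (-c * ‖x‖ ^ β₀))) := by
  have hJ : ∀ (a : ℝ) (x : Plane), 0 ≤ japaneseBracket x ^ a := fun a x =>
    Real.rpow_nonneg (by linarith [one_le_japaneseBracket x]) a
  constructor
  · intro N β₀ hN hβ hβ1
    -- With `b = β₀/2`, `β₀ > 1` is `b > 1/2`, and `N ≥ 0` gives `b ≤ 2/3`.
    obtain ⟨u, C, c, hC, hc, hu, hu0, h1, -, h3⟩ :=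
      exists_decaying_function lam (b := β₀ / 2) (by linarith) (by linarith)
    rw [show 3 * (β₀ / 2) - 2 = -N by linarith] at h1
    rw [show 2 * (β₀ / 2) = β₀ by ring] at h3
    obtain ⟨V, hV, hVu, hVb⟩ := exists_scalar_potential
      ((continuous_laplacian hu).add (continuous_const.mul hu.continuous)) hu.continuous
      (fun x => mul_nonneg hC.le (hJ (-N) x)) h1
    -- The available decay has no logarithm; as `log |x| ≥ log 2`, shrinking `c` by `log 2` gives
    -- the stated form.
    refine ⟨V, u, C, c * Real.log 2, hC, mul_pos hc (Real.log_pos (by norm_num)), hV, hu, hu0, hVu,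
      hVb, fun x hx => (h3 x).trans ?_⟩
    gcongr C * Real.exp ?_
    have hl2 : 0 < Real.log 2 := Real.log_pos (by norm_num)
    have hl : Real.log 2 ≤ Real.log ‖x‖ := Real.log_le_log (by norm_num) hx
    have hp : 0 ≤ ‖x‖ ^ β₀ := Real.rpow_nonneg (norm_nonneg x) _
    have h4 : Real.log 2 * (‖x‖ ^ β₀ / Real.log ‖x‖) ≤ ‖x‖ ^ β₀ := by
      rw [mul_div_assoc', div_le_iff₀ (by linarith), mul_comm]
      gcongr
    nlinarith
  · intro P β₀ hP hβ hβ1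
    obtain ⟨u, C, c, hC, hc, hu, hu0, -, h2, h3⟩ :=
      exists_decaying_function lam (b := β₀ / 2) (by linarith) (by linarith)
    rw [show β₀ / 2 - 1 = -P by linarith] at h2
    rw [show 2 * (β₀ / 2) = β₀ by ring] at h3
    obtain ⟨W, hW, hWu, hWb⟩ := exists_vector_potential
      ((continuous_laplacian hu).add (continuous_const.mul hu.continuous)) hu
      (fun x => mul_nonneg hC.le (hJ (-P) x)) h2
    refine ⟨W, u, 2 * C, c, by linarith, hc, hW, hu, hu0, hWu, fun x => ?_, fun x => ?_⟩
    · rw [mul_assoc]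
      exact hWb x
    · refine (h3 x).trans ?_
      gcongr
      linarith
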